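/- **Setting.** Let $K$ be a compact matrix group with Lie algebra $\mathfrak k$, let $M\subset\mathfrak k^*$ be a coadjoint orbit of $K$, and let a torus $G$ act on $M$ through unitary matrices normalizing $K$. Let $\mathbb Z_G^*$ be the weight (character) lattice of $G$, and let the mod 2 reduction of a weight be its image in $\mathbb Z_G^*/2\mathbb Z_G^*$. Put $M^{(1)}=\{p\in M:\dim(G\cdot p)\le 1\}$. We say that $M$ is a *GKM manifold* if $M^G$ is finite and $\dim M^{(1)}\le 2$, and a *mod 2 GKM space* if, in addition, at every $p\in M^G$ the mod 2 reductions of the weights of the isotropy representation of $G$ on $T_pM$ are distinct and non-zero (the weights are determined up to order and sign, and the sign does not matter mod 2). A coadjoint orbit is *maximal* if its dimension is the largest among the coadjoint orbits of $K$. Let $\varepsilon_1,\dots,\varepsilon_n$ be the standard basis of the weight lattice $\mathbb Z^n$ of $T^n=(S^1)^n$. **Theorem.** 1. Every coadjoint orbit $M$ of $SU(n)$, with the action by conjugation of the torus $G=T^n$ of diagonal unitary matrices, is a mod 2 GKM space. Moreover, there is an anti-symplectic involution $\sigma$ of $M$ with $\sigma\circ g=g^{-1}\circ\sigma$ for $g\in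 G$ such that, with $G_{\mathbb R}=\{g\in G: g^2=1\}$, $X=M^\sigma$ and $X^{(1)}=\{x\in X:\#(G_{\mathbb R}\cdot x)\le 2\}$, one has $X^{G_{\mathbb R}}=M^G$ and $X^{(1)}=X\cap M^{(1)}$. If $n\ne 2,4$, all of this also holds with $G$ replaced by the maximal torus $\{t\in T^n: t_1\cdots t_n=1\}$ of $SU(n)$. 2. Let $K$ be $SO(2n+1)$ with $n\ge2$ (type $B_n$), $Sp(n)$ with $n\ge 2$ (type $C_n$), or $SO(2n)$ with $n\ge3$ (type $D_n$), with its standard maximal torus $T^n$. Then no maximal coadjoint orbit $M$ of $K$ is a mod 2 GKM space. In fact $M^{T^n}\neq\varnothing$, and at every $p\in M^{T^n}$ the isotropy weights can be chosen (up to sign) so that, for all $a<b$, both $\varepsilon_a-\varepsilon_b$ and $\varepsilon_a+\varepsilon_b$ occur among them; these two weights have the same mod 2 reduction. -/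

import Mathlib

open scoped Matrix

section ExpLemmas

variable {ι : Type} [Fintype ι] [DecidableEq ι]

open scoped Matrix.Norms.Operator in
theorem matrix_eq_of_exp_smul_eq {A B : Matrix ι ι ℂ}
    (h : ∀ t : ℝ, NormedSpace.exp (t • A) = NormedSpace.exp (t • B)) : A = B := by
  have hA := hasDerivAt_exp_smul_const (𝕂 := ℝ) A 0
  have hB := hasDerivAt_exp_smul_const (𝕂 := ℝ) B 0
  have hC := hB.congr_of_eventuallyEq (f₁ := fun t : ℝ => NormedSpace.exp (t • A))
    (Filter.Eventually.of_forall fun t => h t)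
  simpa using hA.unique hC

theorem matrix_exp_conj_unitary (u : Matrix.unitaryGroup ι ℂ) (X : Matrix ι ι ℂ) :
    NormedSpace.exp ((u : Matrix ι ι ℂ) * X * star (u : Matrix ι ι ℂ))
      = (u : Matrix ι ι ℂ) * NormedSpace.exp X * star (u : Matrix ι ι ℂ) := by
  have h := Matrix.exp_units_conj (Unitary.toUnits u) X
  simpa using h

theorem matrix_exp_mem_unitary {X : Matrix ι ι ℂ} (h : Xᴴ = -X) :
    NormedSpace.exp X ∈ Matrix.unitaryGroup ι ℂ := by
  rw [Matrix.mem_unitaryGroup_iff, Matrix.star_eq_conjTranspose, ← Matrix.exp_conjTranspose, h,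
    Matrix.exp_neg]
  exact Matrix.mul_nonsing_inv _ ((Matrix.isUnit_iff_isUnit_det _).mp (Matrix.isUnit_exp X))

theorem matrix_exp_smul_mem_unitary {X : Matrix ι ι ℂ} (h : Xᴴ = -X) (t : ℝ) :
    NormedSpace.exp (t • X) ∈ Matrix.unitaryGroup ι ℂ := by
  refine matrix_exp_mem_unitary ?_
  rw [Matrix.conjTranspose_smul, h]
  simp

theorem matrix_exp_inv_of_mem_unitary {X : Matrix ι ι ℂ}
    (h : NormedSpace.exp X ∈ Matrix.unitaryGroup ι ℂ) :
    star (NormedSpace.exp X) = NormedSpace.exp (-X) := by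
  rw [Matrix.exp_neg]
  exact (Matrix.inv_eq_left_inv ((Matrix.mem_unitaryGroup_iff').mp h)).symm

theorem matrix_skew_of_exp_mem_unitary {X : Matrix ι ι ℂ}
    (h : ∀ t : ℝ, NormedSpace.exp (t • X) ∈ Matrix.unitaryGroup ι ℂ) : Xᴴ = -X := by
  refine matrix_eq_of_exp_smul_eq fun t => ?_
  have := matrix_exp_inv_of_mem_unitary (h t)
  rw [Matrix.star_eq_conjTranspose, ← Matrix.exp_conjTranspose, Matrix.conjTranspose_smul] at this
  simpa using this

theorem matrix_exp_map_conj (X : Matrix ι ι ℂ) :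
    (NormedSpace.exp X).map (starRingEnd ℂ) = NormedSpace.exp (X.map (starRingEnd ℂ)) := by
  have h : ∀ Y : Matrix ι ι ℂ, Y.map (starRingEnd ℂ) = Yᴴᵀ := fun Y => by
    ext i j; simp [Matrix.conjTranspose_apply]
  rw [h, h, Matrix.exp_transpose, Matrix.exp_conjTranspose]

/-- `det (exp X) = exp (tr X)` for a skew-Hermitian matrix `X`. -/
theorem matrix_det_exp_skew {X : Matrix ι ι ℂ} (h : Xᴴ = -X) :
    (NormedSpace.exp X).det = Complex.exp X.trace := by
  have hH : (Complex.I • X).IsHermitian := by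
    rw [Matrix.IsHermitian, Matrix.conjTranspose_smul, h]; simp
  have hX : X = (-Complex.I) • (Complex.I • X) := by
    rw [smul_smul]; simp
  set U := hH.eigenvectorUnitary
  set D : ι → ℂ := fun i => -Complex.I * (hH.eigenvalues i : ℂ) with hD
  have hdiag : X = (U : Matrix ι ι ℂ) * Matrix.diagonal D * star (U : Matrix ι ι ℂ) := by
    conv_lhs => rw [hX, hH.spectral_theorem, Unitary.conjStarAlgAut_apply]
    have : Matrix.diagonal D = (-Complex.I) •
        Matrix.diagonal (RCLike.ofReal ∘ hH.eigenvalues : ι → ℂ) := by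
      rw [← Matrix.diagonal_smul]; rfl
    rw [this]
    simp [U]
  have hU : star (U : Matrix ι ι ℂ) * (U : Matrix ι ι ℂ) = 1 :=
    (Matrix.mem_unitaryGroup_iff').mp U.2
  have h1 : ∀ Y : Matrix ι ι ℂ, ((U : Matrix ι ι ℂ) * Y * star (U : Matrix ι ι ℂ)).det = Y.det := by
    intro Y
    rw [Matrix.det_mul_comm, ← mul_assoc, hU, one_mul]
  have h2 : ((U : Matrix ι ι ℂ) * Matrix.diagonal D * star (U : Matrix ι ι ℂ)).trace
      = ∑ i, D i := by
    rw [Matrix.trace_mul_comm, ← mul_assoc, hU, one_mul, Matrix.trace_diagonal]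
  rw [hdiag, matrix_exp_conj_unitary, h1, h2, Matrix.exp_diagonal, Matrix.det_diagonal,
    Complex.exp_sum]
  refine Finset.prod_congr rfl fun i _ => ?_
  rw [Complex.exp_eq_exp_ℂ, Pi.coe_exp]

theorem eq_zero_of_exp_smul_eq_one {c : ℂ} (h : ∀ t : ℝ, Complex.exp (t • c) = 1) : c = 0 := by
  have hA := hasDerivAt_exp_smul_const (𝕂 := ℝ) c 0
  have : (fun t : ℝ => NormedSpace.exp (t • c)) = fun _ : ℝ => (1 : ℂ) := by
    funext t; rw [← Complex.exp_eq_exp_ℂ]; exact h t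
  rw [this] at hA
  simpa using hA.unique (hasDerivAt_const (0:ℝ) (1:ℂ))

end ExpLemmas

attribute [local instance] LieRing.ofAssociativeRing

/-- A closed subgroup `grp` of the unitary group `U(ι)`, together with its Lie algebra
`lie = {X | exp (tX) ∈ grp for all real t}`. -/
structure CompactMatrixGroup (ι : Type) [Fintype ι] [DecidableEq ι] where
  grp : Subgroup (Matrix.unitaryGroup ι ℂ)
  isClosed : IsClosed (grp : Set (Matrix.unitaryGroup ι ℂ))
  lie : LieSubalgebra ℝ (Matrix ι ι ℂ)
  mem_lie : ∀ X : Matrix ι ι ℂ, X ∈ lie ↔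
    ∀ t : ℝ, ∃ u ∈ grp, (u : Matrix ι ι ℂ) = NormedSpace.exp (t • X)

namespace CompactMatrixGroup

variable {ι : Type} [Fintype ι] [DecidableEq ι] (K : CompactMatrixGroup ι)

/-- The real dual `𝔨^*` of the Lie algebra. -/
abbrev Dual : Type := Module.Dual ℝ K.lie

/-- The unitary matrices normalising `K`; they act on `K`, on `𝔨` and on `𝔨^*`. -/
abbrev Normalizer : Subgroup (Matrix.unitaryGroup ι ℂ) :=
  Subgroup.normalizer (K.grp : Set (Matrix.unitaryGroup ι ℂ))

theorem conj_mem_lie (u : K.Normalizer) {X : Matrix ι ι ℂ} (hX : X ∈ K.lie) :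
    (u.1 : Matrix ι ι ℂ) * X * star (u.1 : Matrix ι ι ℂ) ∈ K.lie := by
  rw [K.mem_lie] at hX ⊢
  intro t
  obtain ⟨v, hv, hvX⟩ := hX t
  refine ⟨u.1 * v * u.1⁻¹, (Subgroup.mem_normalizer_iff.mp u.2 v).mp hv, ?_⟩
  have h : t • ((u.1 : Matrix ι ι ℂ) * X * star (u.1 : Matrix ι ι ℂ))
      = (u.1 : Matrix ι ι ℂ) * (t • X) * star (u.1 : Matrix ι ι ℂ) := by
    simp
  rw [h, matrix_exp_conj_unitary, ← hvX]
  rfl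

/-- The adjoint action `Ad u X = u X u⁻¹`. -/
noncomputable def Ad (u : K.Normalizer) : K.lie →ₗ[ℝ] K.lie where
  toFun X := ⟨(u.1 : Matrix ι ι ℂ) * X.1 * star (u.1 : Matrix ι ι ℂ), K.conj_mem_lie u X.2⟩
  map_add' X Y := by
    apply Subtype.ext
    simp [mul_add, add_mul]
  map_smul' c X := by
    apply Subtype.ext
    simp

/-- The coadjoint action `(Ad^*_u ξ)(X) = ξ (Ad_{u⁻¹} X)`. -/
noncomputable def coAd (u : K.Normalizer) : K.Dual →ₗ[ℝ] K.Dual := (K.Ad u⁻¹).dualMap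

/-- The coadjoint orbit of `K` through `ξ`. -/
def coadjointOrbit (ξ : K.Dual) : Set K.Dual :=
  {η | ∃ (k : Matrix.unitaryGroup ι ℂ) (hk : k ∈ K.grp),
    η = K.coAd ⟨k, Subgroup.le_normalizer hk⟩ ξ}

/-- The infinitesimal coadjoint action `X ↦ ad^*_X ξ`, `(ad^*_X ξ)(Y) = -ξ ([X, Y])`. -/
noncomputable def infCoAd (ξ : K.Dual) : K.lie →ₗ[ℝ] K.Dual where
  toFun X := -(ξ ∘ₗ (LieAlgebra.ad ℝ K.lie X : K.lie →ₗ[ℝ] K.lie))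
  map_add' X Y := by
    ext Z
    simp [add_comm]
  map_smul' c X := by
    ext Z
    simp

/-- The tangent space at `p` of the coadjoint orbit through `p`, as a subspace of `𝔨^*`. -/
noncomputable def tangent (p : K.Dual) : Submodule ℝ K.Dual := LinearMap.range (K.infCoAd p)

/-- The orbit through `ξ` has the largest dimension among all coadjoint orbits of `K`. -/
def IsMaximalOrbit (ξ : K.Dual) : Prop :=
  ∀ η : K.Dual, Module.finrank ℝ (K.tangent η) ≤ Module.finrank ℝ (K.tangent ξ)

end CompactMatrixGroup

/-- The (Hausdorff) dimension of a subset of a finite-dimensional real vector space, computed in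
linear coordinates; the choice of coordinates is irrelevant.  For embedded submanifolds and finite
unions of them it is the usual dimension. -/
noncomputable def linDim {V : Type} [AddCommGroup V] [Module ℝ V] [Module.Finite ℝ V]
    (S : Set V) : ENNReal :=
  dimH ((Module.finBasis ℝ V).equivFun '' S)

/-- The reduction mod `2` of a weight.  The weight lattice of a torus `G` is the group of continuous
characters of `G`, written multiplicatively. -/
noncomputable def mod2 {G : Type} [CommGroup G] [TopologicalSpace G] (χ : PontryaginDual G) :
    PontryaginDual G ⧸ (powMonoidHom 2 : PontryaginDual G →* PontryaginDual G).range :=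
  QuotientGroup.mk χ

namespace CompactMatrixGroup

variable {ι : Type} [Fintype ι] [DecidableEq ι] {K : CompactMatrixGroup ι}
variable {G : Type} [CommGroup G] [TopologicalSpace G]

/-!  In this section a torus `G` acts on `𝔨^*` and on the coadjoint orbits through a homomorphism
`ρ` to the unitary matrices normalising `K`; `M` is a coadjoint orbit. -/

/-- The fixed point set `M^G`. -/
def fixedPts (ρ : G →* K.Normalizer) (M : Set K.Dual) : Set K.Dual :=
  {p ∈ M | ∀ g : G, K.coAd (ρ g) p = p}

/-- The orbit `G · p`. -/
def torusOrbit (ρ : G →* K.Normalizer) (p : K.Dual) : Set K.Dual :=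
  Set.range fun g : G => K.coAd (ρ g) p

/-- The one-skeleton `M^(1) = {p ∈ M | dim (G · p) ≤ 1}`. -/
def oneSkeleton (ρ : G →* K.Normalizer) (M : Set K.Dual) : Set K.Dual :=
  {p ∈ M | linDim (torusOrbit ρ p) ≤ 1}

/-- GKM manifold: finitely many fixed points and a one-skeleton of dimension at most `2`. -/
def IsGKM (ρ : G →* K.Normalizer) (M : Set K.Dual) : Prop :=
  (fixedPts ρ M).Finite ∧ linDim (oneSkeleton ρ M) ≤ 2

/-- The characters `α 0, …, α (d-1)` are the weights of the isotropy representation of `G` at the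
fixed point `p` of the coadjoint orbit through `p`: as a real representation of `G`, the tangent
space is isomorphic to `ℂ_{α 0} ⊕ … ⊕ ℂ_{α (d-1)}`.  This determines the weights up to order and
signs, and the signs do not matter mod `2`. -/
def IsIsotropyWeights (ρ : G →* K.Normalizer) (p : K.Dual) {d : ℕ}
    (α : Fin d → PontryaginDual G) : Prop :=
  ∃ Ψ : (Fin d → ℂ) →ₗ[ℝ] K.Dual, Function.Injective Ψ ∧ LinearMap.range Ψ = K.tangent p ∧
    ∀ (g : G) (z : Fin d → ℂ), K.coAd (ρ g) (Ψ z) = Ψ fun i => ((α i g : Circle) : ℂ) * z i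

/-- Mod 2 GKM manifold: a GKM manifold such that at each fixed point the mod 2 reductions of the
isotropy weights are distinct and non-zero. -/
def IsMod2GKM (ρ : G →* K.Normalizer) (M : Set K.Dual) : Prop :=
  IsGKM ρ M ∧ ∀ p ∈ fixedPts ρ M, ∃ (d : ℕ) (α : Fin d → PontryaginDual G),
    IsIsotropyWeights ρ p α ∧ Function.Injective (fun i => mod2 (α i)) ∧ ∀ i, mod2 (α i) ≠ 1

/-- `σ` restricts to an involution of the coadjoint orbit `M` with `σ ∘ g = g⁻¹ ∘ σ` for `g ∈ G`
which is anti-symplectic for the Kirillov-Kostant-Souriau form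
`ω_p (ad^*_X p, ad^*_Y p) = p ([X, Y])`. -/
structure IsAntisymplecticInvolution (ρ : G →* K.Normalizer) (M : Set K.Dual)
    (σ : K.Dual →ₗ[ℝ] K.Dual) : Prop where
  mapsTo : Set.MapsTo σ M M
  involutive : ∀ p ∈ M, σ (σ p) = p
  anti_equivariant : ∀ (g : G), ∀ p ∈ M, σ (K.coAd (ρ g) p) = K.coAd (ρ g⁻¹) (σ p)
  antisymplectic : ∀ p ∈ M, ∀ X Y X' Y' : K.lie,
    σ (K.infCoAd p X) = K.infCoAd (σ p) X' → σ (K.infCoAd p Y) = K.infCoAd (σ p) Y' →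
      (σ p) ⁅X', Y'⁆ = -(p ⁅X, Y⁆)

/-- There is an anti-symplectic involution `σ` whose real locus `X = M^σ` satisfies
`X^{G_ℝ} = M^G` and `X^(1) = X ∩ M^(1)`, where `G_ℝ = {g ∈ G | g² = 1}` and
`X^(1) = {x ∈ X | #(G_ℝ · x) ≤ 2}`. -/
def HasRealGKMLocus (ρ : G →* K.Normalizer) (M : Set K.Dual) : Prop :=
  ∃ σ : K.Dual →ₗ[ℝ] K.Dual, IsAntisymplecticInvolution ρ M σ ∧
    {x ∈ M | σ x = x ∧ ∀ g : G, g ^ 2 = 1 → K.coAd (ρ g) x = x} = fixedPts ρ M ∧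
    {x ∈ M | σ x = x ∧ ((fun g : G => K.coAd (ρ g) x) '' {g | g ^ 2 = 1}).encard ≤ 2}
      = {x ∈ M | σ x = x} ∩ oneSkeleton ρ M

end CompactMatrixGroup

/-- The weight `ε_i` of the torus `T^n = (S^1)^n`. -/
noncomputable def torusEps {n : ℕ} (i : Fin n) : PontryaginDual (Fin n → Circle) :=
  ({ toFun := fun t => t i
     map_one' := rfl
     map_mul' := fun _ _ => rfl
     continuous_toFun := continuous_apply i } : (Fin n → Circle) →ₜ* Circle)

/-- The action of `T^n` on `M` has a fixed point, and at each fixed point both `ε_a - ε_b` and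
`ε_a + ε_b` occur among the isotropy weights, for all `a < b`, and have the same reduction
mod `2`. -/
def CompactMatrixGroup.HasCongruentWeights {ι : Type} [Fintype ι] [DecidableEq ι]
    {K : CompactMatrixGroup ι} {n : ℕ} (ρ : (Fin n → Circle) →* K.Normalizer)
    (M : Set K.Dual) : Prop :=
  (CompactMatrixGroup.fixedPts ρ M).Nonempty ∧
    ∀ p ∈ CompactMatrixGroup.fixedPts ρ M,
      ∃ (d : ℕ) (α : Fin d → PontryaginDual (Fin n → Circle)),
        CompactMatrixGroup.IsIsotropyWeights ρ p α ∧
        ∀ a b : Fin n, a < b →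
          (∃ k, α k = torusEps a / torusEps b) ∧ (∃ l, α l = torusEps a * torusEps b) ∧
            mod2 (torusEps a / torusEps b) = mod2 (torusEps a * torusEps b)

/-! ### The classical groups -/

section Classical

variable (ι : Type) [Fintype ι] [DecidableEq ι]

/-- The skew-Hermitian matrices. -/
def skewHermitianLie : LieSubalgebra ℝ (Matrix ι ι ℂ) where
  carrier := {X | Xᴴ = -X}
  add_mem' {X Y} hX hY := by
    simp only [Set.mem_ofPred_eq] at *
    rw [Matrix.conjTranspose_add, hX, hY, neg_add]
  zero_mem' := by simp
  smul_mem' c X hX := by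
    simp only [Set.mem_ofPred_eq] at *
    rw [Matrix.conjTranspose_smul, hX]; simp
  lie_mem' {X Y} hX hY := by
    simp only [Set.mem_ofPred_eq] at *
    rw [Ring.lie_def, Matrix.conjTranspose_sub, Matrix.conjTranspose_mul, Matrix.conjTranspose_mul,
      hX, hY]
    noncomm_ring

/-- `SU(ι)`, with Lie algebra the traceless skew-Hermitian matrices. -/
noncomputable def groupSU : CompactMatrixGroup ι where
  grp :=
    { carrier := {u | (u : Matrix ι ι ℂ).det = 1}
      mul_mem' := by
        intro u v hu hv
        simp only [Set.mem_ofPred_eq] at *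
        simp [hu, hv]
      one_mem' := by simp
      inv_mem' := by
        intro u hu
        simp only [Set.mem_ofPred_eq] at *
        change (star (u : Matrix ι ι ℂ)).det = 1
        rw [Matrix.star_eq_conjTranspose, Matrix.det_conjTranspose, hu, star_one] }
  isClosed := isClosed_eq (Continuous.matrix_det continuous_subtype_val) continuous_const
  lie :=
    { skewHermitianLie ι with
      carrier := {X | Xᴴ = -X ∧ X.trace = 0}
      add_mem' := fun {X Y} hX hY =>
        ⟨(skewHermitianLie ι).add_mem hX.1 hY.1, by rw [Matrix.trace_add, hX.2, hY.2, add_zero]⟩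
      zero_mem' := by simp
      smul_mem' := fun c X hX =>
        ⟨(skewHermitianLie ι).smul_mem c hX.1, by rw [Matrix.trace_smul, hX.2, smul_zero]⟩
      lie_mem' := fun {X Y} hX hY =>
        ⟨(skewHermitianLie ι).lie_mem hX.1 hY.1, by
          rw [Ring.lie_def, Matrix.trace_sub, Matrix.trace_mul_comm, sub_self]⟩ }
  mem_lie X := by
    constructor
    · rintro ⟨h, h0⟩ t
      refine ⟨⟨_, matrix_exp_smul_mem_unitary h t⟩, ?_, rfl⟩
      change (NormedSpace.exp (t • X)).det = 1
      rw [matrix_det_exp_skew ((skewHermitianLie ι).smul_mem t h), Matrix.trace_smul, h0]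
      simp
    · intro h
      have h1 : Xᴴ = -X := matrix_skew_of_exp_mem_unitary fun t => by
        obtain ⟨u, -, hu⟩ := h t
        exact hu ▸ u.2
      refine ⟨h1, eq_zero_of_exp_smul_eq_one fun t => ?_⟩
      obtain ⟨u, hu, huX⟩ := h t
      have hu' : (u : Matrix ι ι ℂ).det = 1 := hu
      rw [huX, matrix_det_exp_skew ((skewHermitianLie ι).smul_mem t h1), Matrix.trace_smul] at hu'
      exact hu'

/-- `SO(ι)`, the unitary matrices with real entries and determinant `1`, with Lie algebra the
skew-symmetric matrices with real entries. -/
noncomputable def groupSO : CompactMatrixGroup ι where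
  grp :=
    { carrier := {u | (u : Matrix ι ι ℂ).map (starRingEnd ℂ) = u ∧ (u : Matrix ι ι ℂ).det = 1}
      mul_mem' := by
        rintro u v ⟨hu, hu'⟩ ⟨hv, hv'⟩
        refine ⟨?_, by simp [hu', hv']⟩
        change ((u : Matrix ι ι ℂ) * (v : Matrix ι ι ℂ)).map (starRingEnd ℂ) = u * v
        rw [Matrix.map_mul, hu, hv]
      one_mem' := by
        refine ⟨?_, by simp⟩
        change (1 : Matrix ι ι ℂ).map (starRingEnd ℂ) = 1
        simp
      inv_mem' := by
        rintro u ⟨hu, hu'⟩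
        refine ⟨?_, ?_⟩
        · change (star (u : Matrix ι ι ℂ)).map (starRingEnd ℂ) = star (u : Matrix ι ι ℂ)
          nth_rewrite 2 [← hu]
          ext i j
          simp [Matrix.star_apply]
        · change (star (u : Matrix ι ι ℂ)).det = 1
          rw [Matrix.star_eq_conjTranspose, Matrix.det_conjTranspose, hu', star_one] }
  isClosed := (isClosed_eq
      (Continuous.matrix_map continuous_subtype_val Complex.continuous_conj)
      continuous_subtype_val).inter
    (isClosed_eq (Continuous.matrix_det continuous_subtype_val) continuous_const)
  lie :=
    { skewHermitianLie ι with
      carrier := {X | Xᴴ = -X ∧ X.map (starRingEnd ℂ) = X}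
      add_mem' := fun {X Y} hX hY =>
        ⟨(skewHermitianLie ι).add_mem hX.1 hY.1, by
          rw [Matrix.map_add _ (map_add _), hX.2, hY.2]⟩
      zero_mem' := by simp
      smul_mem' := fun c X hX =>
        ⟨(skewHermitianLie ι).smul_mem c hX.1, by
          nth_rewrite 2 [← hX.2]
          ext i j
          simp⟩
      lie_mem' := fun {X Y} hX hY =>
        ⟨(skewHermitianLie ι).lie_mem hX.1 hY.1, by
          rw [Ring.lie_def, Matrix.map_sub _ (map_sub _), Matrix.map_mul, Matrix.map_mul,
            hX.2, hY.2]⟩ }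
  mem_lie X := by
    have hconj : ∀ (t : ℝ), (t • X).map (starRingEnd ℂ) = t • X.map (starRingEnd ℂ) := by
      intro t; ext i j; simp
    constructor
    · rintro ⟨h, h0⟩ t
      refine ⟨⟨_, matrix_exp_smul_mem_unitary h t⟩, ⟨?_, ?_⟩, rfl⟩
      · change (NormedSpace.exp (t • X)).map (starRingEnd ℂ) = NormedSpace.exp (t • X)
        rw [matrix_exp_map_conj, hconj, h0]
      · change (NormedSpace.exp (t • X)).det = 1
        have hT : Xᵀ = -X := by
          rw [← h]
          nth_rewrite 1 [← h0]
          ext i j; simp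
        have h2 : X.trace = 0 := by
          have := Matrix.trace_transpose X
          rw [hT, Matrix.trace_neg] at this
          exact self_eq_neg.mp this.symm
        rw [matrix_det_exp_skew ((skewHermitianLie ι).smul_mem t h), Matrix.trace_smul, h2]
        simp
    · intro h
      refine ⟨matrix_skew_of_exp_mem_unitary fun t => ?_, matrix_eq_of_exp_smul_eq fun t => ?_⟩
      · obtain ⟨u, -, hu⟩ := h t
        exact hu ▸ u.2
      · obtain ⟨u, ⟨hu, -⟩, huX⟩ := h t
        rw [← hconj, ← matrix_exp_map_conj, ← huX]
        exact hu

/-- The compact symplectic group `Sp(n) = U(2n) ∩ Sp(2n, ℂ)`, where `ι` has `n` elements. -/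
noncomputable def groupSp : CompactMatrixGroup (ι ⊕ ι) where
  grp :=
    { carrier := {u | (u : Matrix (ι ⊕ ι) (ι ⊕ ι) ℂ) ∈ Matrix.symplecticGroup ι ℂ}
      mul_mem' := fun {u v} hu hv => (Matrix.symplecticGroup ι ℂ).mul_mem hu hv
      one_mem' := one_mem (Matrix.symplecticGroup ι ℂ)
      inv_mem' := by
        intro u hu
        have h1 := (Matrix.mem_unitaryGroup_iff').mp u.2
        have h2 := (Matrix.mem_unitaryGroup_iff).mp u.2
        have hu' := SymplecticGroup.mem_iff.mp hu
        change star (u : Matrix (ι ⊕ ι) (ι ⊕ ι) ℂ) ∈ Matrix.symplecticGroup ι ℂ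
        rw [SymplecticGroup.mem_iff]
        have h3 : (u : Matrix (ι ⊕ ι) (ι ⊕ ι) ℂ)ᵀ * (star (u : Matrix (ι ⊕ ι) (ι ⊕ ι) ℂ))ᵀ = 1 := by
          rw [← Matrix.transpose_mul, h1, Matrix.transpose_one]
        calc star (u : Matrix (ι ⊕ ι) (ι ⊕ ι) ℂ) * Matrix.J ι ℂ * (star (u : Matrix (ι ⊕ ι) (ι ⊕ ι) ℂ))ᵀ
            = star (u : Matrix (ι ⊕ ι) (ι ⊕ ι) ℂ) * ((u : Matrix (ι ⊕ ι) (ι ⊕ ι) ℂ) * Matrix.J ι ℂ *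
                (u : Matrix (ι ⊕ ι) (ι ⊕ ι) ℂ)ᵀ) * (star (u : Matrix (ι ⊕ ι) (ι ⊕ ι) ℂ))ᵀ := by rw [hu']
          _ = (star (u : Matrix (ι ⊕ ι) (ι ⊕ ι) ℂ) * (u : Matrix (ι ⊕ ι) (ι ⊕ ι) ℂ)) * Matrix.J ι ℂ *
                ((u : Matrix (ι ⊕ ι) (ι ⊕ ι) ℂ)ᵀ * (star (u : Matrix (ι ⊕ ι) (ι ⊕ ι) ℂ))ᵀ) := by
              simp only [mul_assoc]
          _ = Matrix.J ι ℂ := by rw [h1, h3, one_mul, mul_one] }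
  isClosed := by
    have : IsClosed {u : Matrix.unitaryGroup (ι ⊕ ι) ℂ |
        (u : Matrix (ι ⊕ ι) (ι ⊕ ι) ℂ) * Matrix.J ι ℂ * (u : Matrix (ι ⊕ ι) (ι ⊕ ι) ℂ)ᵀ
          = Matrix.J ι ℂ} :=
      isClosed_eq (by fun_prop) continuous_const
    exact this
  lie :=
    { skewHermitianLie (ι ⊕ ι) with
      carrier := {X | Xᴴ = -X ∧ X * Matrix.J ι ℂ + Matrix.J ι ℂ * Xᵀ = 0}
      add_mem' := fun {X Y} hX hY =>
        ⟨(skewHermitianLie (ι ⊕ ι)).add_mem hX.1 hY.1, by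
          rw [Matrix.transpose_add, add_mul, mul_add, add_add_add_comm, hX.2, hY.2, add_zero]⟩
      zero_mem' := by simp
      smul_mem' := fun c X hX =>
        ⟨(skewHermitianLie (ι ⊕ ι)).smul_mem c hX.1, by
          rw [Matrix.transpose_smul, smul_mul_assoc, mul_smul_comm, ← smul_add, hX.2, smul_zero]⟩
      lie_mem' := fun {X Y} hX hY =>
        ⟨(skewHermitianLie (ι ⊕ ι)).lie_mem hX.1 hY.1, by
          have h1 := eq_neg_of_add_eq_zero_right hX.2
          have h2 := eq_neg_of_add_eq_zero_right hY.2
          rw [Ring.lie_def, Matrix.transpose_sub, Matrix.transpose_mul, Matrix.transpose_mul,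
            mul_sub, ← mul_assoc, ← mul_assoc, h1, h2, neg_mul, neg_mul, mul_assoc X, mul_assoc Y,
            h1, h2]
          noncomm_ring⟩ }
  mem_lie X := by
    have key : ∀ Y : Matrix (ι ⊕ ι) (ι ⊕ ι) ℂ,
        Matrix.J ι ℂ * NormedSpace.exp Y * (-Matrix.J ι ℂ)
          = NormedSpace.exp (Matrix.J ι ℂ * Y * (-Matrix.J ι ℂ)) := by
      intro Y
      have hJ : Matrix.J ι ℂ * (-Matrix.J ι ℂ) = 1 := by
        rw [mul_neg, Matrix.J_squared, neg_neg]
      have hJ' : (-Matrix.J ι ℂ) * Matrix.J ι ℂ = 1 := by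
        rw [neg_mul, Matrix.J_squared, neg_neg]
      exact (Matrix.exp_units_conj ⟨Matrix.J ι ℂ, -Matrix.J ι ℂ, hJ, hJ'⟩ Y).symm
    have hJ : Matrix.J ι ℂ * Matrix.J ι ℂ = -1 := Matrix.J_squared ι ℂ
    have key2 : ∀ t : ℝ, NormedSpace.exp (t • X) ∈ Matrix.symplecticGroup ι ℂ ↔
        NormedSpace.exp (t • (Matrix.J ι ℂ * Xᵀ * (-Matrix.J ι ℂ))) = NormedSpace.exp (t • (-X)) := by
      intro t
      have h1 : t • (Matrix.J ι ℂ * Xᵀ * (-Matrix.J ι ℂ))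
          = Matrix.J ι ℂ * (t • X)ᵀ * (-Matrix.J ι ℂ) := by
        rw [Matrix.transpose_smul, mul_smul_comm, smul_mul_assoc]
      have hI : NormedSpace.exp (t • X) * NormedSpace.exp (-(t • X)) = 1 := by
        rw [Matrix.exp_neg]
        exact Matrix.mul_nonsing_inv _ ((Matrix.isUnit_iff_isUnit_det _).mp (Matrix.isUnit_exp _))
      have hI' : NormedSpace.exp (-(t • X)) * NormedSpace.exp (t • X) = 1 := by
        rw [Matrix.exp_neg]
        exact Matrix.nonsing_inv_mul _ ((Matrix.isUnit_iff_isUnit_det _).mp (Matrix.isUnit_exp _))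
      rw [SymplecticGroup.mem_iff, h1, ← key, Matrix.exp_transpose, smul_neg]
      constructor
      · intro h
        calc Matrix.J ι ℂ * (NormedSpace.exp (t • X))ᵀ * (-Matrix.J ι ℂ)
            = (NormedSpace.exp (-(t • X)) * NormedSpace.exp (t • X)) *
              Matrix.J ι ℂ * (NormedSpace.exp (t • X))ᵀ * (-Matrix.J ι ℂ) := by rw [hI', one_mul]
          _ = NormedSpace.exp (-(t • X)) * (NormedSpace.exp (t • X) *
              Matrix.J ι ℂ * (NormedSpace.exp (t • X))ᵀ) * (-Matrix.J ι ℂ) := by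
              simp only [mul_assoc]
          _ = NormedSpace.exp (-(t • X)) := by
              rw [h, mul_assoc, mul_neg, hJ, neg_neg, mul_one]
      · intro h
        have h2 : Matrix.J ι ℂ * (NormedSpace.exp (t • X))ᵀ
            = NormedSpace.exp (-(t • X)) * Matrix.J ι ℂ := by
          rw [← h, mul_assoc, neg_mul, hJ, neg_neg, mul_one]
        rw [mul_assoc, h2, ← mul_assoc, hI, one_mul]
    have key3 : X * Matrix.J ι ℂ + Matrix.J ι ℂ * Xᵀ = 0 ↔
        Matrix.J ι ℂ * Xᵀ * (-Matrix.J ι ℂ) = -X := by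
      constructor
      · intro h
        rw [eq_neg_of_add_eq_zero_right h, neg_mul_neg, mul_assoc, hJ, mul_neg, mul_one]
      · intro h
        have h2 : Matrix.J ι ℂ * Xᵀ = -X * Matrix.J ι ℂ := by
          rw [← h, mul_assoc, neg_mul, hJ, neg_neg, mul_one]
        rw [h2, neg_mul, add_neg_cancel]
    constructor
    · rintro ⟨h, h0⟩ t
      refine ⟨⟨_, matrix_exp_smul_mem_unitary h t⟩, ?_, rfl⟩
      exact (key2 t).mpr (by rw [key3.mp h0])
    · intro h
      refine ⟨matrix_skew_of_exp_mem_unitary fun t => ?_,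
        key3.mpr (matrix_eq_of_exp_smul_eq fun t => (key2 t).mp ?_)⟩
      · obtain ⟨u, -, hu⟩ := h t
        exact hu ▸ u.2
      · obtain ⟨u, hu, huX⟩ := h t
        exact huX ▸ hu

end Classical

/-! ### The tori -/

theorem mem_normalizer_groupSU {ι : Type} [Fintype ι] [DecidableEq ι]
    (u : Matrix.unitaryGroup ι ℂ) : u ∈ (groupSU ι).Normalizer := by
  rw [Subgroup.mem_normalizer_iff]
  intro v
  have h1 := congrArg Matrix.det ((Matrix.mem_unitaryGroup_iff').mp u.2)
  rw [Matrix.det_mul, Matrix.det_one] at h1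
  have h : ((u * v * u⁻¹ : Matrix.unitaryGroup ι ℂ) : Matrix ι ι ℂ).det
      = (v : Matrix ι ι ℂ).det := by
    change ((u : Matrix ι ι ℂ) * v * star (u : Matrix ι ι ℂ)).det = _
    rw [Matrix.det_mul, Matrix.det_mul, mul_comm, ← mul_assoc, h1, one_mul]
  change (v : Matrix ι ι ℂ).det = 1 ↔ ((u * v * u⁻¹ : Matrix.unitaryGroup ι ℂ) :
    Matrix ι ι ℂ).det = 1
  rw [h]

/-- The torus `T^n` of diagonal unitary matrices, acting on `SU(n)` by conjugation. -/
noncomputable def torusU (n : ℕ) : (Fin n → Circle) →* (groupSU (Fin n)).Normalizer where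
  toFun t := ⟨⟨Matrix.diagonal fun i => (t i : ℂ), by
      rw [Matrix.mem_unitaryGroup_iff, Matrix.star_eq_conjTranspose, Matrix.diagonal_conjTranspose,
        Matrix.diagonal_mul_diagonal, ← Matrix.diagonal_one]
      congr 1
      funext i
      simp [Complex.mul_conj]⟩, by
      exact mem_normalizer_groupSU _⟩
  map_one' := by
    apply Subtype.ext
    apply Subtype.ext
    simp
  map_mul' s t := by
    apply Subtype.ext
    apply Subtype.ext
    simp [Matrix.diagonal_mul_diagonal]

/-- The maximal torus `{t ∈ T^n | t_1 ⋯ t_n = 1}` of `SU(n)`. -/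
def specialTorus (n : ℕ) : Subgroup (Fin n → Circle) where
  carrier := {t | ∏ i, t i = 1}
  mul_mem' := by
    intro s t hs ht
    simp only [Set.mem_ofPred_eq] at *
    simp [Finset.prod_mul_distrib, hs, ht]
  one_mem' := by simp
  inv_mem' := by
    intro s hs
    simp only [Set.mem_ofPred_eq] at *
    simp [hs]

/-- The maximal torus of `SU(n)`, acting by conjugation. -/
noncomputable def torusSU (n : ℕ) : specialTorus n →* (groupSU (Fin n)).Normalizer :=
  (torusU n).comp (specialTorus n).subtype

/-- The block matrix of the rotations by `t_1, …, t_n` in the coordinate planes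
`(inl i, inr i)`. -/
noncomputable def rotationMatrix {n : ℕ} (t : Fin n → Circle) :
    Matrix (Fin n ⊕ Fin n) (Fin n ⊕ Fin n) ℂ :=
  Matrix.fromBlocks
    (Matrix.diagonal fun i => (((t i : ℂ).re : ℝ) : ℂ))
    (Matrix.diagonal fun i => -(((t i : ℂ).im : ℝ) : ℂ))
    (Matrix.diagonal fun i => (((t i : ℂ).im : ℝ) : ℂ))
    (Matrix.diagonal fun i => (((t i : ℂ).re : ℝ) : ℂ))

theorem rotationMatrix_mul {n : ℕ} (s t : Fin n → Circle) :
    rotationMatrix (s * t) = rotationMatrix s * rotationMatrix t := by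
  simp only [rotationMatrix, Matrix.fromBlocks_multiply, Matrix.diagonal_mul_diagonal,
    Matrix.diagonal_add]
  congr 1 <;> congr 1 <;> funext i <;>
    simp [Complex.mul_re, Complex.mul_im] <;> ring

theorem rotationMatrix_one {n : ℕ} : rotationMatrix (1 : Fin n → Circle) = 1 := by
  simp [rotationMatrix]

theorem rotationMatrix_star {n : ℕ} (t : Fin n → Circle) :
    star (rotationMatrix t) = rotationMatrix t⁻¹ := by
  simp only [rotationMatrix, Matrix.star_eq_conjTranspose, Matrix.fromBlocks_conjTranspose,
    Matrix.diagonal_conjTranspose]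
  congr 1 <;> congr 1 <;> funext i <;> simp

theorem rotationMatrix_map_conj {n : ℕ} (t : Fin n → Circle) :
    (rotationMatrix t).map (starRingEnd ℂ) = rotationMatrix t := by
  simp only [rotationMatrix, Matrix.fromBlocks_map]
  congr 1 <;> rw [Matrix.diagonal_map (by simp)] <;> congr 1 <;> funext i <;> simp

theorem rotationMatrix_det {n : ℕ} (t : Fin n → Circle) : (rotationMatrix t).det = 1 := by
  have hs : ∀ z : Circle, ∃ w : Circle, w * w = z := fun z =>
    ⟨Circle.exp (Complex.arg z / 2), by rw [← Circle.exp_add, add_halves, Circle.exp_arg]⟩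
  choose r hr using hs
  set s : Fin n → Circle := fun i => r (t i)
  have ht : t = s * s := funext fun i => (hr (t i)).symm
  have h1 : (rotationMatrix s).det * (rotationMatrix s).det = 1 := by
    have h2 : star (rotationMatrix s).det = (rotationMatrix s).det := by
      conv_rhs => rw [← rotationMatrix_map_conj]
      exact (RingHom.map_det (starRingEnd ℂ) (rotationMatrix s))
    have h3 : (rotationMatrix s⁻¹).det = (rotationMatrix s).det := by
      rw [← rotationMatrix_star, Matrix.star_eq_conjTranspose, Matrix.det_conjTranspose, h2]
    nth_rewrite 2 [← h3]
    rw [← Matrix.det_mul, ← rotationMatrix_mul, mul_inv_cancel, rotationMatrix_one, Matrix.det_one]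
  rw [ht, rotationMatrix_mul, Matrix.det_mul, h1]

/-- The maximal torus of `SO(2n)`: rotations in `n` orthogonal planes. -/
noncomputable def torusSOEven (n : ℕ) :
    (Fin n → Circle) →* (groupSO (Fin n ⊕ Fin n)).Normalizer where
  toFun t := ⟨⟨rotationMatrix t, by
      rw [Matrix.mem_unitaryGroup_iff, rotationMatrix_star, ← rotationMatrix_mul, mul_inv_cancel,
        rotationMatrix_one]⟩,
    Subgroup.le_normalizer ⟨rotationMatrix_map_conj t, rotationMatrix_det t⟩⟩
  map_one' := by
    apply Subtype.ext
    apply Subtype.ext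
    exact rotationMatrix_one
  map_mul' s t := by
    apply Subtype.ext
    apply Subtype.ext
    exact rotationMatrix_mul s t

/-- The maximal torus of `SO(2n+1)`: rotations in `n` orthogonal planes, fixing the last
coordinate. -/
noncomputable def torusSOOdd (n : ℕ) :
    (Fin n → Circle) →* (groupSO ((Fin n ⊕ Fin n) ⊕ Unit)).Normalizer where
  toFun t := ⟨⟨Matrix.fromBlocks (rotationMatrix t) 0 0 1, by
      rw [Matrix.mem_unitaryGroup_iff, Matrix.star_eq_conjTranspose,
        Matrix.fromBlocks_conjTranspose, Matrix.fromBlocks_multiply,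
        ← Matrix.star_eq_conjTranspose, rotationMatrix_star, ← rotationMatrix_mul, mul_inv_cancel,
        rotationMatrix_one]
      simp⟩,
    Subgroup.le_normalizer ⟨by
      change (Matrix.fromBlocks (rotationMatrix t) 0 0 1).map (starRingEnd ℂ)
        = Matrix.fromBlocks (rotationMatrix t) 0 0 1
      rw [Matrix.fromBlocks_map, rotationMatrix_map_conj]
      simp, by
      change (Matrix.fromBlocks (rotationMatrix t) 0 0 1).det = 1
      rw [Matrix.det_fromBlocks_zero₂₁, rotationMatrix_det, Matrix.det_one, one_mul]⟩⟩
  map_one' := by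
    apply Subtype.ext
    apply Subtype.ext
    change Matrix.fromBlocks (rotationMatrix 1) 0 0 1 = 1
    rw [rotationMatrix_one, Matrix.fromBlocks_one]
  map_mul' s t := by
    apply Subtype.ext
    apply Subtype.ext
    change Matrix.fromBlocks (rotationMatrix (s * t)) 0 0 1
      = Matrix.fromBlocks (rotationMatrix s) 0 0 1 * Matrix.fromBlocks (rotationMatrix t) 0 0 1
    rw [rotationMatrix_mul, Matrix.fromBlocks_multiply]
    simp

/-- The maximal torus of `Sp(n)`: the matrices `diag (t_1, …, t_n, t_1⁻¹, …, t_n⁻¹)`. -/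
noncomputable def torusSp (n : ℕ) : (Fin n → Circle) →* (groupSp (Fin n)).Normalizer where
  toFun t := ⟨⟨Matrix.fromBlocks (Matrix.diagonal fun i => (t i : ℂ)) 0 0
        (Matrix.diagonal fun i => ((t i)⁻¹ : ℂ)), by
      rw [Matrix.mem_unitaryGroup_iff, Matrix.star_eq_conjTranspose,
        Matrix.fromBlocks_conjTranspose, Matrix.fromBlocks_multiply]
      simp only [Matrix.diagonal_conjTranspose, Matrix.diagonal_mul_diagonal]
      rw [← Matrix.fromBlocks_one]
      have h : ∀ i, (t i : ℂ) * (starRingEnd ℂ) (t i : ℂ) = 1 := fun i => by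
        simp [Complex.mul_conj]
      have h' : ∀ i, (t i : ℂ)⁻¹ * ((starRingEnd ℂ) (t i : ℂ))⁻¹ = 1 := fun i => by
        rw [← mul_inv, h, inv_one]
      congr 1 <;> simp [← Matrix.diagonal_one, h, h']⟩,
    Subgroup.le_normalizer (by
      change Matrix.fromBlocks (Matrix.diagonal fun i => (t i : ℂ)) 0 0
        (Matrix.diagonal fun i => ((t i)⁻¹ : ℂ)) ∈ Matrix.symplecticGroup (Fin n) ℂ
      rw [SymplecticGroup.mem_iff, Matrix.J, Matrix.fromBlocks_transpose,
        Matrix.fromBlocks_multiply, Matrix.fromBlocks_multiply]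
      have h : (Matrix.diagonal fun _ : Fin n => (-1 : ℂ)) = -1 := by
        rw [← Matrix.diagonal_one, Matrix.diagonal_neg]
      simp [Matrix.diagonal_mul_diagonal, h])⟩
  map_one' := by
    apply Subtype.ext
    apply Subtype.ext
    simp
  map_mul' s t := by
    apply Subtype.ext
    apply Subtype.ext
    simp [Matrix.diagonal_mul_diagonal, mul_comm]

open CompactMatrixGroup

/-!
Write `⟨A, X⟩ = -Re tr (A X)` for the invariant inner product on the Lie algebra of a closed group
`K` of unitary matrices.  It identifies the dual of the Lie algebra with the Lie algebra, coadjoint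
orbits with adjoint orbits, and the tangent space at `A` with the image of `ad A`
(`traceDual`, `mem_tangent_traceDual`).

*Root coordinates.*  For each classical group a change of basis makes the torus diagonal, and a list
of matrix entries serves as root coordinates (`TorusFrame`).  The fixed points of the torus are then
the diagonal elements.  Every orbit contains one: on the orbit, minimise `Re tr (A H)` for a regular
diagonal element `H`; the minimum commutes with `H`, so it is diagonal (`exists_conj_commute`).  At a
diagonal `A` the root coordinates whose roots do not vanish on `A` identify the tangent space with a
sum of complex lines, so that their weights are the isotropy weights
(`TorusFrame.isIsotropyWeights`).  On an orbit of maximal dimension no root vanishes at a fixed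
point (`TorusFrame.ne_of_isMaximalOrbit`).

*Types B, C and D.*  All `ε_a - ε_b` and `ε_a + ε_b` are therefore isotropy weights.  They differ
by `2 ε_b`.  Isotropy weights are unique up to order and sign, since `g + g⁻¹` acts on the real plane
of the weight `χ` as `2 Re χ(g)`; hence no choice of weights is injective mod 2 (`not_isMod2GKM`).

*Type A.*  The roots `ε_i - ε_j` of `SU(n)` restrict to distinct non-trivial characters of the
elements of order two in the torus; for the maximal torus of `SU(n)` itself this needs `n ≠ 2, 4`
(`IsRootSeparating`).  That gives the statement about the weights mod 2.  The torus orbit of a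
skew-Hermitian matrix has dimension at most one exactly when at most one entry above the diagonal
is non-zero, because two such entries rotate independently.  Such a matrix is diagonal outside a
`2 × 2` block.  Its outer diagonal consists of eigenvalues, and the trace and the trace of the square
fix the mean and the radius of the block, so the one-skeleton is covered by finitely many points and
two-spheres (`isGKM_coadjointOrbit`).  The involution is transposition, an anti-automorphism of the
Lie algebra.  By the separation property, the elements of order two fix only the diagonal matrices,
and move a matrix to at most two places exactly when it has at most one non-zero entry above the
diagonal (`encard_image_le_two_iff`).
-/

/-! ### The invariant inner product -/

namespace CompactMatrixGroup

theorem trace_mul_self_of_conjTranspose_eq_neg {ι : Type} [Fintype ι]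
    {A : Matrix ι ι ℂ} (hA : Aᴴ = -A)
    (h : ((A * A).trace).re = 0) : A = 0 := by
  have h1 : (A * A).trace = -∑ i, ∑ j, (Complex.normSq (A i j) : ℂ) := by
    have h2 : A * A = -(A * Aᴴ) := by rw [hA]; simp
    rw [h2, Matrix.trace_neg, Matrix.trace]
    simp [Matrix.mul_apply, Complex.mul_conj]
  rw [h1] at h
  have h3 : ∑ i, ∑ j, Complex.normSq (A i j) = 0 := by
    simpa using h
  ext i j
  have h4 := (Finset.sum_eq_zero_iff_of_nonneg
    fun i _ => Finset.sum_nonneg fun j _ => Complex.normSq_nonneg (A i j)).mp h3 i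
      (Finset.mem_univ i)
  have h5 := (Finset.sum_eq_zero_iff_of_nonneg fun j _ => Complex.normSq_nonneg (A i j)).mp h4 j
    (Finset.mem_univ j)
  exact Complex.normSq_eq_zero.mp h5

section TraceForm

variable {ι : Type} [Fintype ι] [DecidableEq ι] (K : CompactMatrixGroup ι)

theorem conjTranspose_eq_neg_of_mem_lie {X : Matrix ι ι ℂ} (hX : X ∈ K.lie) : Xᴴ = -X :=
  matrix_skew_of_exp_mem_unitary fun t => by
    obtain ⟨u, -, hu⟩ := (K.mem_lie X).mp hX t
    exact hu ▸ u.2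

theorem mul_sub_mul_mem_lie {X Y : Matrix ι ι ℂ} (hX : X ∈ K.lie) (hY : Y ∈ K.lie) :
    X * Y - Y * X ∈ K.lie :=
  K.lie.lie_mem hX hY

theorem apply_eq_neg_conj_of_mem_lie {X : Matrix ι ι ℂ} (hX : X ∈ K.lie) (i j : ι) :
    X i j = -(starRingEnd ℂ) (X j i) := by
  have h := congrFun (congrFun (K.conjTranspose_eq_neg_of_mem_lie hX) i) j
  rw [Matrix.conjTranspose_apply, Matrix.neg_apply] at h
  rw [← neg_eq_iff_eq_neg, ← h]
  rfl

/-- The functional `X ↦ -Re tr (A X)` on the Lie algebra.  For `A` in the Lie algebra it is the one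
that corresponds to `A` under the invariant inner product `⟨A, X⟩ = -Re tr (A X)`. -/
noncomputable def traceDual : Matrix ι ι ℂ →ₗ[ℝ] K.Dual where
  toFun A :=
    { toFun := fun X => -((A * X.1).trace).re
      map_add' := fun X Y => by
        change -((A * (X.1 + Y.1)).trace).re = _
        rw [mul_add, Matrix.trace_add, Complex.add_re, neg_add]
      map_smul' := fun c X => by
        change -((A * (c • X.1)).trace).re = c * -((A * X.1).trace).re
        rw [mul_smul_comm, Matrix.trace_smul, Complex.smul_re, smul_eq_mul, mul_neg] }
  map_add' A B := by
    refine LinearMap.ext fun X => ?_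
    change -(((A + B) * X.1).trace).re = -((A * X.1).trace).re + -((B * X.1).trace).re
    rw [add_mul, Matrix.trace_add, Complex.add_re, neg_add]
  map_smul' c A := by
    refine LinearMap.ext fun X => ?_
    change -(((c • A) * X.1).trace).re = c * -((A * X.1).trace).re
    rw [smul_mul_assoc, Matrix.trace_smul, Complex.smul_re, smul_eq_mul, mul_neg]

theorem traceDual_apply (A : Matrix ι ι ℂ) (X : K.lie) :
    K.traceDual A X = -((A * X.1).trace).re := rfl

theorem coAd_traceDual (u : K.Normalizer) (A : Matrix ι ι ℂ) :
    K.coAd u (K.traceDual A)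
      = K.traceDual ((u.1 : Matrix ι ι ℂ) * A * star (u.1 : Matrix ι ι ℂ)) := by
  ext X
  have h : (K.Ad u⁻¹ X).1
      = star (u.1 : Matrix ι ι ℂ) * X.1 * star (star (u.1 : Matrix ι ι ℂ)) := rfl
  change K.traceDual A (K.Ad u⁻¹ X) = _
  rw [traceDual_apply, traceDual_apply, h, star_star, ← mul_assoc, ← mul_assoc,
    Matrix.trace_mul_comm, ← mul_assoc, ← mul_assoc]

theorem infCoAd_traceDual (A : Matrix ι ι ℂ) (X : K.lie) :
    K.infCoAd (K.traceDual A) X = K.traceDual (X.1 * A - A * X.1) := by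
  ext Y
  change -(K.traceDual A ⁅X, Y⁆) = _
  have h : (⁅X, Y⁆ : K.lie).1 = X.1 * Y.1 - Y.1 * X.1 := rfl
  rw [traceDual_apply, traceDual_apply, h, mul_sub, sub_mul, Matrix.trace_sub, Matrix.trace_sub,
    ← mul_assoc, ← mul_assoc, Matrix.trace_mul_comm (A * Y.1), ← mul_assoc]
  simp

theorem eq_zero_of_traceDual_eq_zero {A : Matrix ι ι ℂ} (hA : A ∈ K.lie)
    (h : K.traceDual A = 0) : A = 0 := by
  refine trace_mul_self_of_conjTranspose_eq_neg (K.conjTranspose_eq_neg_of_mem_lie hA) ?_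
  have := congrArg (fun f : K.Dual => f ⟨A, hA⟩) h
  simpa [traceDual_apply] using this

theorem traceDual_injOn {A B : Matrix ι ι ℂ} (hA : A ∈ K.lie) (hB : B ∈ K.lie)
    (h : K.traceDual A = K.traceDual B) : A = B :=
  sub_eq_zero.mp <| K.eq_zero_of_traceDual_eq_zero (K.lie.sub_mem hA hB) <| by
    rw [map_sub, h, sub_self]

theorem exists_mem_lie_traceDual_eq (ξ : K.Dual) : ∃ A ∈ K.lie, K.traceDual A = ξ := by
  let f : K.lie →ₗ[ℝ] K.Dual := K.traceDual ∘ₗ K.lie.toSubmodule.subtype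
  have hf : Function.Injective f := fun X Y h =>
    Subtype.ext (K.traceDual_injOn X.2 Y.2 h)
  have hs : Function.Surjective f :=
    (LinearMap.injective_iff_surjective_of_finrank_eq_finrank
      (Subspace.dual_finrank_eq (K := ℝ) (V := K.lie)).symm).mp hf
  obtain ⟨A, hA⟩ := hs ξ
  exact ⟨A.1, A.2, hA⟩

theorem mem_tangent_traceDual {A : Matrix ι ι ℂ} {η : K.Dual} :
    η ∈ K.tangent (K.traceDual A) ↔ ∃ X ∈ K.lie, K.traceDual (X * A - A * X) = η := by
  constructor
  · rintro ⟨X, rfl⟩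
    exact ⟨X.1, X.2, (K.infCoAd_traceDual A X).symm⟩
  · rintro ⟨X, hX, rfl⟩
    exact ⟨⟨X, hX⟩, K.infCoAd_traceDual A ⟨X, hX⟩⟩

theorem mem_coadjointOrbit_traceDual {A : Matrix ι ι ℂ} {η : K.Dual} :
    η ∈ K.coadjointOrbit (K.traceDual A) ↔ ∃ k ∈ K.grp,
      η = K.traceDual ((k : Matrix ι ι ℂ) * A * star (k : Matrix ι ι ℂ)) := by
  constructor
  · rintro ⟨k, hk, rfl⟩
    exact ⟨k, hk, K.coAd_traceDual _ A⟩
  · rintro ⟨k, hk, rfl⟩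
    exact ⟨k, hk, (K.coAd_traceDual ⟨k, Subgroup.le_normalizer hk⟩ A).symm⟩

theorem conj_mem_lie_of_mem_grp {k : Matrix.unitaryGroup ι ℂ} (hk : k ∈ K.grp)
    {A : Matrix ι ι ℂ} (hA : A ∈ K.lie) :
    (k : Matrix ι ι ℂ) * A * star (k : Matrix ι ι ℂ) ∈ K.lie :=
  K.conj_mem_lie ⟨k, Subgroup.le_normalizer hk⟩ hA

theorem conj_commutator (k : Matrix.unitaryGroup ι ℂ) (X A : Matrix ι ι ℂ) :
    ((k : Matrix ι ι ℂ) * X * star (k : Matrix ι ι ℂ)) *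
        ((k : Matrix ι ι ℂ) * A * star (k : Matrix ι ι ℂ)) -
      ((k : Matrix ι ι ℂ) * A * star (k : Matrix ι ι ℂ)) *
        ((k : Matrix ι ι ℂ) * X * star (k : Matrix ι ι ℂ))
      = (k : Matrix ι ι ℂ) * (X * A - A * X) * star (k : Matrix ι ι ℂ) := by
  have h : star (k : Matrix ι ι ℂ) * (k : Matrix ι ι ℂ) = 1 :=
    (Matrix.mem_unitaryGroup_iff').mp k.2
  have h2 : ∀ Y Z : Matrix ι ι ℂ, ((k : Matrix ι ι ℂ) * Y * star (k : Matrix ι ι ℂ)) *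
        ((k : Matrix ι ι ℂ) * Z * star (k : Matrix ι ι ℂ))
        = (k : Matrix ι ι ℂ) * (Y * Z) * star (k : Matrix ι ι ℂ) := fun Y Z => by
    calc _ = (k : Matrix ι ι ℂ) * Y * (star (k : Matrix ι ι ℂ) * (k : Matrix ι ι ℂ)) * Z *
          star (k : Matrix ι ι ℂ) := by simp only [mul_assoc]
      _ = _ := by rw [h, mul_one]; simp only [mul_assoc]
  rw [h2, h2, mul_sub, sub_mul]

theorem coAd_inv_coAd (u : K.Normalizer) (ξ : K.Dual) : K.coAd u⁻¹ (K.coAd u ξ) = ξ := by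
  obtain ⟨A, -, rfl⟩ := K.exists_mem_lie_traceDual_eq ξ
  rw [coAd_traceDual, coAd_traceDual]
  have h : star (u.1 : Matrix ι ι ℂ) * (u.1 : Matrix ι ι ℂ) = 1 :=
    (Matrix.mem_unitaryGroup_iff').mp u.1.2
  have h1 : ((u⁻¹).1 : Matrix ι ι ℂ) = star (u.1 : Matrix ι ι ℂ) := rfl
  congr 1
  rw [h1, star_star]
  calc _ = (star (u.1 : Matrix ι ι ℂ) * (u.1 : Matrix ι ι ℂ)) * A *
        (star (u.1 : Matrix ι ι ℂ) * (u.1 : Matrix ι ι ℂ)) := by simp only [mul_assoc]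
    _ = A := by rw [h, one_mul, mul_one]

theorem coAd_injective (u : K.Normalizer) : Function.Injective (K.coAd u) :=
  Function.LeftInverse.injective (K.coAd_inv_coAd u)

/-- All tangent spaces of a coadjoint orbit have the same dimension. -/
theorem finrank_tangent_of_mem_coadjointOrbit {ξ η : K.Dual} (h : η ∈ K.coadjointOrbit ξ) :
    Module.finrank ℝ (K.tangent η) = Module.finrank ℝ (K.tangent ξ) := by
  obtain ⟨A, -, rfl⟩ := K.exists_mem_lie_traceDual_eq ξ
  obtain ⟨k, hk, rfl⟩ := h
  set u : K.Normalizer := ⟨k, Subgroup.le_normalizer hk⟩ with hu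
  have h1 : K.tangent (K.coAd u (K.traceDual A)) = (K.tangent (K.traceDual A)).map (K.coAd u) := by
    ext η
    rw [coAd_traceDual, mem_tangent_traceDual, Submodule.mem_map]
    constructor
    · rintro ⟨X, hX, rfl⟩
      refine ⟨_, (K.mem_tangent_traceDual).mpr ⟨_, K.conj_mem_lie u⁻¹ hX, rfl⟩, ?_⟩
      rw [coAd_traceDual]
      congr 1
      have h3 : ((u⁻¹).1 : Matrix ι ι ℂ) = star (k : Matrix ι ι ℂ) := rfl
      have h4 : (k : Matrix ι ι ℂ) * star (k : Matrix ι ι ℂ) = 1 :=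
        (Matrix.mem_unitaryGroup_iff).mp k.2
      change (k : Matrix ι ι ℂ) * _ * star (k : Matrix ι ι ℂ) = _
      rw [← conj_commutator, h3, star_star]
      have h5 : (k : Matrix ι ι ℂ) * (star (k : Matrix ι ι ℂ) * X * (k : Matrix ι ι ℂ)) *
          star (k : Matrix ι ι ℂ) = X := by
        calc _ = ((k : Matrix ι ι ℂ) * star (k : Matrix ι ι ℂ)) * X *
              ((k : Matrix ι ι ℂ) * star (k : Matrix ι ι ℂ)) := by simp only [mul_assoc]
          _ = X := by rw [h4, one_mul, mul_one]
      rw [h5]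
    · rintro ⟨_, h2, rfl⟩
      obtain ⟨X, hX, rfl⟩ := (K.mem_tangent_traceDual).mp h2
      refine ⟨_, K.conj_mem_lie u hX, ?_⟩
      rw [coAd_traceDual]
      congr 1
      exact conj_commutator k X A
  rw [h1]
  exact (Submodule.equivMapOfInjective _ (K.coAd_injective u) _).finrank_eq.symm

end TraceForm

/-! ### Every adjoint orbit meets every centraliser -/

section Commute

variable {ι : Type} [Fintype ι] [DecidableEq ι] (K : CompactMatrixGroup ι)

theorem isCompact_grp : IsCompact ((fun k : Matrix.unitaryGroup ι ℂ => (k : Matrix ι ι ℂ)) ''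
    (K.grp : Set (Matrix.unitaryGroup ι ℂ))) := by
  have hU : IsClosed (Matrix.unitaryGroup ι ℂ : Set (Matrix ι ι ℂ)) := by
    have : (Matrix.unitaryGroup ι ℂ : Set (Matrix ι ι ℂ)) = {A | A * Aᴴ = 1} := by
      ext A
      exact Matrix.mem_unitaryGroup_iff
    rw [this]
    exact isClosed_eq (by fun_prop) continuous_const
  have hC : IsClosed ((fun k : Matrix.unitaryGroup ι ℂ => (k : Matrix ι ι ℂ)) ''
      (K.grp : Set (Matrix.unitaryGroup ι ℂ))) :=
    (hU.isClosedEmbedding_subtypeVal.isClosedMap) _ K.isClosed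
  have hB : IsCompact (Set.univ.pi fun _ : ι => Set.univ.pi fun _ : ι =>
      Metric.closedBall (0 : ℂ) 1) :=
    isCompact_univ_pi fun _ => isCompact_univ_pi fun _ => isCompact_closedBall 0 1
  refine hB.of_isClosed_subset hC ?_
  rintro _ ⟨k, -, rfl⟩ i - j -
  simpa using entry_norm_bound_of_unitary k.2 i j

open scoped Matrix.Norms.Operator in
theorem hasDerivAt_trace_exp_conj (X B H : Matrix ι ι ℂ) :
    HasDerivAt (fun t : ℝ => ((NormedSpace.exp (t • X) * B * NormedSpace.exp (t • (-X)) *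
      H).trace).re) (((X * B - B * X) * H).trace).re 0 := by
  have h1 : HasDerivAt (fun t : ℝ => NormedSpace.exp (t • X))
      (NormedSpace.exp ((0 : ℝ) • X) * X) 0 :=
    hasDerivAt_exp_smul_const (𝕂 := ℝ) X 0
  have h2 := hasDerivAt_exp_smul_const (𝕂 := ℝ) (-X) 0
  have h3 := ((h1.mul_const B).mul h2).mul_const H
  let τ : Matrix ι ι ℂ →ₗ[ℝ] ℝ :=
    Complex.reLm ∘ₗ (Matrix.traceLinearMap ι ℝ ℂ)
  have h4 := (τ.toContinuousLinearMap.hasFDerivAt (x := _)).comp_hasDerivAt (0 : ℝ) h3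
  refine h4.congr_deriv ?_
  change ((((NormedSpace.exp ((0 : ℝ) • X) * X * B * NormedSpace.exp ((0 : ℝ) • -X) +
    NormedSpace.exp ((0 : ℝ) • X) * B * (NormedSpace.exp ((0 : ℝ) • -X) * -X)) * H)).trace).re = _
  simp [sub_eq_add_neg]

/-- Every adjoint orbit meets the centraliser of `H`: at a point `k A k⁻¹` of the orbit of `A` where
`Re tr (k A k⁻¹ H)` is minimal, the derivative along `X = [H, k A k⁻¹]` vanishes, and that
derivative is, up to sign, the squared norm of `X`. -/
theorem exists_conj_commute {A H : Matrix ι ι ℂ} (hA : A ∈ K.lie) (hH : H ∈ K.lie) :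
    ∃ k ∈ K.grp, (k : Matrix ι ι ℂ) * A * star (k : Matrix ι ι ℂ) * H
      = H * ((k : Matrix ι ι ℂ) * A * star (k : Matrix ι ι ℂ)) := by
  -- The function `M ↦ Re tr (M A M⁻¹ H)` attains its minimum on the compact group.
  have hcont : ContinuousOn (fun M : Matrix ι ι ℂ => ((M * A * Mᴴ * H).trace).re)
      ((fun k : Matrix.unitaryGroup ι ℂ => (k : Matrix ι ι ℂ)) ''
        (K.grp : Set (Matrix.unitaryGroup ι ℂ))) := by
    refine Continuous.continuousOn (Complex.continuous_re.comp (Continuous.matrix_trace ?_))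
    exact ((continuous_id.matrix_mul continuous_const).matrix_mul
      continuous_id.matrix_conjTranspose).matrix_mul continuous_const
  obtain ⟨_, ⟨k, hk, rfl⟩, hmin⟩ := K.isCompact_grp.exists_isMinOn ⟨_, 1, K.grp.one_mem, rfl⟩ hcont
  refine ⟨k, hk, ?_⟩
  set B : Matrix ι ι ℂ := (k : Matrix ι ι ℂ) * A * star (k : Matrix ι ι ℂ) with hB
  have hBl : B ∈ K.lie := K.conj_mem_lie_of_mem_grp hk hA
  set X : Matrix ι ι ℂ := H * B - B * H with hX
  have hXl : X ∈ K.lie := K.mul_sub_mul_mem_lie hH hBl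
  have hloc : IsLocalMin (fun t : ℝ => ((NormedSpace.exp (t • X) * B *
      NormedSpace.exp (t • (-X)) * H).trace).re) 0 := by
    refine Filter.Eventually.of_forall fun t => ?_
    obtain ⟨u, hu, huX⟩ := (K.mem_lie X).mp hXl t
    have h1 := hmin ⟨u * k, K.grp.mul_mem hu hk, rfl⟩
    have h2 : star (NormedSpace.exp (t • X)) = NormedSpace.exp (t • (-X)) := by
      rw [smul_neg]
      exact matrix_exp_inv_of_mem_unitary (huX ▸ u.2)
    have h3 : ((u * k : Matrix.unitaryGroup ι ℂ) : Matrix ι ι ℂ) * A *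
        star ((u * k : Matrix.unitaryGroup ι ℂ) : Matrix ι ι ℂ)
        = NormedSpace.exp (t • X) * B * NormedSpace.exp (t • (-X)) := by
      rw [← h2, ← huX, hB]
      change (u : Matrix ι ι ℂ) * (k : Matrix ι ι ℂ) * A * star ((u : Matrix ι ι ℂ) * k) = _
      rw [star_mul]
      simp only [mul_assoc]
    simp only [Set.mem_ofPred_eq] at h1
    rw [← Matrix.star_eq_conjTranspose, ← Matrix.star_eq_conjTranspose, h3] at h1
    simpa using h1
  have h0 := hloc.hasDerivAt_eq_zero (hasDerivAt_trace_exp_conj X B H)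
  have h5 : ((X * B - B * X) * H).trace = -(X * X).trace := by
    have e1 : (B * X * H).trace = (X * (H * B)).trace := by
      rw [mul_assoc, Matrix.trace_mul_comm, mul_assoc]
    rw [sub_mul, Matrix.trace_sub, e1, mul_assoc, ← Matrix.trace_sub, ← mul_sub, ← Matrix.trace_neg,
      ← mul_neg, hX, neg_sub]
  have h6 : X = 0 := by
    refine trace_mul_self_of_conjTranspose_eq_neg (K.conjTranspose_eq_neg_of_mem_lie hXl) ?_
    rw [h5] at h0
    simpa using h0
  exact (sub_eq_zero.mp h6).symm

end Commute

end CompactMatrixGroup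

/-! ### Root coordinates -/

/-- Coordinates adapted to the action of a torus `G` on the Lie algebra of `K`.  Conjugation by `W`
(with inverse `V`) turns the matrices of `G` into diagonal ones, with entries `char i`; the matrix
entries `(row k, col k)` of `W X V` for `k : κ` are a full set of root coordinates: they can be
prescribed arbitrarily, and the common kernel of the root coordinates consists of elements that
become diagonal.  Moreover some diagonal element takes no zero value on the roots, and the torus
acts non-trivially on every root coordinate. -/
structure TorusFrame {ι : Type} [Fintype ι] [DecidableEq ι] (K : CompactMatrixGroup ι) {G : Type}
    [CommGroup G] [TopologicalSpace G] (ρ : G →* K.Normalizer) (κ : Type) where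
  W : Matrix ι ι ℂ
  V : Matrix ι ι ℂ
  W_mul_V : W * V = 1
  char : ι → PontryaginDual G
  diag : ∀ g, W * ((ρ g).1 : Matrix ι ι ℂ) * V
    = Matrix.diagonal fun i => ((char i g : Circle) : ℂ)
  row : κ → ι
  col : κ → ι
  exists_coord : ∀ z : κ → ℂ, ∃ X ∈ K.lie, ∀ k, (W * X * V) (row k) (col k) = z k
  offDiag : ∀ X ∈ K.lie, (∀ k, (W * X * V) (row k) (col k) = 0) →
    ∀ i j, i ≠ j → (W * X * V) i j = 0
  exists_regular : ∃ H ∈ K.lie, (∀ i j, i ≠ j → (W * H * V) i j = 0) ∧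
    ∀ k, (W * H * V) (row k) (row k) ≠ (W * H * V) (col k) (col k)
  char_ne : ∀ k, ∃ g, char (row k) g ≠ char (col k) g

namespace TorusFrame

open CompactMatrixGroup

variable {ι : Type} [Fintype ι] [DecidableEq ι] {K : CompactMatrixGroup ι} {G : Type}
  [CommGroup G] [TopologicalSpace G] {ρ : G →* K.Normalizer} {κ : Type} (F : TorusFrame K ρ κ)

/-- The matrix of `X` in the adapted basis. -/
def mat (X : Matrix ι ι ℂ) : Matrix ι ι ℂ := F.W * X * F.V

/-- `X` is diagonal in the adapted basis. -/
def IsDiag (X : Matrix ι ι ℂ) : Prop := ∀ i j, i ≠ j → F.mat X i j = 0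

/-- The character by which the torus acts on the coordinate `k`. -/
noncomputable def weight (k : κ) : PontryaginDual G := F.char (F.row k) / F.char (F.col k)

theorem V_mul_W : F.V * F.W = 1 := mul_eq_one_comm.mp F.W_mul_V

theorem mat_mul (X Y : Matrix ι ι ℂ) : F.mat (X * Y) = F.mat X * F.mat Y := by
  unfold mat
  calc _ = F.W * X * 1 * Y * F.V := by simp only [mul_assoc, one_mul]
    _ = _ := by rw [← F.V_mul_W]; simp only [mul_assoc]

theorem mat_sub (X Y : Matrix ι ι ℂ) : F.mat (X - Y) = F.mat X - F.mat Y := by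
  unfold mat
  rw [mul_sub, sub_mul]

theorem mat_add (X Y : Matrix ι ι ℂ) : F.mat (X + Y) = F.mat X + F.mat Y := by
  unfold mat
  rw [mul_add, add_mul]

theorem mat_smul (c : ℝ) (X : Matrix ι ι ℂ) : F.mat (c • X) = c • F.mat X := by
  unfold mat
  rw [mul_smul_comm, smul_mul_assoc]

theorem mat_injective : Function.Injective F.mat := fun X Y h => by
  have h1 : ∀ X, F.V * F.mat X * F.W = X := fun X => by
    unfold mat
    calc _ = (F.V * F.W) * X * (F.V * F.W) := by simp only [mul_assoc]
      _ = X := by rw [F.V_mul_W, one_mul, mul_one]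
  rw [← h1 X, h, h1]

theorem mat_eq_diagonal {A : Matrix ι ι ℂ} (hA : F.IsDiag A) :
    F.mat A = Matrix.diagonal fun i => F.mat A i i := by
  ext i j
  by_cases h : i = j
  · subst h; simp
  · rw [hA i j h, Matrix.diagonal_apply_ne _ h]

theorem mat_conj (g : G) (X : Matrix ι ι ℂ) (i j : ι) :
    F.mat (((ρ g).1 : Matrix ι ι ℂ) * X * star ((ρ g).1 : Matrix ι ι ℂ)) i j
      = ((F.char i g / F.char j g : Circle) : ℂ) * F.mat X i j := by
  have h1 : F.mat (star ((ρ g).1 : Matrix ι ι ℂ))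
      = Matrix.diagonal fun i => (((F.char i g)⁻¹ : Circle) : ℂ) := by
    have h2 : F.mat ((ρ g⁻¹).1 : Matrix ι ι ℂ)
      = Matrix.diagonal fun i => ((F.char i g⁻¹ : Circle) : ℂ) := F.diag g⁻¹
    have h3 : ((ρ g⁻¹).1 : Matrix ι ι ℂ) = star ((ρ g).1 : Matrix ι ι ℂ) := by
      rw [map_inv]; rfl
    rw [← h3, h2]
    simp only [map_inv]
  have h2 : F.mat ((ρ g).1 : Matrix ι ι ℂ)
      = Matrix.diagonal fun i => ((F.char i g : Circle) : ℂ) := F.diag g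
  rw [mat_mul, mat_mul, h1, h2, Matrix.mul_diagonal, Matrix.diagonal_mul, div_eq_mul_inv,
    Circle.coe_mul]
  ring

theorem mat_commutator {A : Matrix ι ι ℂ} (hA : F.IsDiag A) (X : Matrix ι ι ℂ) (i j : ι) :
    F.mat (X * A - A * X) i j = (F.mat A j j - F.mat A i i) * F.mat X i j := by
  rw [mat_sub, mat_mul, mat_mul, F.mat_eq_diagonal hA, Matrix.sub_apply, Matrix.mul_diagonal,
    Matrix.diagonal_mul, Matrix.diagonal_apply_eq, Matrix.diagonal_apply_eq]
  ring

theorem commute_of_isDiag {A B : Matrix ι ι ℂ} (hA : F.IsDiag A) (hB : F.IsDiag B) :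
    A * B = B * A := by
  apply F.mat_injective
  rw [mat_mul, mat_mul, F.mat_eq_diagonal hA, F.mat_eq_diagonal hB, Matrix.diagonal_mul_diagonal,
    Matrix.diagonal_mul_diagonal]
  congr 1
  funext i
  exact mul_comm _ _

/-- The fixed points of the torus in the dual of the Lie algebra are the diagonal elements. -/
theorem forall_coAd_eq_iff {A : Matrix ι ι ℂ} (hA : A ∈ K.lie) :
    (∀ g, K.coAd (ρ g) (K.traceDual A) = K.traceDual A) ↔ F.IsDiag A := by
  constructor
  · intro h
    refine F.offDiag A hA fun k => ?_
    obtain ⟨g, hg⟩ := F.char_ne k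
    have h1 := h g
    rw [coAd_traceDual] at h1
    have h2 := K.traceDual_injOn (K.conj_mem_lie (ρ g) hA) hA h1
    have h3 := F.mat_conj g A (F.row k) (F.col k)
    rw [h2] at h3
    by_contra h0
    have h4 : ((F.char (F.row k) g / F.char (F.col k) g : Circle) : ℂ) = 1 :=
      mul_right_cancel₀ (b := F.mat A (F.row k) (F.col k)) h0 (by rw [← h3, one_mul])
    exact hg (div_eq_one.mp (Circle.coe_eq_one.mp h4))
  · intro h g
    rw [coAd_traceDual]
    congr 1
    apply F.mat_injective
    ext i j
    rw [mat_conj]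
    by_cases hij : i = j
    · subst hij; simp
    · rw [h i j hij, mul_zero]

theorem mem_fixedPts_iff {ξ : K.Dual} {A : Matrix ι ι ℂ} (hA : A ∈ K.lie) :
    K.traceDual A ∈ fixedPts ρ (K.coadjointOrbit ξ)
      ↔ K.traceDual A ∈ K.coadjointOrbit ξ ∧ F.IsDiag A :=
  and_congr_right fun _ => F.forall_coAd_eq_iff hA

/-- Every coadjoint orbit contains a fixed point of the torus. -/
theorem exists_isDiag_mem_coadjointOrbit (ξ : K.Dual) :
    ∃ A ∈ K.lie, F.IsDiag A ∧ K.traceDual A ∈ K.coadjointOrbit ξ := by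
  obtain ⟨B, hB, rfl⟩ := K.exists_mem_lie_traceDual_eq ξ
  obtain ⟨H, hH, hHd, hreg⟩ := F.exists_regular
  obtain ⟨k, hk, hcomm⟩ := K.exists_conj_commute hB hH
  refine ⟨_, K.conj_mem_lie_of_mem_grp hk hB, ?_, K.mem_coadjointOrbit_traceDual.mpr ⟨k, hk, rfl⟩⟩
  refine F.offDiag _ (K.conj_mem_lie_of_mem_grp hk hB) fun m => ?_
  have h1 := F.mat_commutator hHd ((k : Matrix ι ι ℂ) * B * star (k : Matrix ι ι ℂ))
    (F.row m) (F.col m)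
  rw [hcomm, sub_self] at h1
  have h2 : F.mat (0 : Matrix ι ι ℂ) (F.row m) (F.col m) = 0 := by simp [mat]
  rw [h2] at h1
  exact (mul_eq_zero.mp h1.symm).resolve_left fun h => hreg m (sub_eq_zero.mp h).symm

/-- The isotropy weights at a diagonal element `A` are the weights of the root coordinates whose
roots do not vanish on `A`: these coordinates identify the image of `ad A` with a complex vector
space. -/
theorem isIsotropyWeights {A : Matrix ι ι ℂ} (hA : A ∈ K.lie) (hd : F.IsDiag A) {d : ℕ}
    (e : Fin d ≃ {k : κ // F.mat A (F.row k) (F.row k) ≠ F.mat A (F.col k) (F.col k)}) :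
    IsIsotropyWeights ρ (K.traceDual A) fun m => F.weight (e m).1 := by
  let adA : K.lie →ₗ[ℝ] Matrix ι ι ℂ :=
    { toFun := fun X => X.1 * A - A * X.1
      map_add' := fun X Y => by
        change (X.1 + Y.1) * A - A * (X.1 + Y.1) = _
        rw [add_mul, mul_add, add_sub_add_comm]
      map_smul' := fun c X => by
        change (c • X.1) * A - A * (c • X.1) = c • (X.1 * A - A * X.1)
        rw [smul_mul_assoc, mul_smul_comm, smul_sub] }
  let R : Submodule ℝ (Matrix ι ι ℂ) := LinearMap.range adA
  have hR : ∀ Y ∈ R, Y ∈ K.lie := by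
    rintro _ ⟨X, rfl⟩
    exact K.mul_sub_mul_mem_lie X.2 hA
  let θ : R →ₗ[ℝ] (Fin d → ℂ) :=
    { toFun := fun Y m => F.mat Y.1 (F.row (e m).1) (F.col (e m).1)
      map_add' := fun X Y => by
        funext m
        change F.mat (X.1 + Y.1) _ _ = _
        rw [mat_add]; rfl
      map_smul' := fun c X => by
        funext m
        change F.mat (c • X.1) _ _ = _
        rw [mat_smul]; rfl }
  have hinj : Function.Injective θ := by
    rw [← LinearMap.ker_eq_bot, LinearMap.ker_eq_bot']
    rintro ⟨_, X, rfl⟩ h0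
    apply Subtype.ext
    change X.1 * A - A * X.1 = 0
    set Y := X.1 * A - A * X.1 with hY
    have hYl : Y ∈ K.lie := K.mul_sub_mul_mem_lie X.2 hA
    have hYd : F.IsDiag Y := by
      refine F.offDiag Y hYl fun k => ?_
      by_cases hk : F.mat A (F.row k) (F.row k) ≠ F.mat A (F.col k) (F.col k)
      · have := congrFun h0 (e.symm ⟨k, hk⟩)
        change F.mat Y (F.row (e (e.symm ⟨k, hk⟩)).1) (F.col (e (e.symm ⟨k, hk⟩)).1) = 0 at this
        rwa [Equiv.apply_symm_apply] at this
      · have h1 : F.mat Y (F.row k) (F.col k) = _ := F.mat_commutator hd X.1 (F.row k) (F.col k)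
        rw [not_not.mp hk, sub_self, zero_mul] at h1
        exact h1
    -- `Y = [X, A]` commutes with `A`, so `tr (Y Y) = tr (X [A, Y]) = 0`.
    refine trace_mul_self_of_conjTranspose_eq_neg (K.conjTranspose_eq_neg_of_mem_lie hYl) ?_
    have h2 : (Y * Y).trace = 0 := by
      have e1 : (Y * (X.1 * A)).trace = (X.1 * (A * Y)).trace := by
        rw [Matrix.trace_mul_comm, mul_assoc]
      have e2 : (Y * (A * X.1)).trace = (X.1 * (Y * A)).trace := by
        rw [← mul_assoc, Matrix.trace_mul_comm]
      have e3 : (Y * (X.1 * A - A * X.1)).trace = 0 := by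
        rw [mul_sub, Matrix.trace_sub, e1, e2, F.commute_of_isDiag hd hYd, sub_self]
      exact e3
    rw [h2, Complex.zero_re]
  have hsurj : Function.Surjective θ := by
    intro z
    classical
    obtain ⟨X, hX, hXz⟩ := F.exists_coord fun k =>
      if hk : F.mat A (F.row k) (F.row k) ≠ F.mat A (F.col k) (F.col k) then
        z (e.symm ⟨k, hk⟩) / (F.mat A (F.col k) (F.col k) - F.mat A (F.row k) (F.row k)) else 0
    refine ⟨⟨_, ⟨X, hX⟩, rfl⟩, ?_⟩
    funext m
    change F.mat (X * A - A * X) _ _ = z m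
    have h1 : F.mat X (F.row (e m).1) (F.col (e m).1) = _ := hXz (e m).1
    rw [F.mat_commutator hd, h1, dif_pos (e m).2]
    have h2 : e.symm ⟨(e m).1, (e m).2⟩ = m := e.symm_apply_apply m
    rw [h2]
    exact mul_div_cancel₀ _ (sub_ne_zero.mpr (e m).2.symm)
  let Θ : R ≃ₗ[ℝ] (Fin d → ℂ) := LinearEquiv.ofBijective θ ⟨hinj, hsurj⟩
  refine ⟨K.traceDual ∘ₗ R.subtype ∘ₗ Θ.symm.toLinearMap, ?_, ?_, ?_⟩
  · intro z w h
    exact Θ.symm.injective (Subtype.ext (K.traceDual_injOn (hR _ (Θ.symm z).2)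
      (hR _ (Θ.symm w).2) h))
  · ext η
    rw [mem_tangent_traceDual]
    constructor
    · rintro ⟨z, rfl⟩
      obtain ⟨X, hX⟩ := (Θ.symm z).2
      exact ⟨X.1, X.2, congrArg K.traceDual hX⟩
    · rintro ⟨X, hX, rfl⟩
      refine ⟨Θ ⟨_, ⟨X, hX⟩, rfl⟩, ?_⟩
      change K.traceDual (Θ.symm (Θ ⟨X * A - A * X, ⟨X, hX⟩, rfl⟩)).1 = _
      rw [LinearEquiv.symm_apply_apply]
  · intro g z
    have hmem : ((ρ g).1 : Matrix ι ι ℂ) * (Θ.symm z).1 * star ((ρ g).1 : Matrix ι ι ℂ) ∈ R := by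
      obtain ⟨X, hX⟩ := (Θ.symm z).2
      have hX' : X.1 * A - A * X.1 = (Θ.symm z).1 := hX
      refine ⟨⟨_, K.conj_mem_lie (ρ g) X.2⟩, ?_⟩
      have hfix := (F.forall_coAd_eq_iff hA).mpr hd g
      rw [coAd_traceDual] at hfix
      have h2 := K.traceDual_injOn (K.conj_mem_lie (ρ g) hA) hA hfix
      rw [← hX', ← conj_commutator, h2]
      rfl
    change K.coAd (ρ g) (K.traceDual (Θ.symm z).1) = K.traceDual (Θ.symm _).1
    rw [coAd_traceDual]
    congr 1
    have h3 : (⟨_, hmem⟩ : R) = Θ.symm fun i => ((F.weight (e i).1 g : Circle) : ℂ) * z i := by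
      rw [LinearEquiv.eq_symm_apply]
      funext m
      have h4 : F.mat (Θ.symm z).1 (F.row (e m).1) (F.col (e m).1) = z m :=
        congrFun (Θ.apply_symm_apply z) m
      change F.mat _ _ _ = _
      rw [mat_conj, h4]
      rfl
    exact congrArg Subtype.val h3

theorem finrank_tangent_of_isIsotropyWeights {p : K.Dual} {d : ℕ} {α : Fin d → PontryaginDual G}
    (h : IsIsotropyWeights ρ p α) : Module.finrank ℝ (K.tangent p) = 2 * d := by
  obtain ⟨Ψ, hinj, hrange, -⟩ := h
  rw [← hrange, LinearMap.finrank_range_of_inj hinj, Module.finrank_pi_fintype]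
  simp [mul_comm]

/-- On a coadjoint orbit of maximal dimension no root vanishes at a fixed point of the torus. -/
theorem ne_of_isMaximalOrbit [Finite κ] {ξ : K.Dual} (hξ : K.IsMaximalOrbit ξ) {A : Matrix ι ι ℂ}
    (hA : A ∈ K.lie) (hd : F.IsDiag A) (hmem : K.traceDual A ∈ K.coadjointOrbit ξ) (k : κ) :
    F.mat A (F.row k) (F.row k) ≠ F.mat A (F.col k) (F.col k) := by
  classical
  have := Fintype.ofFinite κ
  obtain ⟨H, hH, hHd, hreg⟩ := F.exists_regular
  have h1 := finrank_tangent_of_isIsotropyWeights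
    (F.isIsotropyWeights hH hHd (Fintype.equivFin _).symm)
  have h2 := finrank_tangent_of_isIsotropyWeights
    (F.isIsotropyWeights hA hd (Fintype.equivFin _).symm)
  have h3 := hξ (K.traceDual H)
  rw [← K.finrank_tangent_of_mem_coadjointOrbit hmem, h1, h2] at h3
  have h4 : Fintype.card {k : κ // F.mat H (F.row k) (F.row k) ≠ F.mat H (F.col k) (F.col k)}
      = Fintype.card κ :=
    Fintype.card_congr (Equiv.subtypeUnivEquiv hreg)
  by_contra hk
  have h5 := Fintype.card_subtype_lt
    (p := fun k => F.mat A (F.row k) (F.row k) ≠ F.mat A (F.col k) (F.col k)) (not_not.mpr hk)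
  omega

end TorusFrame

/-! ### Weights modulo two -/

section Mod2

open CompactMatrixGroup

variable {ι : Type} [Fintype ι] [DecidableEq ι] {K : CompactMatrixGroup ι} {G : Type}
  [CommGroup G] [TopologicalSpace G] {ρ : G →* K.Normalizer}

theorem mod2_eq_iff {χ ψ : PontryaginDual G} :
    mod2 χ = mod2 ψ ↔ ∃ φ : PontryaginDual G, φ ^ 2 = χ⁻¹ * ψ :=
  QuotientGroup.eq

/-- Two characters of a group that agree up to inversion at every element agree up to a global
inversion, since a group is not the union of two proper subgroups. -/
theorem eq_or_eq_inv_of_forall {χ ψ : PontryaginDual G}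
    (h : ∀ g, χ g = ψ g ∨ χ g = (ψ g)⁻¹) : χ = ψ ∨ χ = ψ⁻¹ := by
  by_contra hne
  push Not at hne
  obtain ⟨a, ha⟩ : ∃ a, χ a ≠ ψ a := by
    by_contra h'; push Not at h'; exact hne.1 (PontryaginDual.ext h')
  obtain ⟨b, hb⟩ : ∃ b, χ b ≠ (ψ b)⁻¹ := by
    by_contra h'; push Not at h'; exact hne.2 (PontryaginDual.ext h')
  have ha' := (h a).resolve_left ha
  have hb' := (h b).resolve_right hb
  rcases h (a * b) with h1 | h1
  · rw [map_mul, map_mul, hb'] at h1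
    exact ha (mul_right_cancel h1)
  · rw [map_mul, map_mul, mul_inv, ha'] at h1
    exact hb (mul_left_cancel h1)

/-- The isotropy weights are determined up to order and sign: on the real plane of the weight `χ`
the operator `g + g⁻¹` is the scalar `2 Re χ(g)`. -/
theorem exists_eq_or_eq_inv_of_isIsotropyWeights {p : K.Dual} {d d' : ℕ}
    {α : Fin d → PontryaginDual G} {β : Fin d' → PontryaginDual G}
    (hα : IsIsotropyWeights ρ p α) (hβ : IsIsotropyWeights ρ p β) (k : Fin d) :
    ∃ l, β l = α k ∨ β l = (α k)⁻¹ := by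
  obtain ⟨Ψ, hΨ, hΨr, hΨe⟩ := hα
  obtain ⟨Φ, hΦ, hΦr, hΦe⟩ := hβ
  -- A vector of weight `α k` has a non-zero component in some weight space `l` of the other family.
  obtain ⟨w, hw⟩ : Ψ (Pi.single k 1) ∈ LinearMap.range Φ := by
    rw [hΦr, ← hΨr]
    exact ⟨_, rfl⟩
  have hre : ∀ (χ : PontryaginDual G) (g : G), ((χ g : Circle) : ℂ) + ((χ g⁻¹ : Circle) : ℂ)
      = ((2 * ((χ g : Circle) : ℂ).re : ℝ) : ℂ) := fun χ g => by
    rw [map_inv, Circle.coe_inv_eq_conj, Complex.add_conj]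
  have hsum : ∀ {m : ℕ} {γ : Fin m → PontryaginDual G} {Θ : (Fin m → ℂ) →ₗ[ℝ] K.Dual},
      (∀ (g : G) (z : Fin m → ℂ), K.coAd (ρ g) (Θ z) = Θ fun i => ((γ i g : Circle) : ℂ) * z i) →
      ∀ (g : G) (z : Fin m → ℂ), K.coAd (ρ g) (Θ z) + K.coAd (ρ g⁻¹) (Θ z)
        = Θ fun i => ((2 * ((γ i g : Circle) : ℂ).re : ℝ) : ℂ) * z i := by
    intro m γ Θ h g z
    rw [h, h, ← map_add]
    congr 1
    funext i
    rw [Pi.add_apply, ← add_mul, hre]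
  have hw0 : w ≠ 0 := by
    rintro rfl
    rw [map_zero] at hw
    have h1 := hΨ (hw.symm.trans (map_zero Ψ).symm)
    have h2 := congrFun h1 k
    simp at h2
  obtain ⟨l, hl⟩ := Function.ne_iff.mp hw0
  have hkey : ∀ g, ((β l g : Circle) : ℂ).re = ((α k g : Circle) : ℂ).re := by
    intro g
    have h1 := hsum hΨe g (Pi.single k 1)
    have h2 := hsum hΦe g w
    rw [hw, h1] at h2
    have h3 : (fun i => ((2 * ((α i g : Circle) : ℂ).re : ℝ) : ℂ) * (Pi.single k 1 : Fin d → ℂ) i)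
        = (2 * ((α k g : Circle) : ℂ).re : ℝ) • (Pi.single k 1 : Fin d → ℂ) := by
      funext i
      by_cases h : i = k
      · subst h; simp
      · simp [h]
    rw [h3, map_smul, ← hw, ← map_smul] at h2
    have h4 := congrFun (hΦ h2) l
    rw [Pi.smul_apply, Complex.real_smul] at h4
    have h5 := mul_right_cancel₀ hl h4
    have h6 := Complex.ofReal_injective h5
    linarith
  refine ⟨l, eq_or_eq_inv_of_forall fun g => ?_⟩
  have h1 := hkey g
  have h2 := Circle.normSq_coe (β l g)
  have h3 := Circle.normSq_coe (α k g)
  rw [Complex.normSq_apply] at h2 h3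
  rw [h1] at h2
  have h4 : ((β l g : Circle) : ℂ).im * ((β l g : Circle) : ℂ).im
      = ((α k g : Circle) : ℂ).im * ((α k g : Circle) : ℂ).im := by linarith
  rcases mul_self_eq_mul_self_iff.mp h4 with h5 | h5
  · left
    exact Circle.ext (Complex.ext h1 h5)
  · right
    apply Circle.ext
    rw [Circle.coe_inv_eq_conj]
    exact Complex.ext h1 h5

theorem mod2_inv (χ : PontryaginDual G) : mod2 χ⁻¹ = mod2 χ :=
  mod2_eq_iff.mpr ⟨χ, by rw [inv_inv, sq]⟩

/-- If two isotropy weights at a fixed point agree mod 2 but not up to sign, the orbit is not a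
mod 2 GKM space. -/
theorem not_isMod2GKM {M : Set K.Dual} {p : K.Dual} (hp : p ∈ fixedPts ρ M) {d : ℕ}
    {α : Fin d → PontryaginDual G} (hα : IsIsotropyWeights ρ p α) {k l : Fin d}
    (hkl : mod2 (α k) = mod2 (α l)) (h1 : α k ≠ α l) (h2 : α k ≠ (α l)⁻¹) :
    ¬ IsMod2GKM ρ M := by
  rintro ⟨-, h⟩
  obtain ⟨d', β, hβ, hinj, -⟩ := h p hp
  obtain ⟨k', hk'⟩ := exists_eq_or_eq_inv_of_isIsotropyWeights hα hβ k
  obtain ⟨l', hl'⟩ := exists_eq_or_eq_inv_of_isIsotropyWeights hα hβ l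
  have e1 : mod2 (β k') = mod2 (α k) := by
    rcases hk' with h | h <;> rw [h]
    exact mod2_inv _
  have e2 : mod2 (β l') = mod2 (α l) := by
    rcases hl' with h | h <;> rw [h]
    exact mod2_inv _
  have e3 : k' = l' := hinj (by change mod2 _ = mod2 _; rw [e1, e2, hkl])
  subst e3
  rcases hk' with h | h <;> rcases hl' with h' | h' <;> rw [h] at h'
  · exact h1 h'
  · exact h2 h'
  · exact h2 (inv_eq_iff_eq_inv.mp h')
  · exact h1 (inv_injective h')

end Mod2

/-! ### Congruent weights on maximal orbits -/

section CongruentWeights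

open CompactMatrixGroup

variable {n : ℕ}

theorem torusEps_apply (i : Fin n) (t : Fin n → Circle) : torusEps i t = t i := rfl

theorem pontryaginDual_mul_apply {G : Type} [CommGroup G] [TopologicalSpace G]
    (χ ψ : PontryaginDual G) (g : G) : (χ * ψ) g = χ g * ψ g := rfl

theorem pontryaginDual_div_apply {G : Type} [CommGroup G] [TopologicalSpace G]
    (χ ψ : PontryaginDual G) (g : G) : (χ / ψ) g = χ g / ψ g := by
  rw [div_eq_mul_inv, div_eq_mul_inv]
  rfl

theorem pontryaginDual_inv_apply {G : Type} [CommGroup G] [TopologicalSpace G]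
    (χ : PontryaginDual G) (g : G) : χ⁻¹ g = (χ g)⁻¹ := rfl

/-- A point of the circle that differs from its inverse. -/
theorem exists_circle_ne_inv : ∃ z : Circle, z ≠ z⁻¹ := by
  refine ⟨Circle.exp (Real.pi / 2), fun h => ?_⟩
  have h1 := congrArg (fun z : Circle => (z : ℂ).im) h
  simp only [Circle.coe_inv_eq_conj, Complex.conj_im, Circle.coe_exp] at h1
  rw [show ((Real.pi / 2 : ℝ) : ℂ) * Complex.I = (Real.pi / 2 : ℂ) * Complex.I by push_cast; ring,
    Complex.exp_pi_div_two_mul_I] at h1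
  norm_num at h1

theorem torusEps_div_ne_mul {a b : Fin n} (h : a ≠ b) :
    torusEps a / torusEps b ≠ torusEps a * torusEps b := by
  intro he
  obtain ⟨z, hz⟩ := exists_circle_ne_inv
  have h1 := congrArg (fun χ : PontryaginDual (Fin n → Circle) => χ (Pi.mulSingle b z)) he
  simp only [pontryaginDual_div_apply, pontryaginDual_mul_apply, torusEps_apply,
    Pi.mulSingle_eq_same, Pi.mulSingle_eq_of_ne h, one_div, one_mul] at h1
  exact hz h1.symm

theorem torusEps_div_ne_mul_inv {a b : Fin n} (h : a ≠ b) :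
    torusEps a / torusEps b ≠ (torusEps a * torusEps b)⁻¹ := by
  intro he
  obtain ⟨z, hz⟩ := exists_circle_ne_inv
  have h1 := congrArg (fun χ : PontryaginDual (Fin n → Circle) => χ (Pi.mulSingle a z)) he
  simp only [pontryaginDual_div_apply, pontryaginDual_mul_apply, pontryaginDual_inv_apply,
    torusEps_apply, Pi.mulSingle_eq_same, Pi.mulSingle_eq_of_ne h.symm, div_one, mul_one] at h1
  exact hz h1

theorem mod2_torusEps_div (a b : Fin n) :
    mod2 (torusEps a / torusEps b) = mod2 (torusEps a * torusEps b) :=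
  mod2_eq_iff.mpr ⟨torusEps b, by rw [inv_div, div_mul_eq_mul_div, mul_left_comm,
    mul_div_cancel_left, sq]⟩

/-- If both `ε_a - ε_b` and `ε_a + ε_b` are roots for all `a < b`, they are isotropy weights at
every fixed point of a maximal orbit and obstruct the mod 2 GKM property. -/
theorem TorusFrame.not_isMod2GKM_and_hasCongruentWeights {ι : Type} [Fintype ι] [DecidableEq ι]
    {K : CompactMatrixGroup ι} {ρ : (Fin n → Circle) →* K.Normalizer} {κ : Type} [Finite κ]
    (F : TorusFrame K ρ κ) (hn : 2 ≤ n)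
    (h : ∀ a b : Fin n, a < b → (∃ k, F.weight k = torusEps a / torusEps b) ∧
      ∃ l, F.weight l = torusEps a * torusEps b)
    {ξ : K.Dual} (hξ : K.IsMaximalOrbit ξ) :
    ¬ IsMod2GKM ρ (K.coadjointOrbit ξ) ∧ HasCongruentWeights ρ (K.coadjointOrbit ξ) := by
  classical
  have := Fintype.ofFinite κ
  have hw : ∀ p ∈ fixedPts ρ (K.coadjointOrbit ξ),
      ∃ (d : ℕ) (α : Fin d → PontryaginDual (Fin n → Circle)), IsIsotropyWeights ρ p α ∧
        ∀ k, ∃ m, α m = F.weight k := by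
    intro p hp
    obtain ⟨A, hA, rfl⟩ := K.exists_mem_lie_traceDual_eq p
    obtain ⟨hm, hd⟩ := (F.mem_fixedPts_iff hA).mp hp
    have e := Fintype.equivFin
      {k : κ // F.mat A (F.row k) (F.row k) ≠ F.mat A (F.col k) (F.col k)}
    refine ⟨_, _, F.isIsotropyWeights hA hd e.symm, fun k =>
      ⟨e ⟨k, F.ne_of_isMaximalOrbit hξ hA hd hm k⟩, ?_⟩⟩
    simp only [Equiv.symm_apply_apply]
  obtain ⟨A, hA, hd, hm⟩ := F.exists_isDiag_mem_coadjointOrbit ξ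
  have hfix : K.traceDual A ∈ fixedPts ρ (K.coadjointOrbit ξ) :=
    (F.mem_fixedPts_iff hA).mpr ⟨hm, hd⟩
  constructor
  · obtain ⟨d, α, hα, hk⟩ := hw _ hfix
    have hab : (⟨0, by omega⟩ : Fin n) < ⟨1, by omega⟩ := by simp
    obtain ⟨⟨k, hk1⟩, l, hl1⟩ := h _ _ hab
    obtain ⟨k', hk'⟩ := hk k
    obtain ⟨l', hl'⟩ := hk l
    rw [hk1] at hk'
    rw [hl1] at hl'
    refine not_isMod2GKM hfix hα (k := k') (l := l') ?_ ?_ ?_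
    · rw [hk', hl']; exact mod2_torusEps_div _ _
    · rw [hk', hl']; exact torusEps_div_ne_mul hab.ne
    · rw [hk', hl']; exact torusEps_div_ne_mul_inv hab.ne
  · refine ⟨⟨_, hfix⟩, fun p hp => ?_⟩
    obtain ⟨d, α, hα, hk⟩ := hw p hp
    refine ⟨d, α, hα, fun a b hab => ?_⟩
    obtain ⟨⟨k, hk1⟩, l, hl1⟩ := h a b hab
    obtain ⟨k', hk'⟩ := hk k
    obtain ⟨l', hl'⟩ := hk l
    exact ⟨⟨k', hk'.trans hk1⟩, ⟨l', hl'.trans hl1⟩, mod2_torusEps_div a b⟩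

end CongruentWeights

/-! ### Root coordinates of the symplectic and orthogonal groups -/

section Frames

open CompactMatrixGroup Matrix

variable {n : ℕ}

/-- The pairs `a < b` of indices, which label the roots `ε_a - ε_b` and `ε_a + ε_b`. -/
abbrev IndexPair (n : ℕ) : Type := {p : Fin n × Fin n // p.1 < p.2}

/-- A matrix `Z` with `Z b a = s (Z a b)`, for an involution `s`, can be prescribed freely above the
diagonal. -/
theorem exists_matrix_of_involution (s : ℂ → ℂ) (hs : Function.Involutive s) (z : IndexPair n → ℂ)
    (d : Fin n → ℂ) (hd : ∀ a, s (d a) = d a) :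
    ∃ Z : Matrix (Fin n) (Fin n) ℂ, (∀ p : IndexPair n, Z p.1.1 p.1.2 = z p) ∧
      (∀ a b, Z b a = s (Z a b)) ∧ ∀ a, Z a a = d a := by
  refine ⟨Matrix.of fun a b => if h : a < b then z ⟨(a, b), h⟩ else
    if h : b < a then s (z ⟨(b, a), h⟩) else d a, ?_, ?_, ?_⟩
  · rintro ⟨⟨a, b⟩, h⟩
    simp only [Matrix.of_apply]
    exact dif_pos h
  · intro a b
    simp only [Matrix.of_apply]
    rcases lt_trichotomy a b with h | h | h
    · rw [dif_neg h.not_gt, dif_pos h, dif_pos h]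
    · subst h
      simp [hd]
    · rw [dif_pos h, dif_neg h.not_gt, dif_pos h, hs]
  · intro a
    simp

theorem forall_ne_eq_zero_of_forall_lt {Z : Matrix (Fin n) (Fin n) ℂ} {s : ℂ → ℂ} (hs : s 0 = 0)
    (hZ : ∀ a b, Z b a = s (Z a b)) (h : ∀ p : IndexPair n, Z p.1.1 p.1.2 = 0) (a b : Fin n)
    (hab : a ≠ b) : Z a b = 0 := by
  rcases lt_or_gt_of_ne hab with h1 | h1
  · exact h ⟨(a, b), h1⟩
  · rw [hZ b a, h ⟨(b, a), h1⟩, hs]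

theorem mem_lie_groupSp_iff {X : Matrix (Fin n ⊕ Fin n) (Fin n ⊕ Fin n) ℂ} :
    X ∈ (groupSp (Fin n)).lie ↔ Xᴴ = -X ∧ X * Matrix.J (Fin n) ℂ + Matrix.J (Fin n) ℂ * Xᵀ = 0 :=
  Iff.rfl

theorem fromBlocks_mem_lie_groupSp_iff {P Q R S : Matrix (Fin n) (Fin n) ℂ} :
    fromBlocks P Q R S ∈ (groupSp (Fin n)).lie ↔
      Pᴴ = -P ∧ Qᵀ = Q ∧ R = -Qᴴ ∧ S = -Pᵀ := by
  rw [mem_lie_groupSp_iff, fromBlocks_conjTranspose, fromBlocks_neg, fromBlocks_inj, Matrix.J,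
    fromBlocks_transpose, fromBlocks_multiply, fromBlocks_multiply, fromBlocks_add,
    ← fromBlocks_zero, fromBlocks_inj]
  simp only [mul_zero, zero_add, mul_one, mul_neg, add_zero, zero_mul, neg_mul, one_mul]
  have hc : ∀ M : Matrix (Fin n) (Fin n) ℂ, Mᵀᴴ = Mᴴᵀ := fun _ => rfl
  constructor
  · rintro ⟨⟨h1, h2, h3, h4⟩, h5, h6, h7, h8⟩
    refine ⟨h1, (add_neg_eq_zero.mp h5).symm, ?_, add_eq_zero_iff_eq_neg.mp h7⟩
    rw [h3, neg_neg]
  · rintro ⟨h1, h2, rfl, rfl⟩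
    refine ⟨⟨h1, ?_, ?_, ?_⟩, ?_, ?_, ?_, ?_⟩
    · rw [conjTranspose_neg, conjTranspose_conjTranspose]
    · rw [neg_neg]
    · rw [conjTranspose_neg, hc, h1, transpose_neg]
    · rw [h2, add_neg_cancel]
    · rw [transpose_neg, transpose_transpose, neg_neg, neg_add_cancel]
    · rw [neg_add_cancel]
    · rw [transpose_neg, neg_neg, ← hc, h2, add_neg_cancel]

theorem I_mul_succ_ne_neg (a b : Fin n) :
    Complex.I * ((a : ℂ) + 1) ≠ -(Complex.I * ((b : ℂ) + 1)) := by
  intro h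
  have h1 : (a : ℂ) + 1 = -((b : ℂ) + 1) :=
    mul_left_cancel₀ Complex.I_ne_zero (by rw [h, mul_neg])
  have h2 : (((a : ℕ) + 1 + ((b : ℕ) + 1) : ℕ) : ℂ) = 0 := by
    push_cast
    rw [h1]; ring
  exact absurd (Nat.cast_eq_zero.mp h2) (by omega)

theorem I_mul_succ_ne {a b : Fin n} (hab : a ≠ b) :
    Complex.I * ((a : ℂ) + 1) ≠ Complex.I * ((b : ℂ) + 1) := by
  intro h
  have h1 := add_right_cancel (mul_left_cancel₀ Complex.I_ne_zero h)
  exact hab (Fin.ext (Nat.cast_injective h1))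

/-- The characters of `T^n` on the standard representation of `Sp(n)` and on the complexification
of that of `SO(2n)`. -/
noncomputable def signedEps : Fin n ⊕ Fin n → PontryaginDual (Fin n → Circle) :=
  Sum.elim torusEps fun a => (torusEps a)⁻¹

theorem exists_signedEps_inl_ne (a : Fin n) (y : Fin n ⊕ Fin n) (h : Sum.inl a ≠ y) :
    ∃ t, signedEps (Sum.inl a) t ≠ signedEps y t := by
  obtain ⟨z, hz⟩ := exists_circle_ne_inv
  refine ⟨Pi.mulSingle a z, ?_⟩
  have hz1 : z ≠ 1 := by
    rintro rfl
    simp at hz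
  rcases y with b | b
  · have hab : b ≠ a := fun e => h (by rw [e])
    simpa [signedEps, torusEps_apply, hab] using hz1
  · by_cases hab : b = a
    · subst hab
      simpa [signedEps, torusEps_apply, pontryaginDual_inv_apply] using hz
    · simpa [signedEps, torusEps_apply, pontryaginDual_inv_apply, hab] using hz1

/-- The frame of `Sp(n)`: the torus is diagonal already.  In the block form `(P, Q; -Qᴴ, -Pᵀ)` of
the Lie algebra the root coordinates are the entries of `P` above the diagonal, with weights
`ε_a - ε_b`, and those of the symmetric matrix `Q`, with weights `ε_a + ε_b` and `2 ε_a`. -/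
noncomputable def frameSp (n : ℕ) :
    TorusFrame (groupSp (Fin n)) (torusSp n) ((IndexPair n ⊕ IndexPair n) ⊕ Fin n) where
  W := 1
  V := 1
  W_mul_V := mul_one 1
  char := signedEps
  diag t := by
    rw [one_mul, mul_one]
    change fromBlocks (diagonal fun i => (t i : ℂ)) 0 0 (diagonal fun i => ((t i)⁻¹ : ℂ)) = _
    rw [fromBlocks_diagonal]
    congr 1
    funext i
    rcases i with i | i
    · rfl
    · exact (Circle.coe_inv (t i)).symm
  row := Sum.elim (Sum.elim (fun p => Sum.inl p.1.1) fun p => Sum.inl p.1.1) Sum.inl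
  col := Sum.elim (Sum.elim (fun p => Sum.inl p.1.2) fun p => Sum.inr p.1.2) Sum.inr
  exists_coord z := by
    obtain ⟨P, hP1, hP2, -⟩ := exists_matrix_of_involution (fun w => -(starRingEnd ℂ) w)
      (fun w => by simp) (fun p => z (Sum.inl (Sum.inl p))) (fun _ => 0) (fun _ => by simp)
    obtain ⟨Q, hQ1, hQ2, hQ3⟩ := exists_matrix_of_involution id (fun w => rfl)
      (fun p => z (Sum.inl (Sum.inr p))) (fun a => z (Sum.inr a)) (fun _ => rfl)
    refine ⟨fromBlocks P Q (-Qᴴ) (-Pᵀ), fromBlocks_mem_lie_groupSp_iff.mpr ⟨?_, ?_, rfl, rfl⟩, ?_⟩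
    · ext a b
      rw [conjTranspose_apply, Matrix.neg_apply, hP2 a b]
      simp
    · ext a b
      exact hQ2 a b
    · rw [one_mul, mul_one]
      rintro ((p | p) | a)
      · exact hP1 p
      · exact hQ1 p
      · exact hQ3 a
  offDiag X hX h := by
    rw [one_mul, mul_one] at h ⊢
    rw [← fromBlocks_toBlocks X] at hX h ⊢
    obtain ⟨h1, h2, h3, h4⟩ := fromBlocks_mem_lie_groupSp_iff.mp hX
    have hP := forall_ne_eq_zero_of_forall_lt (Z := X.toBlocks₁₁) (s := fun w => -(starRingEnd ℂ) w)
      (by simp) (fun a b => by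
        have := congrFun (congrFun h1 b) a
        rw [conjTranspose_apply, Matrix.neg_apply] at this
        change _ = -star _
        rw [this, neg_neg]) (fun p => h (Sum.inl (Sum.inl p)))
    have hQ' := forall_ne_eq_zero_of_forall_lt (Z := X.toBlocks₁₂) (s := id) rfl
      (fun a b => congrFun (congrFun h2 a) b) (fun p => h (Sum.inl (Sum.inr p)))
    have hQ : X.toBlocks₁₂ = 0 := by
      ext a b
      by_cases hab : a = b
      · subst hab
        exact h (Sum.inr a)
      · exact hQ' a b hab
    rintro (a | a) (b | b) hab
    · exact hP a b fun e => hab (by rw [e])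
    · rw [fromBlocks_apply₁₂, hQ, Matrix.zero_apply]
    · rw [fromBlocks_apply₂₁, h3, hQ, conjTranspose_zero, neg_zero, Matrix.zero_apply]
    · rw [fromBlocks_apply₂₂, h4, Matrix.neg_apply, transpose_apply,
        hP b a fun e => hab (by rw [e]), neg_zero]
  exists_regular := by
    refine ⟨fromBlocks (diagonal fun a => Complex.I * ((a : ℂ) + 1)) 0 0
      (diagonal fun a => -(Complex.I * ((a : ℂ) + 1))),
      fromBlocks_mem_lie_groupSp_iff.mpr ⟨?_, ?_, ?_, ?_⟩, ?_, ?_⟩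
    · rw [diagonal_conjTranspose, diagonal_neg]
      congr 1
      funext a
      simp
    · simp
    · simp
    · rw [diagonal_transpose, diagonal_neg]
    · rw [one_mul, mul_one, fromBlocks_diagonal]
      exact fun i j hij => diagonal_apply_ne _ hij
    · rw [one_mul, mul_one, fromBlocks_diagonal]
      rintro ((p | p) | a) <;> rw [diagonal_apply_eq, diagonal_apply_eq]
      · exact I_mul_succ_ne p.2.ne
      · exact I_mul_succ_ne_neg _ _
      · exact I_mul_succ_ne_neg _ _
  char_ne := by
    rintro ((p | p) | a)
    · exact exists_signedEps_inl_ne _ _ fun e => p.2.ne (Sum.inl.inj e)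
    · exact exists_signedEps_inl_ne _ _ Sum.inl_ne_inr
    · exact exists_signedEps_inl_ne _ _ Sum.inl_ne_inr

theorem mem_lie_groupSO_iff {ι : Type} [Fintype ι] [DecidableEq ι] {X : Matrix ι ι ℂ} :
    X ∈ (groupSO ι).lie ↔ (∀ i j, X j i = -X i j) ∧ ∀ i j, (starRingEnd ℂ) (X i j) = X i j := by
  change (Xᴴ = -X ∧ X.map (starRingEnd ℂ) = X) ↔ _
  constructor
  · rintro ⟨h1, h2⟩
    have h3 : ∀ i j, (starRingEnd ℂ) (X i j) = X i j := fun i j => congrFun (congrFun h2 i) j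
    refine ⟨fun i j => ?_, h3⟩
    have h4 := congrFun (congrFun h1 i) j
    rw [conjTranspose_apply] at h4
    rw [← h3 j i]
    exact h4
  · rintro ⟨h1, h2⟩
    refine ⟨?_, ?_⟩
    · ext i j
      rw [conjTranspose_apply, Matrix.neg_apply, ← h1]
      exact h2 j i
    · ext i j
      exact h2 i j

/-- The rows `e_a ± i f_a`: the change of basis that diagonalises the rotations. -/
noncomputable def soW (n : ℕ) : Matrix (Fin n ⊕ Fin n) (Fin n ⊕ Fin n) ℂ :=
  fromBlocks 1 (Complex.I • 1) 1 (-Complex.I • 1)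

/-- The inverse of `soW n`. -/
noncomputable def soV (n : ℕ) : Matrix (Fin n ⊕ Fin n) (Fin n ⊕ Fin n) ℂ :=
  fromBlocks ((1 / 2 : ℂ) • 1) ((1 / 2 : ℂ) • 1) ((-Complex.I / 2) • 1) ((Complex.I / 2) • 1)

theorem soW_mul_mul_soV (A B C D : Matrix (Fin n) (Fin n) ℂ) :
    soW n * fromBlocks A B C D * soV n
      = fromBlocks ((1 / 2 : ℂ) • (A + D + Complex.I • (C - B)))
          ((1 / 2 : ℂ) • (A - D + Complex.I • (C + B)))
          ((1 / 2 : ℂ) • (A - D - Complex.I • (C + B)))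
          ((1 / 2 : ℂ) • (A + D - Complex.I • (C - B))) := by
  rw [soW, soV, fromBlocks_multiply, fromBlocks_multiply, fromBlocks_inj]
  simp only [one_mul, smul_mul_assoc, mul_smul_comm, mul_one]
  have hI : Complex.I * Complex.I = -1 := Complex.I_mul_I
  refine ⟨?_, ?_, ?_, ?_⟩ <;> ext i j <;>
    simp only [Matrix.add_apply, Matrix.sub_apply, Matrix.smul_apply, smul_eq_mul]
  · linear_combination (-(D i j) / 2) * hI
  · linear_combination (D i j / 2) * hI
  · linear_combination (D i j / 2) * hI
  · linear_combination (-(D i j) / 2) * hI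

theorem soW_mul_soV : soW n * soV n = 1 := by
  have h := soW_mul_mul_soV (n := n) 1 0 0 1
  rw [fromBlocks_one, mul_one] at h
  rw [h, ← fromBlocks_one, fromBlocks_inj]
  refine ⟨?_, ?_, ?_, ?_⟩ <;> ext i j <;> simp <;> ring

theorem soW_mul_rotationMatrix_mul_soV (t : Fin n → Circle) :
    soW n * rotationMatrix t * soV n
      = diagonal fun i => ((signedEps i t : Circle) : ℂ) := by
  have hre : ∀ w : ℂ, (w.re : ℂ) + Complex.I * w.im = w := fun w => by
    rw [mul_comm]; exact Complex.re_add_im w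
  have hd : (diagonal fun i => ((signedEps i t : Circle) : ℂ))
      = fromBlocks (diagonal fun i => (t i : ℂ)) 0 0
        (diagonal fun i => (starRingEnd ℂ) (t i : ℂ)) := by
    rw [fromBlocks_diagonal]
    congr 1
    funext i
    rcases i with i | i
    · rfl
    · exact Circle.coe_inv_eq_conj (t i)
  have hconj : ∀ w : ℂ, (w.re : ℂ) - Complex.I * w.im = (starRingEnd ℂ) w := fun w => by
    apply Complex.ext <;> simp
  rw [rotationMatrix, soW_mul_mul_soV, hd, fromBlocks_inj]
  simp only [diagonal_add, diagonal_sub, ← diagonal_smul, ← diagonal_zero,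
    diagonal_eq_diagonal_iff, Pi.smul_apply, smul_eq_mul]
  refine ⟨fun i => ?_, fun i => ?_, fun i => ?_, fun i => ?_⟩
  · linear_combination hre (t i)
  · ring
  · ring
  · linear_combination hconj (t i)

theorem exists_mem_lie_groupSO (z w : IndexPair n → ℂ) :
    ∃ X ∈ (groupSO (Fin n ⊕ Fin n)).lie, ∀ p : IndexPair n,
      (soW n * X * soV n) (Sum.inl p.1.1) (Sum.inl p.1.2) = z p ∧
      (soW n * X * soV n) (Sum.inl p.1.1) (Sum.inr p.1.2) = w p := by
  obtain ⟨P, hP1, hP2, -⟩ := exists_matrix_of_involution (fun w => -(starRingEnd ℂ) w)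
    (fun w => by simp) z (fun _ => 0) (fun _ => by simp)
  obtain ⟨Q, hQ1, hQ2, -⟩ := exists_matrix_of_involution (fun w => -w)
    (fun w => neg_neg w) w (fun _ => 0) (fun _ => by simp)
  have hre : ∀ w : ℂ, (w.re : ℂ) + Complex.I * w.im = w := fun w => by
    rw [mul_comm]; exact Complex.re_add_im w
  refine ⟨fromBlocks (of fun a b => (((P a b).re + (Q a b).re : ℝ) : ℂ))
    (of fun a b => (((Q a b).im - (P a b).im : ℝ) : ℂ))
    (of fun a b => (((Q a b).im + (P a b).im : ℝ) : ℂ))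
    (of fun a b => (((P a b).re - (Q a b).re : ℝ) : ℂ)),
    mem_lie_groupSO_iff.mpr ⟨?_, ?_⟩, fun p => ⟨?_, ?_⟩⟩
  · rintro (a | a) (b | b) <;> simp [hP2 a b, hQ2 a b] <;> ring
  · rintro (a | a) (b | b) <;> simp
  · rw [soW_mul_mul_soV, fromBlocks_apply₁₁, ← hP1]
    simp only [Matrix.add_apply, Matrix.sub_apply, Matrix.smul_apply, smul_eq_mul, of_apply]
    push_cast
    linear_combination hre (P p.1.1 p.1.2)
  · rw [soW_mul_mul_soV, fromBlocks_apply₁₂, ← hQ1]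
    simp only [Matrix.add_apply, Matrix.sub_apply, Matrix.smul_apply, smul_eq_mul, of_apply]
    push_cast
    linear_combination hre (Q p.1.1 p.1.2)

theorem offDiag_groupSO {X : Matrix (Fin n ⊕ Fin n) (Fin n ⊕ Fin n) ℂ}
    (hX : X ∈ (groupSO (Fin n ⊕ Fin n)).lie)
    (h1 : ∀ p : IndexPair n, (soW n * X * soV n) (Sum.inl p.1.1) (Sum.inl p.1.2) = 0)
    (h2 : ∀ p : IndexPair n, (soW n * X * soV n) (Sum.inl p.1.1) (Sum.inr p.1.2) = 0)
    (i j : Fin n ⊕ Fin n) (hij : i ≠ j) : (soW n * X * soV n) i j = 0 := by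
  obtain ⟨hs, hr⟩ := mem_lie_groupSO_iff.mp hX
  have hX' := fromBlocks_toBlocks X
  set A := X.toBlocks₁₁
  set B := X.toBlocks₁₂
  set C := X.toBlocks₂₁
  set D := X.toBlocks₂₂
  have sA : ∀ a b, A b a = -A a b := fun a b => hs (Sum.inl a) (Sum.inl b)
  have sB : ∀ a b, C b a = -B a b := fun a b => hs (Sum.inl a) (Sum.inr b)
  have sD : ∀ a b, D b a = -D a b := fun a b => hs (Sum.inr a) (Sum.inr b)
  have rA : ∀ a b, (starRingEnd ℂ) (A a b) = A a b := fun a b => hr (Sum.inl a) (Sum.inl b)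
  have rB : ∀ a b, (starRingEnd ℂ) (B a b) = B a b := fun a b => hr (Sum.inl a) (Sum.inr b)
  have rC : ∀ a b, (starRingEnd ℂ) (C a b) = C a b := fun a b => hr (Sum.inr a) (Sum.inl b)
  have rD : ∀ a b, (starRingEnd ℂ) (D a b) = D a b := fun a b => hr (Sum.inr a) (Sum.inr b)
  rw [← hX', soW_mul_mul_soV] at h1 h2 ⊢
  set P : Matrix (Fin n) (Fin n) ℂ := (1 / 2 : ℂ) • (A + D + Complex.I • (C - B)) with hPdef
  set Q : Matrix (Fin n) (Fin n) ℂ := (1 / 2 : ℂ) • (A - D + Complex.I • (C + B)) with hQdef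
  have eP : ∀ a b, P a b = 1 / 2 * (A a b + D a b + Complex.I * (C a b - B a b)) :=
    fun _ _ => rfl
  have eQ : ∀ a b, Q a b = 1 / 2 * (A a b - D a b + Complex.I * (C a b + B a b)) :=
    fun _ _ => rfl
  have hP := forall_ne_eq_zero_of_forall_lt (Z := P) (s := fun w => -(starRingEnd ℂ) w)
    (by simp) (fun a b => by
      rw [eP, eP]
      simp only [map_mul, map_add, map_sub, rA, rB, rC, rD, Complex.conj_I, map_div₀, map_one,
        map_ofNat]
      rw [sA a b, sD a b, sB a b, ← neg_eq_iff_eq_neg.mpr (sB b a)]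
      ring) (fun p => h1 p)
  have hQs : ∀ a b, Q b a = -Q a b := fun a b => by
    rw [eQ, eQ, sA a b, sD a b, sB a b, ← neg_eq_iff_eq_neg.mpr (sB b a)]
    ring
  have hQ : ∀ a b, Q a b = 0 := fun a b => by
    by_cases hab : a = b
    · subst hab
      exact self_eq_neg.mp (hQs a a)
    · exact forall_ne_eq_zero_of_forall_lt (Z := Q) (s := fun w => -w) neg_zero hQs
        (fun p => h2 p) a b hab
  have hQ' : ∀ a b, ((1 / 2 : ℂ) • (A - D - Complex.I • (C + B))) a b
      = (starRingEnd ℂ) (Q a b) := by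
    intro a b
    rw [eQ]
    simp only [Matrix.add_apply, Matrix.sub_apply, Matrix.smul_apply, smul_eq_mul,
      map_mul, map_add, map_sub, rA, rB, rC, rD, Complex.conj_I, map_div₀, map_one,
      map_ofNat]
    ring
  have hP' : ∀ a b, ((1 / 2 : ℂ) • (A + D - Complex.I • (C - B))) a b
      = (starRingEnd ℂ) (P a b) := by
    intro a b
    rw [eP]
    simp only [Matrix.add_apply, Matrix.sub_apply, Matrix.smul_apply, smul_eq_mul,
      map_mul, map_add, map_sub, rA, rB, rC, rD, Complex.conj_I, map_div₀, map_one,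
      map_ofNat]
    ring
  rcases i with a | a <;> rcases j with b | b
  · exact hP a b fun e => hij (by rw [e])
  · exact hQ a b
  · rw [fromBlocks_apply₂₁, hQ', hQ, map_zero]
  · rw [fromBlocks_apply₂₂, hP', hP a b fun e => hij (by rw [e]), map_zero]

/-- The infinitesimal rotations with pairwise distinct positive angles. -/
noncomputable def soRegular (n : ℕ) : Matrix (Fin n ⊕ Fin n) (Fin n ⊕ Fin n) ℂ :=
  fromBlocks 0 (diagonal fun a : Fin n => -((a : ℂ) + 1)) (diagonal fun a : Fin n => (a : ℂ) + 1) 0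

theorem soRegular_mem : soRegular n ∈ (groupSO (Fin n ⊕ Fin n)).lie := by
  refine mem_lie_groupSO_iff.mpr ⟨?_, ?_⟩
  · rintro (a | a) (b | b) <;> simp only [soRegular, fromBlocks_apply₁₁, fromBlocks_apply₁₂,
      fromBlocks_apply₂₁, fromBlocks_apply₂₂, diagonal_apply, Matrix.zero_apply, neg_zero,
      eq_comm (a := b)] <;> split_ifs with hab <;> simp [hab]
  · rintro (a | a) (b | b) <;> by_cases hab : a = b <;> simp [soRegular, hab]

theorem soW_mul_soRegular_mul_soV : soW n * soRegular n * soV n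
    = diagonal (Sum.elim (fun a : Fin n => Complex.I * ((a : ℂ) + 1))
        fun a : Fin n => -(Complex.I * ((a : ℂ) + 1))) := by
  have h : diagonal (Sum.elim (fun a : Fin n => Complex.I * ((a : ℂ) + 1))
        fun a : Fin n => -(Complex.I * ((a : ℂ) + 1)))
      = fromBlocks (diagonal fun a : Fin n => Complex.I * ((a : ℂ) + 1)) 0 0
        (diagonal fun a : Fin n => -(Complex.I * ((a : ℂ) + 1))) := by
    rw [fromBlocks_diagonal]
  rw [soRegular, soW_mul_mul_soV, h, fromBlocks_inj]
  simp only [diagonal_add, diagonal_sub, zero_add, zero_sub, sub_zero,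
    ← diagonal_smul, ← diagonal_zero, diagonal_eq_diagonal_iff, Pi.smul_apply, smul_eq_mul]
  refine ⟨fun i => ?_, fun i => ?_, fun i => ?_, fun i => ?_⟩ <;> ring

/-- The frame of `SO(2n)`: after the change of basis `soW n`, the entries `(a, b)` and `(a, b̄)` for
`a < b` are root coordinates, with weights `ε_a - ε_b` and `ε_a + ε_b`. -/
noncomputable def frameSOEven (n : ℕ) :
    TorusFrame (groupSO (Fin n ⊕ Fin n)) (torusSOEven n) (IndexPair n ⊕ IndexPair n) where
  W := soW n
  V := soV n
  W_mul_V := soW_mul_soV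
  char := signedEps
  diag := soW_mul_rotationMatrix_mul_soV
  row := Sum.elim (fun p => Sum.inl p.1.1) fun p => Sum.inl p.1.1
  col := Sum.elim (fun p => Sum.inl p.1.2) fun p => Sum.inr p.1.2
  exists_coord z := by
    obtain ⟨X, hX, h⟩ := exists_mem_lie_groupSO (z ∘ Sum.inl) (z ∘ Sum.inr)
    refine ⟨X, hX, ?_⟩
    rintro (p | p)
    · exact (h p).1
    · exact (h p).2
  offDiag X hX h := offDiag_groupSO hX (fun p => h (Sum.inl p)) fun p => h (Sum.inr p)
  exists_regular := by
    refine ⟨_, soRegular_mem, ?_, ?_⟩ <;> rw [soW_mul_soRegular_mul_soV]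
    · exact fun i j hij => diagonal_apply_ne _ hij
    · rintro (p | p) <;> rw [diagonal_apply_eq, diagonal_apply_eq]
      · exact I_mul_succ_ne p.2.ne
      · exact I_mul_succ_ne_neg _ _
  char_ne := by
    rintro (p | p)
    · exact exists_signedEps_inl_ne _ _ fun e => p.2.ne (Sum.inl.inj e)
    · exact exists_signedEps_inl_ne _ _ Sum.inl_ne_inr

theorem fromBlocks_conj_fromBlocks {m : Type} [Fintype m] [DecidableEq m]
    (W V Y : Matrix m m ℂ) (v : Matrix m Unit ℂ) (w : Matrix Unit m ℂ) (c : Matrix Unit Unit ℂ) :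
    fromBlocks W 0 0 1 * fromBlocks Y v w c * fromBlocks V 0 0 1
      = fromBlocks (W * Y * V) (W * v) (w * V) c := by
  simp [fromBlocks_multiply]

theorem fromBlocks_mem_lie_groupSO_iff {m : Type} [Fintype m] [DecidableEq m]
    {Y : Matrix m m ℂ} {v : Matrix m Unit ℂ} {w : Matrix Unit m ℂ} {c : Matrix Unit Unit ℂ} :
    fromBlocks Y v w c ∈ (groupSO (m ⊕ Unit)).lie ↔ Y ∈ (groupSO m).lie ∧
      (∀ i j, (starRingEnd ℂ) (v i j) = v i j) ∧ w = -vᵀ ∧ c = 0 := by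
  rw [mem_lie_groupSO_iff, mem_lie_groupSO_iff]
  constructor
  · rintro ⟨h1, h2⟩
    refine ⟨⟨fun i j => h1 (Sum.inl i) (Sum.inl j), fun i j => h2 (Sum.inl i) (Sum.inl j)⟩,
      fun i j => h2 (Sum.inl i) (Sum.inr j), ?_, ?_⟩
    · ext i j
      exact h1 (Sum.inl j) (Sum.inr i)
    · ext i j
      exact self_eq_neg.mp (h1 (Sum.inr i) (Sum.inr j))
  · rintro ⟨⟨h1, h2⟩, h3, rfl, rfl⟩
    refine ⟨?_, ?_⟩
    · rintro (i | i) (j | j)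
      · exact h1 i j
      · rfl
      · exact (neg_neg _).symm
      · exact neg_zero.symm
    · rintro (i | i) (j | j)
      · exact h2 i j
      · exact h3 i j
      · simpa using h3 j i
      · simp

theorem soW_mul_apply_inl (v : Matrix (Fin n ⊕ Fin n) Unit ℂ) (a : Fin n) (u : Unit) :
    (soW n * v) (Sum.inl a) u = v (Sum.inl a) u + Complex.I * v (Sum.inr a) u := by
  rw [mul_apply, Fintype.sum_sum_type]
  simp [soW, one_apply]

/-- The frame of `SO(2n+1)`: that of `SO(2n)`, together with the coordinates in the last column, of
weights `ε_a`. -/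
noncomputable def frameSOOdd (n : ℕ) :
    TorusFrame (groupSO ((Fin n ⊕ Fin n) ⊕ Unit)) (torusSOOdd n)
      ((IndexPair n ⊕ IndexPair n) ⊕ Fin n) where
  W := fromBlocks (soW n) 0 0 1
  V := fromBlocks (soV n) 0 0 1
  W_mul_V := by
    rw [fromBlocks_multiply]
    simp [soW_mul_soV]
  char := Sum.elim signedEps fun _ => 1
  diag t := by
    change fromBlocks (soW n) 0 0 1 * fromBlocks (rotationMatrix t) 0 0 1 *
      fromBlocks (soV n) 0 0 1 = _
    rw [fromBlocks_conj_fromBlocks, soW_mul_rotationMatrix_mul_soV, Matrix.mul_zero,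
      Matrix.zero_mul, ← diagonal_one, fromBlocks_diagonal]
    congr 1
    funext i
    rcases i with i | i <;> rfl
  row := Sum.elim (Sum.elim (fun p => Sum.inl (Sum.inl p.1.1)) fun p => Sum.inl (Sum.inl p.1.1))
    fun a => Sum.inl (Sum.inl a)
  col := Sum.elim (Sum.elim (fun p => Sum.inl (Sum.inl p.1.2)) fun p => Sum.inl (Sum.inr p.1.2))
    fun _ => Sum.inr ()
  exists_coord z := by
    obtain ⟨Y, hY, h⟩ := exists_mem_lie_groupSO (fun p => z (Sum.inl (Sum.inl p)))
      (fun p => z (Sum.inl (Sum.inr p)))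
    let v : Matrix (Fin n ⊕ Fin n) Unit ℂ := of fun i _ =>
      Sum.elim (fun a => ((z (Sum.inr a)).re : ℂ)) (fun a => ((z (Sum.inr a)).im : ℂ)) i
    refine ⟨fromBlocks Y v (-vᵀ) 0, fromBlocks_mem_lie_groupSO_iff.mpr ⟨hY, ?_, rfl, rfl⟩, ?_⟩
    · rintro (i | i) j <;> simp [v]
    · rw [fromBlocks_conj_fromBlocks]
      rintro ((p | p) | a)
      · exact (h p).1
      · exact (h p).2
      · change (soW n * v) (Sum.inl a) () = _
        rw [soW_mul_apply_inl]
        change ((z (Sum.inr a)).re : ℂ) + Complex.I * ((z (Sum.inr a)).im : ℂ) = _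
        rw [mul_comm]
        exact Complex.re_add_im _
  offDiag X hX h := by
    rw [← fromBlocks_toBlocks X] at hX h ⊢
    obtain ⟨hY, hv, hw, -⟩ := fromBlocks_mem_lie_groupSO_iff.mp hX
    rw [fromBlocks_conj_fromBlocks] at h ⊢
    have h1 := offDiag_groupSO hY (fun p => h (Sum.inl (Sum.inl p)))
      fun p => h (Sum.inl (Sum.inr p))
    have hv0 : X.toBlocks₁₂ = 0 := by
      have h2 : ∀ a, X.toBlocks₁₂ (Sum.inl a) () = 0 ∧ X.toBlocks₁₂ (Sum.inr a) () = 0 := by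
        intro a
        have h3 : (soW n * X.toBlocks₁₂) (Sum.inl a) () = 0 := h (Sum.inr a)
        rw [soW_mul_apply_inl] at h3
        have e1 := Complex.conj_eq_iff_im.mp (hv (Sum.inl a) ())
        have e2 := Complex.conj_eq_iff_im.mp (hv (Sum.inr a) ())
        have h4 := congrArg Complex.re h3
        have h5 := congrArg Complex.im h3
        simp [e1, e2] at h4 h5
        exact ⟨Complex.ext h4 e1, Complex.ext h5 e2⟩
      ext (a | a) u
      · exact (h2 a).1
      · exact (h2 a).2
    rw [hw, hv0]
    rintro (i | i) (j | j) hij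
    · exact h1 i j fun e => hij (by rw [e])
    · simp
    · simp
    · exact absurd rfl hij
  exists_regular := by
    refine ⟨fromBlocks (soRegular n) 0 0 0,
      fromBlocks_mem_lie_groupSO_iff.mpr ⟨soRegular_mem, by simp, by simp, rfl⟩, ?_, ?_⟩ <;>
      rw [fromBlocks_conj_fromBlocks, soW_mul_soRegular_mul_soV, Matrix.mul_zero, Matrix.zero_mul]
    · rintro (i | i) (j | j) hij
      · exact diagonal_apply_ne _ fun e => hij (by rw [e])
      · rfl
      · rfl
      · exact absurd rfl hij
    · rintro ((p | p) | a)
      · change diagonal _ _ _ ≠ diagonal _ _ _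
        rw [diagonal_apply_eq, diagonal_apply_eq]
        exact I_mul_succ_ne p.2.ne
      · change diagonal _ _ _ ≠ diagonal _ _ _
        rw [diagonal_apply_eq, diagonal_apply_eq]
        exact I_mul_succ_ne_neg _ _
      · change diagonal _ _ _ ≠ 0
        rw [diagonal_apply_eq]
        exact mul_ne_zero Complex.I_ne_zero (Nat.cast_add_one_ne_zero _)
  char_ne := by
    rintro ((p | p) | a)
    · exact exists_signedEps_inl_ne _ _ fun e => p.2.ne (Sum.inl.inj e)
    · exact exists_signedEps_inl_ne _ _ Sum.inl_ne_inr
    · obtain ⟨z, hz⟩ := exists_circle_ne_inv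
      refine ⟨Pi.mulSingle a z, ?_⟩
      have hz1 : z ≠ 1 := by
        rintro rfl
        simp at hz
      simpa [signedEps, torusEps_apply] using hz1

theorem frameSp_weights (a b : Fin n) (h : a < b) :
    (∃ k, (frameSp n).weight k = torusEps a / torusEps b) ∧
      ∃ l, (frameSp n).weight l = torusEps a * torusEps b :=
  ⟨⟨Sum.inl (Sum.inl ⟨(a, b), h⟩), rfl⟩,
    ⟨Sum.inl (Sum.inr ⟨(a, b), h⟩), div_inv_eq_mul (torusEps a) (torusEps b)⟩⟩

theorem frameSOEven_weights (a b : Fin n) (h : a < b) :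
    (∃ k, (frameSOEven n).weight k = torusEps a / torusEps b) ∧
      ∃ l, (frameSOEven n).weight l = torusEps a * torusEps b :=
  ⟨⟨Sum.inl ⟨(a, b), h⟩, rfl⟩, ⟨Sum.inr ⟨(a, b), h⟩, div_inv_eq_mul (torusEps a) (torusEps b)⟩⟩

theorem frameSOOdd_weights (a b : Fin n) (h : a < b) :
    (∃ k, (frameSOOdd n).weight k = torusEps a / torusEps b) ∧
      ∃ l, (frameSOOdd n).weight l = torusEps a * torusEps b :=
  ⟨⟨Sum.inl (Sum.inl ⟨(a, b), h⟩), rfl⟩,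
    ⟨Sum.inl (Sum.inr ⟨(a, b), h⟩), div_inv_eq_mul (torusEps a) (torusEps b)⟩⟩

end Frames

/-! ### Coadjoint orbits of the special unitary group -/

section SpecialUnitary

open CompactMatrixGroup Matrix

variable {n : ℕ} {G : Type} [CommGroup G] [TopologicalSpace G]

theorem CompactMatrixGroup.coadjointOrbit_eq_of_mem {ι : Type} [Fintype ι] [DecidableEq ι]
    (K : CompactMatrixGroup ι) {ξ η : K.Dual} (h : η ∈ K.coadjointOrbit ξ) :
    K.coadjointOrbit η = K.coadjointOrbit ξ := by
  obtain ⟨B, -, rfl⟩ := K.exists_mem_lie_traceDual_eq ξ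
  obtain ⟨k, hk, rfl⟩ := K.mem_coadjointOrbit_traceDual.mp h
  have hkk : star (k : Matrix ι ι ℂ) * (k : Matrix ι ι ℂ) = 1 :=
    (Matrix.mem_unitaryGroup_iff').mp k.2
  ext ζ
  rw [mem_coadjointOrbit_traceDual, mem_coadjointOrbit_traceDual]
  constructor
  · rintro ⟨l, hl, rfl⟩
    refine ⟨l * k, K.grp.mul_mem hl hk, ?_⟩
    change _ = K.traceDual ((l : Matrix ι ι ℂ) * k * B * star ((l : Matrix ι ι ℂ) * k))
    rw [star_mul]
    simp only [mul_assoc]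
  · rintro ⟨l, hl, rfl⟩
    refine ⟨l * k⁻¹, K.grp.mul_mem hl (K.grp.inv_mem hk), ?_⟩
    change _ = K.traceDual ((l : Matrix ι ι ℂ) * star (k : Matrix ι ι ℂ) *
      ((k : Matrix ι ι ℂ) * B * star (k : Matrix ι ι ℂ)) *
        star ((l : Matrix ι ι ℂ) * star (k : Matrix ι ι ℂ)))
    congr 1
    rw [star_mul, star_star]
    calc (l : Matrix ι ι ℂ) * B * star (l : Matrix ι ι ℂ)
        = (l : Matrix ι ι ℂ) * (star (k : Matrix ι ι ℂ) * (k : Matrix ι ι ℂ)) * B *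
          (star (k : Matrix ι ι ℂ) * (k : Matrix ι ι ℂ)) * star (l : Matrix ι ι ℂ) := by
          rw [hkk, mul_one, mul_one]
      _ = _ := by simp only [mul_assoc]

theorem mem_lie_groupSU_iff {X : Matrix (Fin n) (Fin n) ℂ} :
    X ∈ (groupSU (Fin n)).lie ↔ Xᴴ = -X ∧ X.trace = 0 :=
  Iff.rfl

/-- What the results on `SU(n)` use of a torus `G` that maps to `T^n`: up to scalar matrices, which
act trivially, `G` is all of `T^n`; and the restrictions of the roots `ε_i - ε_j`, `i < j`, to the
elements of order two in `G` are distinct and non-trivial. -/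
structure IsRootSeparating (φ : G →ₜ* (Fin n → Circle)) : Prop where
  exists_eq_mul : ∀ t : Fin n → Circle, ∃ (g : G) (c : Circle), ∀ i, t i = c * φ g i
  exists_ne : ∀ i j, i ≠ j → ∃ g, g ^ 2 = 1 ∧ φ g i / φ g j ≠ 1
  exists_div_ne : ∀ p q : IndexPair n, p ≠ q →
    ∃ g, g ^ 2 = 1 ∧ φ g p.1.1 / φ g p.1.2 ≠ φ g q.1.1 / φ g q.1.2

/-- The action on the coadjoint orbits of `SU(n)` of a torus `G` that maps to `T^n`. -/
noncomputable def torusAction (φ : G →ₜ* (Fin n → Circle)) : G →* (groupSU (Fin n)).Normalizer :=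
  (torusU n).comp φ.toMonoidHom

/-- The frame of `SU(n)`: the entries above the diagonal, with weights `ε_i - ε_j`. -/
noncomputable def frameSU {φ : G →ₜ* (Fin n → Circle)} (hφ : IsRootSeparating φ) :
    TorusFrame (groupSU (Fin n)) (torusAction φ) (IndexPair n) where
  W := 1
  V := 1
  W_mul_V := mul_one 1
  char i := (PontryaginDual.map φ) (torusEps i)
  diag g := by
    rw [one_mul, mul_one]
    rfl
  row p := p.1.1
  col p := p.1.2
  exists_coord z := by
    obtain ⟨P, hP1, hP2, hP3⟩ := exists_matrix_of_involution (fun w => -(starRingEnd ℂ) w)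
      (fun w => by simp) z (fun _ => 0) (fun _ => by simp)
    refine ⟨P, mem_lie_groupSU_iff.mpr ⟨?_, ?_⟩, fun p => ?_⟩
    · ext a b
      rw [conjTranspose_apply, Matrix.neg_apply, hP2 a b]
      simp
    · rw [Matrix.trace]
      exact Finset.sum_eq_zero fun i _ => hP3 i
    · rw [one_mul, mul_one]
      exact hP1 p
  offDiag X hX h := by
    rw [one_mul, mul_one] at h ⊢
    exact forall_ne_eq_zero_of_forall_lt (s := fun w => -(starRingEnd ℂ) w) (by simp)
      (fun a b => (groupSU (Fin n)).apply_eq_neg_conj_of_mem_lie hX b a) h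
  exists_regular := by
    refine ⟨diagonal fun a => Complex.I * (((a : ℝ) - (∑ b : Fin n, (b : ℝ)) / n : ℝ) : ℂ),
      mem_lie_groupSU_iff.mpr ⟨?_, ?_⟩, ?_, ?_⟩
    · rw [diagonal_conjTranspose, diagonal_neg]
      congr 1
      funext a
      simp
    · rw [trace_diagonal, ← Finset.mul_sum, ← Complex.ofReal_sum, Finset.sum_sub_distrib]
      rcases Nat.eq_zero_or_pos n with rfl | hn
      · simp
      · have hn' : (n : ℝ) ≠ 0 := by positivity
        rw [Finset.sum_const, Finset.card_univ, Fintype.card_fin, nsmul_eq_mul,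
          mul_div_cancel₀ _ hn', sub_self, Complex.ofReal_zero, mul_zero]
    · rw [one_mul, mul_one]
      exact fun i j hij => diagonal_apply_ne _ hij
    · rw [one_mul, mul_one]
      intro p h
      rw [diagonal_apply_eq, diagonal_apply_eq] at h
      have h1 := Complex.ofReal_injective (mul_left_cancel₀ Complex.I_ne_zero h)
      have h2 := Nat.cast_injective (sub_left_inj.mp h1)
      exact p.2.ne (Fin.ext h2)
  char_ne p := by
    obtain ⟨g, -, hg⟩ := hφ.exists_ne _ _ p.2.ne
    exact ⟨g, fun h => hg (div_eq_one.mpr h)⟩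

variable {φ : G →ₜ* (Fin n → Circle)}

theorem frameSU_mat (hφ : IsRootSeparating φ) (X : Matrix (Fin n) (Fin n) ℂ) :
    (frameSU hφ).mat X = X := by
  change 1 * X * 1 = X
  rw [one_mul, mul_one]

theorem frameSU_weight_apply (hφ : IsRootSeparating φ) (p : IndexPair n) (g : G) :
    (frameSU hφ).weight p g = φ g p.1.1 / φ g p.1.2 := by
  rw [TorusFrame.weight, pontryaginDual_div_apply]
  rfl

theorem frameSU_isDiag_iff (hφ : IsRootSeparating φ) (A : Matrix (Fin n) (Fin n) ℂ) :
    (frameSU hφ).IsDiag A ↔ ∀ i j, i ≠ j → A i j = 0 := by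
  rw [TorusFrame.IsDiag, frameSU_mat]

theorem coAd_torusAction (φ : G →ₜ* (Fin n → Circle)) (g : G) (A : Matrix (Fin n) (Fin n) ℂ) :
    (groupSU (Fin n)).coAd (torusAction φ g) ((groupSU (Fin n)).traceDual A)
      = (groupSU (Fin n)).traceDual (of fun i j => ((φ g i / φ g j : Circle) : ℂ) * A i j) := by
  rw [coAd_traceDual]
  congr 1
  change diagonal (fun i => (φ g i : ℂ)) * A * star (diagonal fun i => (φ g i : ℂ)) = _
  rw [star_eq_conjTranspose, diagonal_conjTranspose]
  ext i j
  rw [mul_diagonal, diagonal_mul, of_apply, Circle.coe_div, Pi.star_apply, div_eq_mul_inv,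
    ← Circle.coe_inv, Circle.coe_inv_eq_conj]
  change _ * (starRingEnd ℂ) _ = _
  ring

theorem torusAction_mem_lie (φ : G →ₜ* (Fin n → Circle)) (g : G) {A : Matrix (Fin n) (Fin n) ℂ}
    (hA : A ∈ (groupSU (Fin n)).lie) :
    (of fun i j => ((φ g i / φ g j : Circle) : ℂ) * A i j) ∈ (groupSU (Fin n)).lie := by
  refine mem_lie_groupSU_iff.mpr ⟨?_, ?_⟩
  · ext i j
    rw [conjTranspose_apply, of_apply, Matrix.neg_apply, of_apply,
      apply_eq_neg_conj_of_mem_lie _ hA i j, ← inv_div (φ g j), Circle.coe_inv_eq_conj]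
    simp
  · rw [Matrix.trace]
    simpa [Matrix.trace] using (mem_lie_groupSU_iff.mp hA).2

theorem coAd_torusAction_eq_iff (φ : G →ₜ* (Fin n → Circle)) (g h : G)
    {A : Matrix (Fin n) (Fin n) ℂ} (hA : A ∈ (groupSU (Fin n)).lie) :
    (groupSU (Fin n)).coAd (torusAction φ g) ((groupSU (Fin n)).traceDual A)
        = (groupSU (Fin n)).coAd (torusAction φ h) ((groupSU (Fin n)).traceDual A) ↔
      ∀ i j, A i j ≠ 0 → φ g i / φ g j = φ h i / φ h j := by
  rw [coAd_torusAction, coAd_torusAction]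
  constructor
  · intro he i j h0
    have h1 := congrFun (congrFun ((groupSU (Fin n)).traceDual_injOn (torusAction_mem_lie φ g hA)
      (torusAction_mem_lie φ h hA) he) i) j
    exact Circle.ext (mul_right_cancel₀ h0 h1)
  · intro he
    congr 1
    ext i j
    rw [of_apply, of_apply]
    by_cases h0 : A i j = 0
    · rw [h0, mul_zero, mul_zero]
    · rw [he i j h0]

theorem apply_sq_eq_one {g : G} (hg : g ^ 2 = 1) (χ : PontryaginDual G) : (χ g) ^ 2 = 1 := by
  rw [← map_pow, hg, map_one]

theorem apply_eq_of_mod2_eq {χ ψ : PontryaginDual G} (h : mod2 χ = mod2 ψ) {g : G}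
    (hg : g ^ 2 = 1) : χ g = ψ g := by
  obtain ⟨θ, hθ⟩ := mod2_eq_iff.mp h
  have h1 : (θ ^ 2) g = (χ g)⁻¹ * ψ g := by rw [hθ]; rfl
  have h2 : (θ ^ 2) g = 1 := by
    rw [sq, pontryaginDual_mul_apply, ← sq, apply_sq_eq_one hg]
  rw [h2] at h1
  exact eq_of_inv_mul_eq_one h1.symm

/-- The isotropy weights at the fixed points of an orbit of `SU(n)` are distinct and non-zero
mod 2, because they differ already on the elements of order two. -/
theorem exists_isotropyWeights_mod2 (hφ : IsRootSeparating φ) {A : Matrix (Fin n) (Fin n) ℂ}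
    (hA : A ∈ (groupSU (Fin n)).lie) (hd : (frameSU hφ).IsDiag A) :
    ∃ (d : ℕ) (α : Fin d → PontryaginDual G),
      IsIsotropyWeights (torusAction φ) ((groupSU (Fin n)).traceDual A) α ∧
        Function.Injective (fun i => mod2 (α i)) ∧ ∀ i, mod2 (α i) ≠ 1 := by
  classical
  refine ⟨_, _, (frameSU hφ).isIsotropyWeights hA hd (Fintype.equivFin _).symm, ?_, ?_⟩
  · intro k l hkl
    by_contra hne
    have h1 : ((Fintype.equivFin _).symm k).1 ≠ ((Fintype.equivFin _).symm l).1 := fun h =>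
      hne ((Fintype.equivFin _).symm.injective (Subtype.ext h))
    obtain ⟨g, hg, hg'⟩ := hφ.exists_div_ne _ _ h1
    have h2 := apply_eq_of_mod2_eq hkl hg
    rw [frameSU_weight_apply, frameSU_weight_apply] at h2
    exact hg' h2
  · intro k hk
    obtain ⟨g, hg, hg'⟩ := hφ.exists_ne _ _ ((Fintype.equivFin _).symm k).1.2.ne
    have h2 := apply_eq_of_mod2_eq (ψ := 1) hk hg
    rw [frameSU_weight_apply] at h2
    exact hg' h2

end SpecialUnitary

/-! ### Transposition as an anti-symplectic involution -/

section RealLocus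

open CompactMatrixGroup Matrix

variable {n : ℕ} {G : Type} [CommGroup G] [TopologicalSpace G] {φ : G →ₜ* (Fin n → Circle)}

theorem transpose_mem_lie_groupSU {X : Matrix (Fin n) (Fin n) ℂ}
    (hX : X ∈ (groupSU (Fin n)).lie) : Xᵀ ∈ (groupSU (Fin n)).lie := by
  obtain ⟨h1, h2⟩ := mem_lie_groupSU_iff.mp hX
  refine mem_lie_groupSU_iff.mpr ⟨?_, by rw [trace_transpose, h2]⟩
  change Xᴴᵀ = -Xᵀ
  rw [h1, transpose_neg]

/-- Transposition, as a linear map of the Lie algebra of `SU(n)`.  It reverses brackets. -/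
noncomputable def transposeSU (n : ℕ) : (groupSU (Fin n)).lie →ₗ[ℝ] (groupSU (Fin n)).lie where
  toFun X := ⟨X.1ᵀ, transpose_mem_lie_groupSU X.2⟩
  map_add' _ _ := rfl
  map_smul' _ _ := rfl

theorem transposeSU_lie (X Y : (groupSU (Fin n)).lie) :
    transposeSU n ⁅X, Y⁆ = ⁅transposeSU n Y, transposeSU n X⁆ := by
  apply Subtype.ext
  change (X.1 * Y.1 - Y.1 * X.1)ᵀ = Y.1ᵀ * X.1ᵀ - X.1ᵀ * Y.1ᵀ
  rw [transpose_sub, transpose_mul, transpose_mul]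

theorem transposeSU_transposeSU (X : (groupSU (Fin n)).lie) :
    transposeSU n (transposeSU n X) = X := rfl

theorem dualMap_transposeSU_traceDual (A : Matrix (Fin n) (Fin n) ℂ) :
    (transposeSU n).dualMap ((groupSU (Fin n)).traceDual A) = (groupSU (Fin n)).traceDual Aᵀ := by
  refine LinearMap.ext fun X => ?_
  change -((A * X.1ᵀ).trace).re = -((Aᵀ * X.1).trace).re
  rw [← trace_transpose, transpose_mul, transpose_transpose, trace_mul_comm]

/-- The orbit through a diagonal matrix is stable under transposition: the transpose of `k D k⁻¹` is
`k̄ D k̄⁻¹`. -/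
theorem transpose_mem_coadjointOrbit {D A : Matrix (Fin n) (Fin n) ℂ} (hD : Dᵀ = D)
    (hDl : D ∈ (groupSU (Fin n)).lie) (hAl : A ∈ (groupSU (Fin n)).lie)
    (hA : (groupSU (Fin n)).traceDual A
      ∈ (groupSU (Fin n)).coadjointOrbit ((groupSU (Fin n)).traceDual D)) :
    (groupSU (Fin n)).traceDual Aᵀ
      ∈ (groupSU (Fin n)).coadjointOrbit ((groupSU (Fin n)).traceDual D) := by
  obtain ⟨k, hk, hkA⟩ := (mem_coadjointOrbit_traceDual _).mp hA
  have h1 := (groupSU (Fin n)).traceDual_injOn hAl (conj_mem_lie_of_mem_grp _ hk hDl) hkA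
  have hkk : star (k : Matrix (Fin n) (Fin n) ℂ) * (k : Matrix (Fin n) (Fin n) ℂ) = 1 :=
    (Matrix.mem_unitaryGroup_iff').mp k.2
  have hs : star ((k : Matrix (Fin n) (Fin n) ℂ)ᴴᵀ) = (k : Matrix (Fin n) (Fin n) ℂ)ᵀ := by
    ext i j
    simp [star_apply]
  have hu : (k : Matrix (Fin n) (Fin n) ℂ)ᴴᵀ ∈ Matrix.unitaryGroup (Fin n) ℂ := by
    rw [Matrix.mem_unitaryGroup_iff', hs, ← transpose_mul, ← star_eq_conjTranspose, hkk,
      transpose_one]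
  refine (mem_coadjointOrbit_traceDual _).mpr ⟨⟨_, hu⟩, ?_, ?_⟩
  · change ((k : Matrix (Fin n) (Fin n) ℂ)ᴴᵀ).det = 1
    have hk' : (k : Matrix (Fin n) (Fin n) ℂ).det = 1 := hk
    rw [det_transpose, det_conjTranspose, hk', star_one]
  · congr 1
    change _ = (k : Matrix (Fin n) (Fin n) ℂ)ᴴᵀ * D * star ((k : Matrix (Fin n) (Fin n) ℂ)ᴴᵀ)
    rw [hs, h1, transpose_mul, transpose_mul, hD, star_eq_conjTranspose, mul_assoc]

theorem isAntisymplecticInvolution_transpose (φ : G →ₜ* (Fin n → Circle))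
    {D : Matrix (Fin n) (Fin n) ℂ} (hD : Dᵀ = D) (hDl : D ∈ (groupSU (Fin n)).lie) :
    IsAntisymplecticInvolution (torusAction φ)
      ((groupSU (Fin n)).coadjointOrbit ((groupSU (Fin n)).traceDual D))
      (transposeSU n).dualMap where
  mapsTo p hp := by
    obtain ⟨A, hA, rfl⟩ := (groupSU (Fin n)).exists_mem_lie_traceDual_eq p
    rw [dualMap_transposeSU_traceDual]
    exact transpose_mem_coadjointOrbit hD hDl hA hp
  involutive p _ := rfl
  anti_equivariant g p _ := by
    obtain ⟨A, hA, rfl⟩ := (groupSU (Fin n)).exists_mem_lie_traceDual_eq p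
    rw [coAd_torusAction, dualMap_transposeSU_traceDual, dualMap_transposeSU_traceDual,
      coAd_torusAction]
    congr 1
    ext i j
    simp only [transpose_apply, of_apply, map_inv, Pi.inv_apply, inv_div_inv]
  antisymplectic p _ X Y X' Y' hX hY := by
    -- Both hypotheses say that `X'` and `-Xᵀ` have the same infinitesimal action at `σ p`.
    have key : ∀ {Z Z' : (groupSU (Fin n)).lie},
        (transposeSU n).dualMap ((groupSU (Fin n)).infCoAd p Z)
          = (groupSU (Fin n)).infCoAd ((transposeSU n).dualMap p) Z' →
        ∀ U, p ⁅transposeSU n Z', U⁆ = -p ⁅Z, U⁆ := by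
      intro Z Z' h U
      have h1 := congrArg (fun f : (groupSU (Fin n)).Dual => f (transposeSU n U)) h
      change -p ⁅Z, transposeSU n (transposeSU n U)⁆
        = -p (transposeSU n ⁅Z', transposeSU n U⁆) at h1
      have h2 : p ⁅U, transposeSU n Z'⁆ = -p ⁅transposeSU n Z', U⁆ := by
        rw [← lie_skew, map_neg]
      rw [transposeSU_lie, transposeSU_transposeSU, h2, neg_neg] at h1
      exact h1.symm
    have h3 : p ⁅Y, transposeSU n X'⁆ = -p ⁅transposeSU n X', Y⁆ := by
      rw [← lie_skew, map_neg]
    change p (transposeSU n ⁅X', Y'⁆) = _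
    rw [transposeSU_lie, key hY, h3, neg_neg, key hX]

end RealLocus

/-! ### Dimension of subsets of a real vector space -/

section LinDim

variable {V : Type} [AddCommGroup V] [Module ℝ V] [Module.Finite ℝ V]

theorem linDim_mono {S T : Set V} (h : S ⊆ T) : linDim S ≤ linDim T :=
  dimH_mono (Set.image_mono h)

theorem linDim_finite {S : Set V} (h : S.Finite) : linDim S = 0 :=
  Set.Finite.dimH_zero (h.image _)

theorem linDim_union (S T : Set V) : linDim (S ∪ T) = max (linDim S) (linDim T) := by
  rw [linDim, Set.image_union, dimH_union]
  rfl

theorem linDim_biUnion_le {β : Type} {s : Set β} (hs : s.Countable) {S : β → Set V} {d : ENNReal}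
    (h : ∀ b ∈ s, linDim (S b) ≤ d) : linDim (⋃ b ∈ s, S b) ≤ d := by
  rw [linDim, Set.image_iUnion₂, dimH_bUnion hs]
  exact iSup₂_le h

theorem dimH_image_le_linDim {E : Type} [NormedAddCommGroup E] [NormedSpace ℝ E]
    (f : V →ₗ[ℝ] E) (S : Set V) : dimH (f '' S) ≤ linDim S := by
  let g : (Fin (Module.finrank ℝ V) → ℝ) →L[ℝ] E :=
    (f ∘ₗ (Module.finBasis ℝ V).equivFun.symm.toLinearMap).toContinuousLinearMap
  have h : f '' S = g '' ((Module.finBasis ℝ V).equivFun '' S) := by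
    rw [Set.image_image]
    refine Set.image_congr fun v _ => ?_
    change f v = f ((Module.finBasis ℝ V).equivFun.symm ((Module.finBasis ℝ V).equivFun v))
    rw [LinearEquiv.symm_apply_apply]
  rw [h]
  exact g.lipschitz.dimH_image_le _

theorem linDim_image_range_le {E F : Type} [NormedAddCommGroup E] [NormedSpace ℝ E]
    [FiniteDimensional ℝ E] [NormedAddCommGroup F] [NormedSpace ℝ F] [FiniteDimensional ℝ F]
    (L : F →ₗ[ℝ] V) {c : E → F} (hc : ContDiff ℝ 1 c) :
    linDim (L '' Set.range c) ≤ Module.finrank ℝ E := by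
  let g : F →L[ℝ] (Fin (Module.finrank ℝ V) → ℝ) :=
    ((Module.finBasis ℝ V).equivFun.toLinearMap ∘ₗ L).toContinuousLinearMap
  have h : (Module.finBasis ℝ V).equivFun '' (L '' Set.range c) = Set.range (g ∘ c) := by
    rw [Set.image_image, Set.range_comp]
    rfl
  rw [linDim, h]
  exact (g.contDiff.comp hc).dimH_range_le

end LinDim

/-! ### Torus orbits of dimension at most one -/

section OneSkeleton

open CompactMatrixGroup Matrix

variable {n : ℕ} {G : Type} [CommGroup G] [TopologicalSpace G] {φ : G →ₜ* (Fin n → Circle)}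

theorem coAd_torusAction_eq_self_iff (φ : G →ₜ* (Fin n → Circle)) (g : G)
    {A : Matrix (Fin n) (Fin n) ℂ} (hA : A ∈ (groupSU (Fin n)).lie) :
    (groupSU (Fin n)).coAd (torusAction φ g) ((groupSU (Fin n)).traceDual A)
        = (groupSU (Fin n)).traceDual A ↔ ∀ i j, A i j ≠ 0 → φ g i / φ g j = 1 := by
  have h1 : (groupSU (Fin n)).coAd (torusAction φ 1) ((groupSU (Fin n)).traceDual A)
      = (groupSU (Fin n)).traceDual A := by
    rw [coAd_torusAction]
    congr 1
    ext i j
    simp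
  have h2 := coAd_torusAction_eq_iff φ g 1 hA
  rw [h1] at h2
  simpa using h2

/-- At most one entry of `A` above the diagonal is non-zero. -/
def AtMostOneEdge (A : Matrix (Fin n) (Fin n) ℂ) : Prop :=
  ∀ p q : IndexPair n, A p.1.1 p.1.2 ≠ 0 → A q.1.1 q.1.2 ≠ 0 → p = q

theorem exists_re_mul_exp_eq {c : ℂ} (hc : c ≠ 0) {u : ℝ} (hu : |u| ≤ ‖c‖) :
    ∃ θ : ℝ, (Complex.exp (θ * Complex.I) * c).re = u := by
  have hpos : 0 < ‖c‖ := norm_pos_iff.mpr hc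
  refine ⟨Real.arccos (u / ‖c‖) - Complex.arg c, ?_⟩
  have h1 : Complex.exp ((Real.arccos (u / ‖c‖) - Complex.arg c : ℝ) * Complex.I) * c
      = ‖c‖ * Complex.exp ((Real.arccos (u / ‖c‖) : ℝ) * Complex.I) := by
    calc _ = Complex.exp ((Real.arccos (u / ‖c‖) - Complex.arg c : ℝ) * Complex.I) *
          (‖c‖ * Complex.exp (Complex.arg c * Complex.I)) := by
          rw [Complex.norm_mul_exp_arg_mul_I]
      _ = _ := by
          rw [mul_left_comm, ← Complex.exp_add]
          congr 2
          push_cast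
          ring
  have h2 := abs_le.mp hu
  rw [h1, Complex.re_ofReal_mul, Complex.exp_ofReal_mul_I_re, Real.cos_arccos]
  · exact mul_div_cancel₀ _ hpos.ne'
  · rw [le_div_iff₀ hpos]; linarith
  · rw [div_le_one hpos]; exact h2.2

/-- Two distinct roots `ε_i - ε_j`, `ε_k - ε_l` take arbitrary values independently. -/
theorem exists_sub_eq_and_sub_eq {p q : IndexPair n} (hpq : p ≠ q) (a b : ℝ) :
    ∃ x : Fin n → ℝ, x p.1.1 - x p.1.2 = a ∧ x q.1.1 - x q.1.2 = b := by
  obtain ⟨⟨i, j⟩, hij⟩ := p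
  obtain ⟨⟨k, l⟩, hkl⟩ := q
  simp only at hij hkl ⊢
  let y : Fin n → ℝ := Pi.single k b
  have hy : y k - y l = b := by simp [y, hkl.ne']
  by_cases hi : i = k ∨ i = l
  · by_cases hj : j = k ∨ j = l
    · exfalso
      apply hpq
      rcases hi with rfl | rfl <;> rcases hj with rfl | rfl
      · exact absurd hij (lt_irrefl _)
      · rfl
      · exact absurd hij hkl.not_gt
      · exact absurd hij (lt_irrefl _)
    · push Not at hj
      refine ⟨Function.update y j (y i - a), ?_, ?_⟩
      · rw [Function.update_self, Function.update_of_ne hij.ne]; ring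
      · rw [Function.update_of_ne hj.1.symm, Function.update_of_ne hj.2.symm, hy]
  · push Not at hi
    refine ⟨Function.update y i (y j + a), ?_, ?_⟩
    · rw [Function.update_self, Function.update_of_ne hij.ne']; ring
    · rw [Function.update_of_ne hi.1.symm, Function.update_of_ne hi.2.symm, hy]

/-- The elementary skew-symmetric matrix that reads off the real part of the entry `(i, j)`. -/
noncomputable def entryReader (p : IndexPair n) : (groupSU (Fin n)).lie :=
  ⟨single p.1.1 p.1.2 1 - single p.1.2 p.1.1 1, mem_lie_groupSU_iff.mpr ⟨by
    rw [conjTranspose_sub, conjTranspose_single, conjTranspose_single, star_one, neg_sub], by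
    rw [trace_sub, trace_single_eq_of_ne _ _ _ p.2.ne, trace_single_eq_of_ne _ _ _ p.2.ne',
      sub_zero]⟩⟩

theorem traceDual_entryReader {A : Matrix (Fin n) (Fin n) ℂ} (hA : A ∈ (groupSU (Fin n)).lie)
    (p : IndexPair n) :
    (groupSU (Fin n)).traceDual A (entryReader p) = 2 * (A p.1.1 p.1.2).re := by
  rw [traceDual_apply]
  change -((A * (single p.1.1 p.1.2 1 - single p.1.2 p.1.1 1)).trace).re = _
  rw [mul_sub, trace_sub, trace_mul_single, trace_mul_single,
    apply_eq_neg_conj_of_mem_lie _ hA p.1.2 p.1.1]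
  simp
  ring

/-- If two entries above the diagonal are non-zero, the torus orbit projects onto a set with
interior points in the plane. -/
theorem two_le_linDim_torusOrbit (hφ : IsRootSeparating φ) {A : Matrix (Fin n) (Fin n) ℂ}
    (hA : A ∈ (groupSU (Fin n)).lie) {p q : IndexPair n} (hpq : p ≠ q)
    (hp : A p.1.1 p.1.2 ≠ 0) (hq : A q.1.1 q.1.2 ≠ 0) :
    2 ≤ linDim (torusOrbit (torusAction φ) ((groupSU (Fin n)).traceDual A)) := by
  let f : (groupSU (Fin n)).Dual →ₗ[ℝ] ℝ × ℝ :=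
    (Module.Dual.eval ℝ _ (entryReader p)).prod (Module.Dual.eval ℝ _ (entryReader q))
  refine le_trans ?_ (dimH_image_le_linDim f _)
  have hopen : IsOpen (Metric.ball (0 : ℝ) (2 * ‖A p.1.1 p.1.2‖) ×ˢ
      Metric.ball (0 : ℝ) (2 * ‖A q.1.1 q.1.2‖)) := Metric.isOpen_ball.prod Metric.isOpen_ball
  have hsub : Metric.ball (0 : ℝ) (2 * ‖A p.1.1 p.1.2‖) ×ˢ
      Metric.ball (0 : ℝ) (2 * ‖A q.1.1 q.1.2‖)
        ⊆ f '' torusOrbit (torusAction φ) ((groupSU (Fin n)).traceDual A) := by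
    rintro ⟨u, v⟩ ⟨hu, hv⟩
    rw [mem_ball_zero_iff, Real.norm_eq_abs] at hu hv
    obtain ⟨a, ha⟩ := exists_re_mul_exp_eq hp (u := u / 2) (by
      rw [abs_div, abs_two]; linarith)
    obtain ⟨b, hb⟩ := exists_re_mul_exp_eq hq (u := v / 2) (by
      rw [abs_div, abs_two]; linarith)
    obtain ⟨x, hxa, hxb⟩ := exists_sub_eq_and_sub_eq hpq a b
    obtain ⟨g, c, hg⟩ := hφ.exists_eq_mul fun i => Circle.exp (x i)
    have hdiv : ∀ i j, φ g i / φ g j = Circle.exp (x i - x j) := fun i j => by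
      rw [Circle.exp_sub, hg, hg, mul_div_mul_left_eq_div]
    refine ⟨_, ⟨g, rfl⟩, ?_⟩
    have h1 : ∀ r : IndexPair n, (groupSU (Fin n)).coAd (torusAction φ g)
        ((groupSU (Fin n)).traceDual A) (entryReader r)
          = 2 * (Complex.exp ((x r.1.1 - x r.1.2 : ℝ) * Complex.I) * A r.1.1 r.1.2).re := by
      intro r
      rw [coAd_torusAction, traceDual_entryReader (torusAction_mem_lie φ g hA), of_apply, hdiv,
        Circle.coe_exp]
    refine Prod.ext ?_ ?_
    · change (groupSU (Fin n)).coAd (torusAction φ g) ((groupSU (Fin n)).traceDual A)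
        (entryReader p) = u
      rw [h1, hxa, ha]; ring
    · change (groupSU (Fin n)).coAd (torusAction φ g) ((groupSU (Fin n)).traceDual A)
        (entryReader q) = v
      rw [h1, hxb, hb]; ring
  have hmem : (0 : ℝ × ℝ) ∈ interior (f '' torusOrbit (torusAction φ)
      ((groupSU (Fin n)).traceDual A)) :=
    interior_maximal hsub hopen ⟨Metric.mem_ball_self (by positivity),
      Metric.mem_ball_self (by positivity)⟩
  rw [Real.dimH_of_nonempty_interior ⟨_, hmem⟩]
  simp

theorem apply_ne_zero_iff_of_mem_lie {A : Matrix (Fin n) (Fin n) ℂ}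
    (hA : A ∈ (groupSU (Fin n)).lie) (i j : Fin n) : A i j ≠ 0 ↔ A j i ≠ 0 := by
  rw [apply_eq_neg_conj_of_mem_lie _ hA i j]
  simp

/-- A skew-Hermitian matrix with at most one non-zero entry above the diagonal either is diagonal or
has a single non-zero pair of off-diagonal entries. -/
theorem AtMostOneEdge.isDiag_or_exists {A : Matrix (Fin n) (Fin n) ℂ} (h : AtMostOneEdge A)
    (hA : A ∈ (groupSU (Fin n)).lie) :
    (∀ i j, i ≠ j → A i j = 0) ∨ ∃ p : IndexPair n, ∀ i j, i ≠ j → A i j ≠ 0 →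
      (i = p.1.1 ∧ j = p.1.2) ∨ (i = p.1.2 ∧ j = p.1.1) := by
  by_cases hd : ∀ p : IndexPair n, A p.1.1 p.1.2 = 0
  · left
    intro i j hij
    by_contra h0
    rcases lt_or_gt_of_ne hij with h1 | h1
    · exact h0 (hd ⟨(i, j), h1⟩)
    · exact (apply_ne_zero_iff_of_mem_lie hA i j).mp h0 (hd ⟨(j, i), h1⟩)
  · right
    push Not at hd
    obtain ⟨p, hp⟩ := hd
    refine ⟨p, fun i j hij h0 => ?_⟩
    rcases lt_or_gt_of_ne hij with h1 | h1
    · have := h p ⟨(i, j), h1⟩ hp h0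
      subst this
      exact Or.inl ⟨rfl, rfl⟩
    · have := h p ⟨(j, i), h1⟩ hp ((apply_ne_zero_iff_of_mem_lie hA i j).mp h0)
      subst this
      exact Or.inr ⟨rfl, rfl⟩

/-- The orbit of the torus through a matrix with at most one edge is a point or a circle. -/
theorem linDim_torusOrbit_le_one (φ : G →ₜ* (Fin n → Circle)) {A : Matrix (Fin n) (Fin n) ℂ}
    (hA : A ∈ (groupSU (Fin n)).lie) (h : AtMostOneEdge A) :
    linDim (torusOrbit (torusAction φ) ((groupSU (Fin n)).traceDual A)) ≤ 1 := by
  rcases h.isDiag_or_exists hA with hd | ⟨p, hp⟩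
  · have hsub : torusOrbit (torusAction φ) ((groupSU (Fin n)).traceDual A)
        ⊆ {(groupSU (Fin n)).traceDual A} := by
      rintro _ ⟨g, rfl⟩
      refine (coAd_torusAction_eq_self_iff φ g hA).mpr fun i j h0 => ?_
      by_cases hij : i = j
      · rw [hij, div_self']
      · exact absurd (hd i j hij) h0
    refine (linDim_mono hsub).trans ?_
    rw [linDim_finite (Set.finite_singleton _)]
    exact zero_le_one
  · let c : ℝ → Fin n → Fin n → ℂ := fun θ i j =>
      if i = p.1.1 ∧ j = p.1.2 then Complex.exp (θ * Complex.I) * A i j else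
        if i = p.1.2 ∧ j = p.1.1 then Complex.exp (-θ * Complex.I) * A i j else A i j
    have hc : ContDiff ℝ 1 c := by
      refine contDiff_pi.mpr fun i => contDiff_pi.mpr fun j => ?_
      simp only [c]
      have hof : ContDiff ℝ 1 fun θ : ℝ => (θ : ℂ) := Complex.ofRealCLM.contDiff
      split_ifs
      · exact ((hof.mul contDiff_const).cexp).mul contDiff_const
      · exact ((hof.neg.mul contDiff_const).cexp).mul contDiff_const
      · exact contDiff_const
    have hsub : torusOrbit (torusAction φ) ((groupSU (Fin n)).traceDual A)
        ⊆ (groupSU (Fin n)).traceDual '' Set.range c := by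
      rintro _ ⟨g, rfl⟩
      refine ⟨_, ⟨Complex.arg (φ g p.1.1 / φ g p.1.2 : Circle), rfl⟩, ?_⟩
      change _ = (groupSU (Fin n)).coAd (torusAction φ g) _
      rw [coAd_torusAction]
      congr 1
      have harg : ∀ z : Circle, Complex.exp (Complex.arg z * Complex.I) = z := fun z => by
        rw [← Circle.coe_exp, Circle.exp_arg]
      ext i j
      simp only [of_apply, c]
      split_ifs with h1 h2
      · rw [harg, h1.1, h1.2]
      · rw [neg_mul, Complex.exp_neg, harg, h2.1, h2.2, ← Circle.coe_inv, inv_div]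
      · by_cases hij : i = j
        · rw [hij, div_self', Circle.coe_one, one_mul]
        · by_cases h0 : A i j = 0
          · rw [h0, mul_zero]
          · rcases hp i j hij h0 with h3 | h3
            · exact absurd h3 h1
            · exact absurd h3 h2
    refine (linDim_mono hsub).trans ?_
    refine (linDim_image_range_le (F := Fin n → Fin n → ℂ) (groupSU (Fin n)).traceDual hc).trans ?_
    simp

theorem traceDual_mem_oneSkeleton_iff (hφ : IsRootSeparating φ) {A : Matrix (Fin n) (Fin n) ℂ}
    (hA : A ∈ (groupSU (Fin n)).lie) (M : Set (groupSU (Fin n)).Dual) :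
    (groupSU (Fin n)).traceDual A ∈ oneSkeleton (torusAction φ) M
      ↔ (groupSU (Fin n)).traceDual A ∈ M ∧ AtMostOneEdge A := by
  refine and_congr_right fun _ => ⟨fun h p q hp hq => ?_, linDim_torusOrbit_le_one φ hA⟩
  by_contra hpq
  exact absurd ((two_le_linDim_torusOrbit hφ hA hpq hp hq).trans h) (by norm_num)

/-- For at most one edge, the elements of order two act by a single sign; two edges are separated by
these elements, which gives at least three points. -/
theorem encard_image_le_two_iff (hφ : IsRootSeparating φ) {A : Matrix (Fin n) (Fin n) ℂ}
    (hA : A ∈ (groupSU (Fin n)).lie) :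
    ((fun g : G => (groupSU (Fin n)).coAd (torusAction φ g) ((groupSU (Fin n)).traceDual A)) ''
      {g | g ^ 2 = 1}).encard ≤ 2 ↔ AtMostOneEdge A := by
  have hsq : ∀ g : G, g ^ 2 = 1 → ∀ i j, φ g i / φ g j = 1 ∨ φ g i / φ g j = -1 := by
    intro g hg i j
    have h1 : (φ g) ^ 2 = 1 := by rw [← map_pow, hg, map_one]
    have h2 : (φ g i / φ g j) ^ 2 = 1 := by
      have e1 : φ g i ^ 2 = 1 := congrFun h1 i
      have e2 : φ g j ^ 2 = 1 := congrFun h1 j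
      rw [div_pow, e1, e2, div_one]
    have h3 : (((φ g i / φ g j : Circle) : ℂ)) ^ 2 = 1 := by
      rw [← Circle.coe_pow, h2, Circle.coe_one]
    rw [sq] at h3
    rcases mul_self_eq_one_iff.mp h3 with h | h
    · exact Or.inl (Circle.ext h)
    · exact Or.inr (Circle.ext (by simpa using h))
  constructor
  · intro h p q hp hq
    by_contra hpq
    -- If `g` moves the entry `p` but not the entry `q`, and `k` moves the entry `q`, then `x`, `g x`
    -- and `k x` are distinct.
    have key : ∀ p q : IndexPair n, A p.1.1 p.1.2 ≠ 0 → A q.1.1 q.1.2 ≠ 0 → ∀ g : G, g ^ 2 = 1 →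
        φ g p.1.1 / φ g p.1.2 ≠ 1 → φ g q.1.1 / φ g q.1.2 = 1 → False := by
      intro p q hp hq g hg hgp hgq
      obtain ⟨k, hk, hkq⟩ := hφ.exists_ne _ _ q.2.ne
      have hne1 := mt (coAd_torusAction_eq_iff φ 1 g hA).mp fun hh =>
        hgp (by simpa using (hh _ _ hp).symm)
      have hne2 := mt (coAd_torusAction_eq_iff φ 1 k hA).mp fun hh =>
        hkq (by simpa using (hh _ _ hq).symm)
      have hne3 := mt (coAd_torusAction_eq_iff φ g k hA).mp fun hh =>
        hkq (by rw [← hh _ _ hq, hgq])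
      have h3 := Set.encard_eq_three.mpr ⟨_, _, _, hne1, hne2, hne3, rfl⟩
      have hsub : ({(groupSU (Fin n)).coAd (torusAction φ 1) ((groupSU (Fin n)).traceDual A),
          (groupSU (Fin n)).coAd (torusAction φ g) ((groupSU (Fin n)).traceDual A),
          (groupSU (Fin n)).coAd (torusAction φ k) ((groupSU (Fin n)).traceDual A)} :
          Set (groupSU (Fin n)).Dual) ⊆ (fun g : G => (groupSU (Fin n)).coAd (torusAction φ g)
            ((groupSU (Fin n)).traceDual A)) '' {g | g ^ 2 = 1} := by
        rintro _ (rfl | rfl | rfl)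
        · exact ⟨1, one_pow 2, rfl⟩
        · exact ⟨g, hg, rfl⟩
        · exact ⟨k, hk, rfl⟩
      have h4 := (Set.encard_le_encard hsub).trans h
      rw [h3] at h4
      exact absurd h4 (by decide)
    obtain ⟨g, hg, hgpq⟩ := hφ.exists_div_ne p q hpq
    by_cases h1 : φ g q.1.1 / φ g q.1.2 = 1
    · exact key p q hp hq g hg (fun h2 => hgpq (h2.trans h1.symm)) h1
    · have h2 := (hsq g hg q.1.1 q.1.2).resolve_left h1
      have h3 : φ g p.1.1 / φ g p.1.2 = 1 :=
        (hsq g hg p.1.1 p.1.2).resolve_right fun h3 => hgpq (h3.trans h2.symm)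
      exact key q p hq hp g hg h1 h3
  · intro h
    rcases h.isDiag_or_exists hA with hd | ⟨p, hp⟩
    · refine (Set.encard_le_one_iff.mpr ?_).trans one_le_two
      rintro _ _ ⟨g, hg, rfl⟩ ⟨k, hk, rfl⟩
      refine (coAd_torusAction_eq_iff φ g k hA).mpr fun i j h0 => ?_
      by_cases hij : i = j
      · rw [hij, div_self', div_self']
      · exact absurd (hd i j hij) h0
    · have hsub : (fun g : G => (groupSU (Fin n)).coAd (torusAction φ g)
          ((groupSU (Fin n)).traceDual A)) '' {g | g ^ 2 = 1} ⊆
          {(groupSU (Fin n)).traceDual A, (groupSU (Fin n)).traceDual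
            (of fun i j => if i = j then A i j else -A i j)} := by
        rintro _ ⟨g, hg, rfl⟩
        simp only [coAd_torusAction]
        rcases hsq g hg p.1.1 p.1.2 with h1 | h1
        · left
          congr 1
          ext i j
          rw [of_apply]
          by_cases hij : i = j
          · rw [hij, div_self', Circle.coe_one, one_mul]
          · by_cases h0 : A i j = 0
            · rw [h0, mul_zero]
            · rcases hp i j hij h0 with ⟨rfl, rfl⟩ | ⟨rfl, rfl⟩
              · rw [h1, Circle.coe_one, one_mul]
              · rw [← inv_div, h1, inv_one, Circle.coe_one, one_mul]
        · right
          change _ = _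
          congr 1
          ext i j
          rw [of_apply, of_apply]
          by_cases hij : i = j
          · rw [if_pos hij, hij, div_self', Circle.coe_one, one_mul]
          · rw [if_neg hij]
            by_cases h0 : A i j = 0
            · rw [h0, mul_zero, neg_zero]
            · rcases hp i j hij h0 with ⟨rfl, rfl⟩ | ⟨rfl, rfl⟩
              · rw [h1]; simp
              · rw [← inv_div, h1]; simp
      refine ((Set.encard_le_encard hsub).trans (Set.encard_insert_le _ _)).trans ?_
      rw [Set.encard_singleton, one_add_one_eq_two]

end OneSkeleton

/-! ### The GKM property for the special unitary group -/

section GKM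

open CompactMatrixGroup Matrix

variable {n : ℕ} {G : Type} [CommGroup G] [TopologicalSpace G] {φ : G →ₜ* (Fin n → Circle)}

theorem exists_eq_conj_of_mem_coadjointOrbit {ι : Type} [Fintype ι] [DecidableEq ι]
    {K : CompactMatrixGroup ι} {A D : Matrix ι ι ℂ} (hA : A ∈ K.lie) (hD : D ∈ K.lie)
    (h : K.traceDual A ∈ K.coadjointOrbit (K.traceDual D)) :
    ∃ k : Matrix.unitaryGroup ι ℂ, A = (k : Matrix ι ι ℂ) * D * star (k : Matrix ι ι ℂ) := by
  obtain ⟨k, hk, hkA⟩ := K.mem_coadjointOrbit_traceDual.mp h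
  exact ⟨k, K.traceDual_injOn hA (K.conj_mem_lie_of_mem_grp hk hD) hkA⟩

/-- The possible eigenvalues of elements of the orbit of `D`, and zero. -/
noncomputable def eigenvalueSet (D : Matrix (Fin n) (Fin n) ℂ) : Set ℂ :=
  insert 0 (D.charpoly.roots.toFinset : Set ℂ)

theorem finite_eigenvalueSet (D : Matrix (Fin n) (Fin n) ℂ) : (eigenvalueSet D).Finite :=
  (Finset.finite_toSet _).insert 0

theorem finite_pi_eigenvalueSet (D : Matrix (Fin n) (Fin n) ℂ) :
    (Set.univ.pi fun _ : Fin n => eigenvalueSet D).Finite :=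
  Set.Finite.pi fun _ => finite_eigenvalueSet D

theorem apply_self_mem_eigenvalueSet {A D : Matrix (Fin n) (Fin n) ℂ}
    (h : A.charpoly = D.charpoly) {m : Fin n} (hm : ∀ i, i ≠ m → A i m = 0) :
    A m m ∈ eigenvalueSet D := by
  refine Or.inr ?_
  rw [Finset.mem_coe, Multiset.mem_toFinset, ← h,
    Polynomial.mem_roots (charpoly_monic A).ne_zero, Polynomial.IsRoot.def, eval_charpoly]
  refine det_eq_zero_of_column_eq_zero m fun i => ?_
  by_cases him : i = m
  · subst him
    simp
  · simp [him, hm i him]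

/-- A matrix with diagonal `f`, except for the `2 × 2` block at `p`, which runs through the sphere
of radius `r` in polar coordinates `(θ, ψ)`; the mean value of the diagonal of the block is `c`. -/
noncomputable def blockSphere (p : IndexPair n) (f : Fin n → ℂ) (c : ℂ) (r : ℝ) (x : ℝ × ℝ) :
    Fin n → Fin n → ℂ := fun i j =>
  if i = p.1.1 ∧ j = p.1.1 then c + Complex.I * (r * Complex.cos x.1)
  else if i = p.1.2 ∧ j = p.1.2 then c - Complex.I * (r * Complex.cos x.1)
  else if i = p.1.1 ∧ j = p.1.2 then r * Complex.sin x.1 * Complex.exp (x.2 * Complex.I)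
  else if i = p.1.2 ∧ j = p.1.1 then -(r * Complex.sin x.1 * Complex.exp (-x.2 * Complex.I))
  else if i = j then f i else 0

theorem contDiff_blockSphere (p : IndexPair n) (f : Fin n → ℂ) (c : ℂ) (r : ℝ) :
    ContDiff ℝ 1 (blockSphere p f c r) := by
  have h1 : ContDiff ℝ 1 fun x : ℝ × ℝ => (x.1 : ℂ) := Complex.ofRealCLM.contDiff.comp contDiff_fst
  have h2 : ContDiff ℝ 1 fun x : ℝ × ℝ => (x.2 : ℂ) := Complex.ofRealCLM.contDiff.comp contDiff_snd
  have hcos : ContDiff ℝ 1 fun x : ℝ × ℝ => Complex.cos x.1 :=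
    (Complex.contDiff_cos.restrict_scalars ℝ).comp h1
  have hsin : ContDiff ℝ 1 fun x : ℝ × ℝ => Complex.sin x.1 :=
    (Complex.contDiff_sin.restrict_scalars ℝ).comp h1
  refine contDiff_pi.mpr fun i => contDiff_pi.mpr fun j => ?_
  simp only [blockSphere]
  split_ifs
  · exact contDiff_const.add (contDiff_const.mul (contDiff_const.mul hcos))
  · exact contDiff_const.sub (contDiff_const.mul (contDiff_const.mul hcos))
  · exact (contDiff_const.mul hsin).mul (h2.mul contDiff_const).cexp
  · exact ((contDiff_const.mul hsin).mul (h2.neg.mul contDiff_const).cexp).neg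
  · exact contDiff_const
  · exact contDiff_const

/-- The centre of the block of a traceless matrix, in terms of the other diagonal entries. -/
noncomputable def blockCentre (f : Fin n → ℂ) : ℂ := -(∑ m, f m) / 2

/-- The radius of the block of a traceless matrix of given trace of the square `τ`, in terms of the
other diagonal entries. -/
noncomputable def blockRadius (τ : ℂ) (f : Fin n → ℂ) : ℝ :=
  √((blockCentre f ^ 2 - (τ - ∑ m, f m ^ 2) / 2).re)

/-- The diagonal of `A` outside the block `p`. -/
noncomputable def outerDiag (p : IndexPair n) (A : Matrix (Fin n) (Fin n) ℂ) (m : Fin n) : ℂ :=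
  if m = p.1.1 ∨ m = p.1.2 then 0 else A m m

theorem sum_eq_add_add_sum_outer (p : IndexPair n) (g : Fin n → ℂ) :
    ∑ m, g m = g p.1.1 + g p.1.2 + ∑ m, if m = p.1.1 ∨ m = p.1.2 then 0 else g m := by
  have h : ∀ m, g m = (if m = p.1.1 then g p.1.1 else 0) + (if m = p.1.2 then g p.1.2 else 0)
      + if m = p.1.1 ∨ m = p.1.2 then 0 else g m := by
    intro m
    by_cases h1 : m = p.1.1
    · subst h1
      simp [p.2.ne]
    · by_cases h2 : m = p.1.2
      · subst h2
        simp [p.2.ne']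
      · simp [h1, h2]
  conv_lhs => enter [2, m]; rw [h m]
  rw [Finset.sum_add_distrib, Finset.sum_add_distrib]
  simp

theorem trace_mul_self_eq {A : Matrix (Fin n) (Fin n) ℂ} {p : IndexPair n}
    (hp : ∀ i j, i ≠ j → A i j ≠ 0 →
      (i = p.1.1 ∧ j = p.1.2) ∨ (i = p.1.2 ∧ j = p.1.1)) :
    (A * A).trace = A p.1.1 p.1.1 ^ 2 + A p.1.2 p.1.2 ^ 2 +
      2 * (A p.1.1 p.1.2 * A p.1.2 p.1.1) + ∑ m, outerDiag p A m ^ 2 := by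
  have hz : ∀ i j, i ≠ j → ¬((i = p.1.1 ∧ j = p.1.2) ∨ (i = p.1.2 ∧ j = p.1.1)) → A i j = 0 :=
    fun i j hij h => by
      by_contra h0
      exact h (hp i j hij h0)
  have hin : ∀ m, (A * A) m m = ∑ k, A m k * A k m := fun m => mul_apply
  have hne := p.2.ne
  have h1 : (A * A) p.1.1 p.1.1 = A p.1.1 p.1.1 ^ 2 + A p.1.1 p.1.2 * A p.1.2 p.1.1 := by
    rw [hin, sum_eq_add_add_sum_outer p, Finset.sum_eq_zero, add_zero, sq]
    intro m _
    split_ifs with h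
    · rfl
    · push Not at h
      rw [hz p.1.1 m (Ne.symm h.1) (by simp [h.2, hne]), zero_mul]
  have h2 : (A * A) p.1.2 p.1.2 = A p.1.2 p.1.2 ^ 2 + A p.1.1 p.1.2 * A p.1.2 p.1.1 := by
    rw [hin, sum_eq_add_add_sum_outer p, Finset.sum_eq_zero, add_zero, sq, add_comm, mul_comm
      (A p.1.2 p.1.1)]
    intro m _
    split_ifs with h
    · rfl
    · push Not at h
      rw [hz p.1.2 m (Ne.symm h.2) (by simp [h.1, hne.symm]), zero_mul]
  rw [Matrix.trace]
  simp only [diag_apply]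
  rw [sum_eq_add_add_sum_outer p, h1, h2]
  have h3 : ∀ m, (if m = p.1.1 ∨ m = p.1.2 then 0 else (A * A) m m) = outerDiag p A m ^ 2 := by
    intro m
    rw [outerDiag]
    split_ifs with h
    · simp
    · push Not at h
      rw [hin, Finset.sum_eq_single m, sq]
      · intro k _ hk
        rw [hz m k hk.symm (by simp [h.1, h.2]), zero_mul]
      · simp
  rw [Finset.sum_congr rfl fun m _ => h3 m]
  ring

/-- A matrix with a single edge lies on the sphere of block matrices determined by its outer
diagonal, its trace and the trace of its square. -/
theorem mem_range_blockSphere {A : Matrix (Fin n) (Fin n) ℂ} (hA : A ∈ (groupSU (Fin n)).lie)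
    {p : IndexPair n} (hp : ∀ i j, i ≠ j → A i j ≠ 0 →
      (i = p.1.1 ∧ j = p.1.2) ∨ (i = p.1.2 ∧ j = p.1.1)) :
    A ∈ Set.range (blockSphere p (outerDiag p A) (blockCentre (outerDiag p A))
      (blockRadius (A * A).trace (outerDiag p A))) := by
  set f := outerDiag p A with hf
  set c := blockCentre f with hc
  set r := blockRadius (A * A).trace f with hr
  have hskew := fun i j => apply_eq_neg_conj_of_mem_lie _ hA i j
  have hre : ∀ i, (A i i).re = 0 := fun i => by
    have := congrArg Complex.re (hskew i i)
    simp at this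
    linarith
  have hdiag : ∀ i, A i i = Complex.I * ((A i i).im : ℝ) := fun i => by
    apply Complex.ext <;> simp [hre]
  obtain ⟨⟨i, j⟩, hij⟩ := p
  simp only at *
  have hne : i ≠ j := hij.ne
  set u : ℝ := ((A i i).im - (A j j).im) / 2 with hu
  set w := A i j with hw
  have hw' : A j i = -(starRingEnd ℂ) w := hskew j i
  have htr : A i i + A j j + ∑ m, f m = 0 := by
    have h0 : ∑ m, A m m = 0 := (mem_lie_groupSU_iff.mp hA).2
    rw [sum_eq_add_add_sum_outer ⟨(i, j), hij⟩] at h0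
    exact h0
  have hci : A i i = c + Complex.I * u := by
    rw [hc, blockCentre, hu]
    push_cast
    linear_combination (1 / 2 : ℂ) * htr + (1 / 2 : ℂ) * hdiag i - (1 / 2 : ℂ) * hdiag j
  have hcj : A j j = c - Complex.I * u := by
    rw [hc, blockCentre, hu]
    push_cast
    linear_combination (1 / 2 : ℂ) * htr - (1 / 2 : ℂ) * hdiag i + (1 / 2 : ℂ) * hdiag j
  have hτ := trace_mul_self_eq (p := ⟨(i, j), hij⟩) hp
  simp only at hτ
  let ζ : ℂ := ⟨u, ‖w‖⟩
  have hrζ : r = ‖ζ‖ := by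
    have h1 : blockCentre f ^ 2 - ((A * A).trace - ∑ m, f m ^ 2) / 2 = ((‖ζ‖ ^ 2 : ℝ) : ℂ) := by
      have h2 : ‖ζ‖ ^ 2 = u ^ 2 + ‖w‖ ^ 2 := by
        rw [Complex.sq_norm, Complex.normSq_apply]
        simp only [ζ]
        ring
      have h3 : w * (starRingEnd ℂ) w = ((‖w‖ ^ 2 : ℝ) : ℂ) := by
        rw [Complex.mul_conj, Complex.sq_norm]
      rw [h2, hτ, ← hc, hci, hcj, hw']
      push_cast at h3 ⊢
      linear_combination h3 - (u : ℂ) ^ 2 * Complex.I_sq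
    rw [hr, blockRadius, h1, Complex.ofReal_re, Real.sqrt_sq (norm_nonneg _)]
  have hζ := Complex.norm_mul_cos_add_sin_mul_I ζ
  have hcos : (r : ℂ) * Complex.cos (Complex.arg ζ) = u := by
    have := congrArg Complex.re hζ
    rw [hrζ, ← Complex.ofReal_cos, ← Complex.ofReal_mul, Complex.norm_mul_cos_arg]
  have hsin : (r : ℂ) * Complex.sin (Complex.arg ζ) = ‖w‖ := by
    rw [hrζ, ← Complex.ofReal_sin, ← Complex.ofReal_mul, Complex.norm_mul_sin_arg]
  have hexp : (‖w‖ : ℂ) * Complex.exp (Complex.arg w * Complex.I) = w :=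
    Complex.norm_mul_exp_arg_mul_I w
  have hexp' : (‖w‖ : ℂ) * Complex.exp (-(Complex.arg w) * Complex.I) = (starRingEnd ℂ) w := by
    conv_rhs => rw [← hexp]
    rw [map_mul, ← Complex.exp_conj, map_mul, Complex.conj_I, Complex.conj_ofReal,
      Complex.conj_ofReal, neg_mul, mul_neg]
  refine ⟨(Complex.arg ζ, Complex.arg w), ?_⟩
  funext a b
  simp only [blockSphere]
  rw [hcos, hsin, hexp, hexp']
  split_ifs with h1 h2 h3 h4 h5
  · rw [h1.1, h1.2, hci]
  · rw [h2.1, h2.2, hcj]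
  · rw [h3.1, h3.2]
  · rw [h4.1, h4.2, hw']
  · subst h5
    rw [hf, outerDiag, if_neg]
    rintro (h | h)
    · exact h1 ⟨h, h⟩
    · exact h2 ⟨h, h⟩
  · by_contra h0
    rcases hp a b h5 (Ne.symm h0) with h | h
    · exact h3 h
    · exact h4 h

/-- Coadjoint orbits of `SU(n)` are GKM manifolds: the one-skeleton is contained in a finite union
of points and two-spheres. -/
theorem isGKM_coadjointOrbit (hφ : IsRootSeparating φ) {D : Matrix (Fin n) (Fin n) ℂ}
    (hD : D ∈ (groupSU (Fin n)).lie) :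
    IsGKM (torusAction φ) ((groupSU (Fin n)).coadjointOrbit ((groupSU (Fin n)).traceDual D)) := by
  set M := (groupSU (Fin n)).coadjointOrbit ((groupSU (Fin n)).traceDual D) with hM
  set R := Set.univ.pi fun _ : Fin n => eigenvalueSet D with hR
  have hRf : R.Finite := finite_pi_eigenvalueSet D
  have hconj : ∀ A ∈ (groupSU (Fin n)).lie, (groupSU (Fin n)).traceDual A ∈ M →
      A.charpoly = D.charpoly ∧ (A * A).trace = (D * D).trace := by
    intro A hA hAM
    obtain ⟨k, rfl⟩ := exists_eq_conj_of_mem_coadjointOrbit hA hD hAM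
    have hkk : star (k : Matrix (Fin n) (Fin n) ℂ) * (k : Matrix (Fin n) (Fin n) ℂ) = 1 :=
      (Matrix.mem_unitaryGroup_iff').mp k.2
    constructor
    · rw [charpoly_mul_comm, ← mul_assoc, hkk, one_mul]
    · calc _ = ((k : Matrix (Fin n) (Fin n) ℂ) * D * (star (k : Matrix (Fin n) (Fin n) ℂ) *
            (k : Matrix (Fin n) (Fin n) ℂ)) * D * star (k : Matrix (Fin n) (Fin n) ℂ)).trace := by
            simp only [mul_assoc]
        _ = _ := by
            rw [hkk, mul_one, Matrix.trace_mul_comm, ← mul_assoc, ← mul_assoc, hkk, one_mul]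
  set T := (fun f => (groupSU (Fin n)).traceDual (diagonal f)) '' R with hT
  have hTf : T.Finite := hRf.image _
  have hdiag : ∀ A ∈ (groupSU (Fin n)).lie, (groupSU (Fin n)).traceDual A ∈ M →
      (∀ i j, i ≠ j → A i j = 0) → (groupSU (Fin n)).traceDual A ∈ T := by
    intro A hA hAM hd
    refine ⟨fun i => A i i, fun i _ =>
      apply_self_mem_eigenvalueSet (hconj A hA hAM).1 fun j hj => hd j i hj, ?_⟩
    change (groupSU (Fin n)).traceDual (diagonal fun i => A i i) = _
    congr 1
    ext i j
    by_cases hij : i = j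
    · subst hij; simp
    · rw [diagonal_apply_ne _ hij, hd i j hij]
  constructor
  · refine hTf.subset fun q hq => ?_
    obtain ⟨A, hA, rfl⟩ := (groupSU (Fin n)).exists_mem_lie_traceDual_eq q
    obtain ⟨hAM, hd⟩ := ((frameSU hφ).mem_fixedPts_iff hA).mp hq
    exact hdiag A hA hAM ((frameSU_isDiag_iff hφ A).mp hd)
  · have hsub : oneSkeleton (torusAction φ) M ⊆ T ∪ ⋃ x ∈ (Set.univ : Set (IndexPair n)) ×ˢ R,
        (groupSU (Fin n)).traceDual '' Set.range
          (blockSphere x.1 x.2 (blockCentre x.2) (blockRadius (D * D).trace x.2)) := by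
      intro q hq
      obtain ⟨A, hA, rfl⟩ := (groupSU (Fin n)).exists_mem_lie_traceDual_eq q
      obtain ⟨hAM, he⟩ := (traceDual_mem_oneSkeleton_iff hφ hA M).mp hq
      rcases he.isDiag_or_exists hA with hd | ⟨p, hp⟩
      · exact Or.inl (hdiag A hA hAM hd)
      · right
        refine Set.mem_biUnion (x := (p, outerDiag p A)) ⟨Set.mem_univ _, fun m _ => ?_⟩
          ⟨A, ?_, rfl⟩
        · change outerDiag p A m ∈ eigenvalueSet D
          rw [outerDiag]
          split_ifs with h
          · exact Or.inl rfl
          · push Not at h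
            refine apply_self_mem_eigenvalueSet (hconj A hA hAM).1 fun i hi => ?_
            by_contra h0
            rcases hp i m hi h0 with h1 | h1
            · exact h.2 h1.2
            · exact h.1 h1.2
        · rw [← (hconj A hA hAM).2]
          exact mem_range_blockSphere hA hp
    refine (linDim_mono hsub).trans ?_
    rw [linDim_union, linDim_finite hTf]
    refine max_le (by norm_num) (linDim_biUnion_le (Set.finite_univ.prod hRf).countable ?_)
    intro x _
    refine (linDim_image_range_le (F := Fin n → Fin n → ℂ) (groupSU (Fin n)).traceDual
      (contDiff_blockSphere _ _ _ _)).trans ?_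
    simp

/-- The coadjoint orbits of `SU(n)` with the action of a root-separating torus. -/
theorem isMod2GKM_and_hasRealGKMLocus (hφ : IsRootSeparating φ) (ξ : (groupSU (Fin n)).Dual) :
    IsMod2GKM (torusAction φ) ((groupSU (Fin n)).coadjointOrbit ξ) ∧
      HasRealGKMLocus (torusAction φ) ((groupSU (Fin n)).coadjointOrbit ξ) := by
  obtain ⟨D, hD, hDd, hDm⟩ := (frameSU hφ).exists_isDiag_mem_coadjointOrbit ξ
  rw [← coadjointOrbit_eq_of_mem _ hDm]
  have hDd' := (frameSU_isDiag_iff hφ D).mp hDd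
  have hdiagT : ∀ A : Matrix (Fin n) (Fin n) ℂ, (∀ i j, i ≠ j → A i j = 0) → Aᵀ = A := by
    intro A hA
    ext i j
    by_cases hij : i = j
    · subst hij; rfl
    · rw [transpose_apply, hA i j hij, hA j i (Ne.symm hij)]
  refine ⟨⟨isGKM_coadjointOrbit hφ hD, fun p hp => ?_⟩, (transposeSU n).dualMap,
    isAntisymplecticInvolution_transpose φ (hdiagT D hDd') hD, ?_, ?_⟩
  · obtain ⟨A, hA, rfl⟩ := (groupSU (Fin n)).exists_mem_lie_traceDual_eq p
    exact exists_isotropyWeights_mod2 hφ hA (((frameSU hφ).mem_fixedPts_iff hA).mp hp).2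
  · ext q
    obtain ⟨A, hA, rfl⟩ := (groupSU (Fin n)).exists_mem_lie_traceDual_eq q
    rw [(frameSU hφ).mem_fixedPts_iff hA, frameSU_isDiag_iff]
    refine and_congr_right fun _ => ⟨fun h i j hij => ?_, fun h => ⟨?_, fun g _ => ?_⟩⟩
    · by_contra h0
      obtain ⟨g, hg, hg'⟩ := hφ.exists_ne i j hij
      exact hg' ((coAd_torusAction_eq_self_iff φ g hA).mp (h.2 g hg) i j h0)
    · rw [dualMap_transposeSU_traceDual, hdiagT A h]
    · refine (coAd_torusAction_eq_self_iff φ g hA).mpr fun i j h0 => ?_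
      by_cases hij : i = j
      · rw [hij, div_self']
      · exact absurd (h i j hij) h0
  · ext q
    obtain ⟨A, hA, rfl⟩ := (groupSU (Fin n)).exists_mem_lie_traceDual_eq q
    rw [Set.mem_inter_iff, traceDual_mem_oneSkeleton_iff hφ hA]
    simp only [Set.mem_ofPred_eq]
    rw [encard_image_le_two_iff hφ hA]
    tauto

end GKM

/-! ### The two tori acting on the orbits of the special unitary group -/

section Tori

open CompactMatrixGroup Matrix

variable {n : ℕ}

theorem neg_one_circle_ne_one : (-1 : Circle) ≠ 1 := by
  intro h
  have h1 := congrArg (fun z : Circle => (z : ℂ).re) h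
  norm_num at h1

/-- The element of order two of `T^n` with entry `-1` at `i` only. -/
noncomputable def signFlip (i : Fin n) : Fin n → Circle := fun m => if m = i then -1 else 1

theorem signFlip_sq (i : Fin n) : signFlip i ^ 2 = 1 := by
  funext m
  rw [Pi.pow_apply, signFlip, Pi.one_apply]
  split_ifs
  · exact neg_one_sq
  · exact one_pow 2

theorem signFlip_self (i : Fin n) : signFlip i i = -1 := if_pos rfl

theorem signFlip_of_ne {i m : Fin n} (h : m ≠ i) : signFlip i m = 1 := if_neg h

/-- Distinct pairs are distinguished by an index of one of them. -/
theorem IndexPair.exists_mem_notMem {p q : IndexPair n} (h : p ≠ q) :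
    (p.1.1 ≠ q.1.1 ∧ p.1.1 ≠ q.1.2) ∨ (p.1.2 ≠ q.1.1 ∧ p.1.2 ≠ q.1.2) := by
  obtain ⟨⟨i, j⟩, hij⟩ := p
  obtain ⟨⟨k, l⟩, hkl⟩ := q
  have hij' : i < j := hij
  have hkl' : k < l := hkl
  change (i ≠ k ∧ i ≠ l) ∨ (j ≠ k ∧ j ≠ l)
  by_contra hcon
  have hne : ¬(i = k ∧ j = l) := fun e => h (by
    obtain ⟨rfl, rfl⟩ := e
    rfl)
  clear hij hkl h
  omega

theorem isRootSeparating_id :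
    IsRootSeparating (ContinuousMonoidHom.id (Fin n → Circle)) where
  exists_eq_mul t := ⟨t, 1, fun i => (one_mul _).symm⟩
  exists_ne i j hij := by
    refine ⟨signFlip i, signFlip_sq i, ?_⟩
    change signFlip i i / signFlip i j ≠ 1
    rw [signFlip_self, signFlip_of_ne hij.symm, div_one]
    exact neg_one_circle_ne_one
  exists_div_ne p q hpq := by
    rcases IndexPair.exists_mem_notMem hpq with ⟨h1, h2⟩ | ⟨h1, h2⟩
    · refine ⟨signFlip p.1.1, signFlip_sq _, ?_⟩
      change signFlip p.1.1 p.1.1 / signFlip p.1.1 p.1.2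
        ≠ signFlip p.1.1 q.1.1 / signFlip p.1.1 q.1.2
      rw [signFlip_self, signFlip_of_ne p.2.ne', signFlip_of_ne h1.symm,
        signFlip_of_ne h2.symm, div_one, div_one]
      exact neg_one_circle_ne_one
    · refine ⟨signFlip p.1.2, signFlip_sq _, ?_⟩
      change signFlip p.1.2 p.1.1 / signFlip p.1.2 p.1.2
        ≠ signFlip p.1.2 q.1.1 / signFlip p.1.2 q.1.2
      rw [signFlip_self, signFlip_of_ne p.2.ne, signFlip_of_ne h1.symm,
        signFlip_of_ne h2.symm, div_one, one_div, inv_neg, inv_one]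
      exact neg_one_circle_ne_one

/-- The inclusion of the maximal torus of `SU(n)` in `T^n`. -/
noncomputable def specialTorusIncl (n : ℕ) : specialTorus n →ₜ* (Fin n → Circle) where
  toMonoidHom := (specialTorus n).subtype
  continuous_toFun := continuous_subtype_val

/-- The element of order two of the maximal torus of `SU(n)` with two entries `-1`. -/
theorem exists_specialTorus_two_signs {a b : Fin n} (hab : a ≠ b) :
    ∃ g : specialTorus n, g ^ 2 = 1 ∧ ∀ i, specialTorusIncl n g i
      = if i = a ∨ i = b then -1 else 1 := by
  have hprod : ∀ c : Fin n, ∏ i, signFlip c i = -1 := fun c => by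
    simp [signFlip]
  refine ⟨⟨signFlip a * signFlip b, ?_⟩, ?_, fun i => ?_⟩
  · change ∏ i, (signFlip a i * signFlip b i) = 1
    rw [Finset.prod_mul_distrib, hprod, hprod, neg_mul_neg, one_mul]
  · apply Subtype.ext
    change (signFlip a * signFlip b) ^ 2 = 1
    rw [mul_pow, signFlip_sq, signFlip_sq, one_mul]
  · change signFlip a i * signFlip b i = _
    by_cases h1 : i = a
    · subst h1
      rw [signFlip_self, signFlip_of_ne hab, if_pos (Or.inl rfl), mul_one]
    · by_cases h2 : i = b
      · subst h2
        rw [signFlip_self, signFlip_of_ne hab.symm, if_pos (Or.inr rfl), one_mul]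
      · rw [signFlip_of_ne h1, signFlip_of_ne h2, if_neg (by simp [h1, h2]), one_mul]

/-- For `n = 2` the only root, and for `n = 4` the roots `ε_1 - ε_2` and `ε_3 - ε_4`, violate the
separation property on the maximal torus of `SU(n)`. -/
theorem isRootSeparating_specialTorusIncl (h2 : n ≠ 2) (h4 : n ≠ 4) :
    IsRootSeparating (specialTorusIncl n) where
  exists_eq_mul t := by
    rcases Nat.eq_zero_or_pos n with rfl | hn
    · exact ⟨1, 1, fun i => i.elim0⟩
    · -- `c` is an `n`-th root of the product of the coordinates of `t`.
      let c : Circle := Circle.exp (Complex.arg (∏ i, t i : Circle) / n)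
      have hc : c ^ n = ∏ i, t i := by
        have hn' : (n : ℝ) ≠ 0 := by positivity
        rw [← Circle.exp_nsmul, nsmul_eq_mul, mul_div_cancel₀ _ hn', Circle.exp_arg]
      refine ⟨⟨fun i => t i / c, ?_⟩, c, fun i => (mul_div_cancel c (t i)).symm⟩
      change ∏ i, t i / c = 1
      rw [Finset.prod_div_distrib, Finset.prod_const, Finset.card_univ, Fintype.card_fin, hc,
        div_self']
  exists_ne i j hij := by
    obtain ⟨m, hm⟩ : ∃ m, m ∉ ({i, j} : Finset (Fin n)) := by
      by_contra hcon
      push Not at hcon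
      have h1 := Finset.card_le_card (fun m (_ : m ∈ Finset.univ) => hcon m)
      rw [Finset.card_univ, Fintype.card_fin, Finset.card_pair hij] at h1
      have h5 := i.2
      have h6 := j.2
      have h7 : (i : ℕ) ≠ j := fun e => hij (Fin.ext e)
      omega
    simp only [Finset.mem_insert, Finset.mem_singleton, not_or] at hm
    obtain ⟨g, hg, hgv⟩ := exists_specialTorus_two_signs (Ne.symm hm.1)
    refine ⟨g, hg, ?_⟩
    rw [hgv, hgv, if_pos (Or.inl rfl), if_neg (by
      rintro (h | h)
      · exact hij h.symm
      · exact hm.2 h.symm), div_one]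
    exact neg_one_circle_ne_one
  exists_div_ne p q hpq := by
    obtain ⟨⟨i, j⟩, hij⟩ := p
    obtain ⟨⟨k, l⟩, hkl⟩ := q
    have hij' : i ≠ j := ne_of_lt hij
    have hkl' : k ≠ l := ne_of_lt hkl
    simp only
    -- If the two pairs share an index, change the signs at the first pair.
    by_cases hdisj : i ≠ k ∧ i ≠ l ∧ j ≠ k ∧ j ≠ l
    · obtain ⟨d1, d2, d3, d4⟩ := hdisj
      obtain ⟨m, hm⟩ : ∃ m, m ∉ ({i, j, k, l} : Finset (Fin n)) := by
        by_contra hcon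
        push Not at hcon
        have h1 := Finset.card_le_card (fun m (_ : m ∈ Finset.univ) => hcon m)
        have h3 : ({i, j, k, l} : Finset (Fin n)).card = 4 := by
          rw [Finset.card_insert_of_notMem (by simp [hij', d1, d2]),
            Finset.card_insert_of_notMem (by simp [d3, d4]), Finset.card_pair hkl']
        have h5 := Finset.card_le_univ ({i, j, k, l} : Finset (Fin n))
        rw [Fintype.card_fin] at h5
        rw [Finset.card_univ, Fintype.card_fin] at h1
        omega
      simp only [Finset.mem_insert, Finset.mem_singleton, not_or] at hm
      obtain ⟨m1, m2, m3, m4⟩ := hm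
      obtain ⟨g, hg, hgv⟩ := exists_specialTorus_two_signs (Ne.symm m1)
      refine ⟨g, hg, ?_⟩
      simp only [hgv]
      simp [hij'.symm, d1.symm, d2.symm, Ne.symm m2, Ne.symm m3, Ne.symm m4]
      exact neg_one_circle_ne_one
    · obtain ⟨g, hg, hgv⟩ := exists_specialTorus_two_signs hij'
      refine ⟨g, hg, ?_⟩
      rw [hgv, hgv, hgv, hgv]
      have hne : ¬(i = k ∧ j = l) := fun h => hpq (by
        obtain ⟨rfl, rfl⟩ := h
        rfl)
      by_cases hk : k = i ∨ k = j
      · have hl : ¬(l = i ∨ l = j) := by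
          rcases hk with rfl | rfl <;> rintro (rfl | rfl)
          · exact hkl' rfl
          · exact hne ⟨rfl, rfl⟩
          · exact absurd hkl hij.not_gt
          · exact hkl' rfl
        rw [if_pos hk, if_neg hl]
        simpa using neg_one_circle_ne_one.symm
      · have hl : l = i ∨ l = j := by
          by_contra hl
          push Not at hk hl
          exact hdisj ⟨hk.1.symm, hl.1.symm, hk.2.symm, hl.2.symm⟩
        rw [if_neg hk, if_pos hl]
        simpa using neg_one_circle_ne_one.symm

end Tori

theorem mainTheorem11 :
    -- every coadjoint orbit of `SU(n)`, with the action of the diagonal torus `T^n`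
    (∀ (n : ℕ) (ξ : (groupSU (Fin n)).Dual),
      IsMod2GKM (torusU n) ((groupSU (Fin n)).coadjointOrbit ξ) ∧
      HasRealGKMLocus (torusU n) ((groupSU (Fin n)).coadjointOrbit ξ)) ∧
    -- the same with the maximal torus of `SU(n)` itself
    (∀ n : ℕ, n ≠ 2 → n ≠ 4 → ∀ ξ : (groupSU (Fin n)).Dual,
      IsMod2GKM (torusSU n) ((groupSU (Fin n)).coadjointOrbit ξ) ∧
      HasRealGKMLocus (torusSU n) ((groupSU (Fin n)).coadjointOrbit ξ)) ∧
    -- type `B_n`: `SO(2n+1)`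
    (∀ n : ℕ, 2 ≤ n → ∀ ξ : (groupSO ((Fin n ⊕ Fin n) ⊕ Unit)).Dual,
      (groupSO ((Fin n ⊕ Fin n) ⊕ Unit)).IsMaximalOrbit ξ →
        ¬ IsMod2GKM (torusSOOdd n) ((groupSO ((Fin n ⊕ Fin n) ⊕ Unit)).coadjointOrbit ξ) ∧
        HasCongruentWeights (torusSOOdd n)
          ((groupSO ((Fin n ⊕ Fin n) ⊕ Unit)).coadjointOrbit ξ)) ∧
    -- type `C_n`: `Sp(n)`
    (∀ n : ℕ, 2 ≤ n → ∀ ξ : (groupSp (Fin n)).Dual,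
      (groupSp (Fin n)).IsMaximalOrbit ξ →
        ¬ IsMod2GKM (torusSp n) ((groupSp (Fin n)).coadjointOrbit ξ) ∧
        HasCongruentWeights (torusSp n) ((groupSp (Fin n)).coadjointOrbit ξ)) ∧
    -- type `D_n`: `SO(2n)`
    (∀ n : ℕ, 3 ≤ n → ∀ ξ : (groupSO (Fin n ⊕ Fin n)).Dual,
      (groupSO (Fin n ⊕ Fin n)).IsMaximalOrbit ξ →
        ¬ IsMod2GKM (torusSOEven n) ((groupSO (Fin n ⊕ Fin n)).coadjointOrbit ξ) ∧
        HasCongruentWeights (torusSOEven n)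
          ((groupSO (Fin n ⊕ Fin n)).coadjointOrbit ξ)) := by
  refine ⟨fun n ξ => isMod2GKM_and_hasRealGKMLocus isRootSeparating_id ξ,
    fun n h2 h4 ξ => isMod2GKM_and_hasRealGKMLocus (isRootSeparating_specialTorusIncl h2 h4) ξ,
    fun n hn ξ hξ => (frameSOOdd n).not_isMod2GKM_and_hasCongruentWeights hn
      (fun a b h => frameSOOdd_weights a b h) hξ,
    fun n hn ξ hξ => (frameSp n).not_isMod2GKM_and_hasCongruentWeights hn
      (fun a b h => frameSp_weights a b h) hξ,
    fun n hn ξ hξ => (frameSOEven n).not_isMod2GKM_and_hasCongruentWeights (by omega)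
      (fun a b h => frameSOEven_weights a b h) hξ⟩
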